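/- Let $m,\hbar>0$ and $q,\mu''\in\mathbb R$. Let $\phi:\mathbb R^3\to\mathbb R$ and $\mathbf A:\mathbb R^3\to\mathbb R^3$ be smooth static potentials whose fields $\mathbf E=-\nabla\phi$ and $\mathbf B=\nabla\times\mathbf A$ are constant. All operators act on $C_c^\infty(\mathbb R^3;\mathbb C^2)$, $\dagger$ is the formal adjoint for the $L^2$ pairing, $\boldsymbol\sigma$ are the Pauli matrices, $\mathbf p=-i\hbar\nabla$, $\boldsymbol\pi=\mathbf p-\frac qc\mathbf A$ and $\mu'=\mu''/c$. Everything is a formal Laurent series in $1/c$ with operator coefficients ($m,\hbar,q,\mu'',\phi,\mathbf A,\mathbf E,\mathbf B$ being independent of $c$), and a function $f(1+T)$ of a formal series $T$ in $1/c$ without constant term means $\sum_n \frac{f^{(n)}(1)}{n!}T^n$. In particular $\gamma_\pi=\sqrt{1+(\boldsymbol\pi/mc)^2}$ and $\sqrt{m^2c^4+c^2\boldsymbol\pi^2}=mc^2\gamma_\pi$. The Dirac–Pauli Hamiltonian is $$\tilde{\mathcal H}=\begin{pmatrix} mc^2+q\phi-\mu'\boldsymbol\sigma\cdot\mathbf B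 & c\,\boldsymbol\sigma\cdot\boldsymbol\pi+i\mu'\boldsymbol\sigma\cdot\mathbf E\\ c\,\boldsymbol\sigma\cdot\boldsymbol\pi-i\mu'\boldsymbol\sigma\cdot\mathbf E & -mc^2+q\phi+\mu'\boldsymbol\sigma\cdot\mathbf B\end{pmatrix}.$$ For $t\in\mathbb R$ replace $(\phi,\mathbf A,\mathbf E,\mathbf B)$ by $(t\phi,t\mathbf A,t\mathbf E,t\mathbf B)$. "$S=T+O(F_{\mu\nu}^n)$" means that, for each power of $1/c$, each wave function $f$ and each point $x$, the coefficients satisfy $(S_kf)(x)-(T_kf)(x)=O(t^n)$ as $t\to0$. 1. For each $t$ there is exactly one formal power series $\mathcal X$ in $1/c$ with $$2mc^2\mathcal X=-\mathcal X c\,\boldsymbol\sigma\cdot\boldsymbol\pi\,\mathcal X+c\,\boldsymbol\sigma\cdot\boldsymbol\pi+q[\phi,\mathcal X]-i\mu'\boldsymbol\sigma\cdot\mathbf E-i\mu'\mathcal X\,\boldsymbol\sigma\cdot\mathbf E\,\mathcal X+\mu'\{\mathcal X,\boldsymbol\sigma\cdot\mathbf B\}.$$ It has no constant term, and it has exactly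 one formal adjoint $\mathcal X^\dagger$. Write $\mathcal X=X+X'$, where $X$ is the solution for $\mu''=0$. Then $X'=O(F_{\mu\nu})$. 2. With $\mathcal Y=(1+\mathcal X^\dagger\mathcal X)^{-1/2}$ and $\mathcal Z=(1+\mathcal X\mathcal X^\dagger)^{-1/2}$, the matrix $\tilde U=\begin{pmatrix}\mathcal Y&\mathcal Y\mathcal X^\dagger\\-\mathcal Z\mathcal X&\mathcal Z\end{pmatrix}$ is unitary ($\tilde U\tilde U^\dagger=\tilde U^\dagger\tilde U=1$), the off-diagonal blocks of $\tilde U\tilde{\mathcal H}\tilde U^\dagger$ vanish, and its upper left block $\mathcal H_{\rm FW}$ is formally self-adjoint (so its anti-Hermitian part vanishes) and equals $$mc^2+\sqrt{1+\mathcal X^\dagger\mathcal X}\,\big(q\phi+c\,\boldsymbol\sigma\cdot\boldsymbol\pi\,\mathcal X-\mu'\boldsymbol\sigma\cdot\mathbf B+i\mu'\boldsymbol\sigma\cdot\mathbf E\,\mathcal X\big)\frac1{\sqrt{1+\mathcal X^\dagger\mathcal X}}.$$ 3. Up to terms linear in the fields, $\mathcal H_{\rm FW}=\mathcal H_{\rm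 wf}+O(F_{\mu\nu}^2)$, where $$\mathcal H_{\rm wf}=\sqrt{m^2c^4+c^2\boldsymbol\pi^2}+q\phi-\boldsymbol\sigma\cdot\Big[\Big(\mu'+\frac{q\hbar}{2mc}\frac1{\gamma_\pi}\Big)\mathbf B-\mu'\frac1{\gamma_\pi(1+\gamma_\pi)}\Big(\frac{\boldsymbol\pi}{mc}\cdot\mathbf B\Big)\frac{\boldsymbol\pi}{mc}-\Big(\mu'\frac1{\gamma_\pi}+\frac{q\hbar}{2mc}\frac1{\gamma_\pi(1+\gamma_\pi)}\Big)\Big(\frac{\boldsymbol\pi}{mc}\times\mathbf E\Big)\Big].$$ 4. (Classical correspondence.) The classical Lorentz-force Hamiltonian plus the Thomas–Bargmann–Michel–Telegdi spin Hamiltonian, for spin $\mathbf s$ and anomalous gyromagnetic ratio $\gamma_m'$, is $$\sqrt{m^2c^4+c^2\boldsymbol\pi^2}+q\phi-\mathbf s\cdot\Big[\Big(\gamma_m'+\frac q{mc}\frac1{\gamma_\pi}\Big)\mathbf B-\gamma_m'\frac1{\gamma_\pi(1+\gamma_\pi)}\Big(\frac{\boldsymbol\pi}{mc}\cdot\mathbf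 B\Big)\frac{\boldsymbol\pi}{mc}-\Big(\gamma_m'\frac1{\gamma_\pi}+\frac q{mc}\frac1{\gamma_\pi(1+\gamma_\pi)}\Big)\Big(\frac{\boldsymbol\pi}{mc}\times\mathbf E\Big)\Big].$$ Read as a formal series in $1/c$ (with $c\gamma_m'$ independent of $c$) and evaluated at the operators $\phi$, $\boldsymbol\pi$, $\mathbf s=\frac\hbar2\boldsymbol\sigma$ with $\mu'=\frac\hbar2\gamma_m'$, it is exactly $\mathcal H_{\rm wf}$. Evaluated at real $c>0$, $\phi$, $\mathbf E,\mathbf B,\boldsymbol\pi,\mathbf s$ with $\boldsymbol\pi^2<m^2c^2$, the series converges to the classical Hamiltonian. 5. (Dirac Hamiltonian.) For $\mu'=0$ (so that $\mathcal X=X$), $$H_{\rm FW}=q\phi+\sqrt{m^2c^4+c^2\boldsymbol\pi^2}-\frac{q\hbar}{2mc}\frac1{\gamma_\pi}\boldsymbol\sigma\cdot\mathbf B+\frac{q\hbar}{2mc}\Big(\frac1{\gamma_\pi}-\frac1{1+\gamma_\pi}\Big)\boldsymbol\sigma\cdot\Big(\frac{\boldsymbol\pi}{mc}\times\mathbf E\Big)+O(F_{\mu\nu}^2),$$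 and $\mathcal H_{\rm wf}$ at $\mu'=0$ equals the displayed right-hand side exactly. -/

import Mathlib

open scoped Matrix Topology ContDiff Distributions

noncomputable section

namespace DiracPauli

/-! ### Formal series in `1/c`

`PowerSeries R` is the ring of formal power series in the central variable `κ = 1/c` over a
(noncommutative) ring `R`, and `LaurentSeries R` is the ring of formal Laurent series in `κ`, in
which `c = κ⁻¹` is an element. -/

/-- The speed of light `c`, as the formal Laurent series `κ⁻¹`. -/
def light (R : Type*) [Ring R] : LaurentSeries R := HahnSeries.single (-1) 1

/-- The inverse `1/c` of the speed of light, as a formal Laurent series. -/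
def invLight (R : Type*) [Ring R] : LaurentSeries R := HahnSeries.single 1 1

/-- A formal power series in `1/c`, seen as a formal Laurent series in `1/c`. -/
def toLaurent {R : Type*} [Ring R] : PowerSeries R →+* LaurentSeries R :=
  HahnSeries.ofPowerSeries ℤ R

/-- An element of `R`, seen as a constant (`c`-independent) Laurent series. -/
def const {R : Type*} [Ring R] : R →+* LaurentSeries R :=
  toLaurent.comp PowerSeries.C

/-- The function `f(1 + T)` of a formal series `T` in `1/c` without constant term, understood
through the Taylor series of `f` at `1`: `f(1 + T) = ∑ₙ f⁽ⁿ⁾(1)/n! Tⁿ`.  The coefficient of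
`(1/c)ᵏ` in `Tⁿ` vanishes for `n > k`, so that the sum is finite at every order. -/
def taylorOnePlus {R : Type*} [Ring R] [Algebra ℝ R] (f : ℝ → ℝ) (T : PowerSeries R) :
    PowerSeries R :=
  PowerSeries.mk fun k =>
    ∑ n ∈ Finset.range (k + 1), (iteratedDeriv n f 1 / (n.factorial : ℝ)) • PowerSeries.coeff k (T ^ n)

/-- The cross product, with the factors of each product kept in order. -/
def cross {R : Type*} [Ring R] (a b : Fin 3 → R) : Fin 3 → R :=
  ![a 1 * b 2 - a 2 * b 1, a 2 * b 0 - a 0 * b 2, a 0 * b 1 - a 1 * b 0]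

/-- A real vector as a vector of scalar Laurent series. -/
def realVec (R : Type*) [Ring R] [Algebra ℝ R] (v : Fin 3 → ℝ) : Fin 3 → LaurentSeries R :=
  fun i => const (algebraMap ℝ R (v i))

/-- `f(γ²)` where `γ² = 1 + (π/(mc))²`; e.g. `gammaFun m π Real.sqrt` is the Lorentz factor. -/
def gammaFun {R : Type*} [Ring R] [Algebra ℝ R] (m : ℝ) (π : Fin 3 → PowerSeries R)
    (f : ℝ → ℝ) : LaurentSeries R :=
  toLaurent (taylorOnePlus f ((1 / m ^ 2) • (PowerSeries.X ^ 2 * (π ⬝ᵥ π))))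

/-- `γ` -/
def lorentz {R : Type*} [Ring R] [Algebra ℝ R] (m : ℝ) (π : Fin 3 → PowerSeries R) :
    LaurentSeries R :=
  gammaFun m π fun u => √u

/-- `1/γ` -/
def invLorentz {R : Type*} [Ring R] [Algebra ℝ R] (m : ℝ) (π : Fin 3 → PowerSeries R) :
    LaurentSeries R :=
  gammaFun m π fun u => 1 / √u

/-- `1/(1+γ)` -/
def invOneAddLorentz {R : Type*} [Ring R] [Algebra ℝ R] (m : ℝ) (π : Fin 3 → PowerSeries R) :
    LaurentSeries R :=
  gammaFun m π fun u => 1 / (1 + √u)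

/-- `1/(γ(1+γ))` -/
def invLorentzMul {R : Type*} [Ring R] [Algebra ℝ R] (m : ℝ) (π : Fin 3 → PowerSeries R) :
    LaurentSeries R :=
  gammaFun m π fun u => 1 / (√u * (1 + √u))

/-- The kinetic energy `√(m²c⁴ + c²π²) = mc² √(1 + (π/(mc))²)`. -/
def kineticEnergy {R : Type*} [Ring R] [Algebra ℝ R] (m : ℝ) (π : Fin 3 → PowerSeries R) :
    LaurentSeries R :=
  m • (light R ^ 2 * lorentz m π)

/-! ### The classical Hamiltonian -/

/-- The classical Lorentz-force Hamiltonian `√(m²c⁴ + c²π²) + qφ` plus the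
Thomas-Bargmann-Michel-Telegdi spin Hamiltonian, for a particle of mass `m`, charge `q`, anomalous
gyromagnetic ratio `g`, kinematic momentum `π` and spin `s`. -/
def classicalHamiltonian (m c q g : ℝ) (φ : ℝ) (E B π s : Fin 3 → ℝ) : ℝ :=
  let γ : ℝ := √(1 + (π ⬝ᵥ π) / (m * c) ^ 2)
  let u : Fin 3 → ℝ := (1 / (m * c)) • π
  √(m ^ 2 * c ^ 4 + c ^ 2 * (π ⬝ᵥ π)) + q * φ
    - s ⬝ᵥ ((g + q / (m * c) * (1 / γ)) • B
        - (g * (1 / (γ * (1 + γ))) * (u ⬝ᵥ B)) • u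
        - (g * (1 / γ) + q / (m * c) * (1 / (γ * (1 + γ)))) • cross u E)

/-- The same expression in formal series in `1/c`, for `φ`, `π`, `s` in an arbitrary
`ℝ`-algebra (real numbers, or operators), with anomalous gyromagnetic ratio `g/c`. -/
def formalHamiltonian {R : Type*} [Ring R] [Algebra ℝ R] (m q g : ℝ) (φ : R) (E B : Fin 3 → ℝ)
    (π : Fin 3 → PowerSeries R) (s : Fin 3 → R) : LaurentSeries R :=
  let γ' : LaurentSeries R := g • invLight R
  let e : LaurentSeries R := (q / m) • invLight R
  let u : Fin 3 → LaurentSeries R := fun i => (1 / m) • (invLight R * toLaurent (π i))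
  kineticEnergy m π + q • const φ
    - ∑ i, const (s i) *
        ((γ' + e * invLorentz m π) * realVec R B i
          - γ' * invLorentzMul m π * (u ⬝ᵥ realVec R B) * u i
          - (γ' * invLorentz m π + e * invLorentzMul m π) * cross u (realVec R E) i)

/-! ### Operators on spinor wave functions -/

/-- Euclidean three-space. -/
abbrev Space : Type := EuclideanSpace ℝ (Fin 3)

/-- Two-component spinor wave functions: smooth, compactly supported functions on `ℝ³` with
values in `ℂ²`. -/
abbrev Spinor : Type := 𝓓((⊤ : TopologicalSpace.Opens Space), Fin 2 → ℂ)

/-- Linear operators on spinor wave functions. -/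
abbrev Op : Type := Module.End ℂ Spinor

/-- The `i`-th partial derivative. -/
def partialDeriv {F : Type*} [NormedAddCommGroup F] [NormedSpace ℝ F] (i : Fin 3)
    (f : Space → F) (x : Space) : F :=
  fderiv ℝ f x (EuclideanSpace.single i 1)

/-- The Pauli matrices. -/
def pauli : Fin 3 → Matrix (Fin 2) (Fin 2) ℂ :=
  ![!![0, 1; 1, 0], !![0, -Complex.I; Complex.I, 0], !![1, 0; 0, -1]]

/-- Multiplication of spinors by a constant `2 × 2` matrix. -/
def matrixOp (M : Matrix (Fin 2) (Fin 2) ℂ) : Op where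
  toFun f :=
    { toFun := fun x => M *ᵥ f x
      contDiff' := by
        have h : ContDiff ℝ ∞ (f : Space → Fin 2 → ℂ) := f.contDiff
        exact ((M.mulVecLin.restrictScalars ℝ).toContinuousLinearMap).contDiff.comp h
      hasCompactSupport' :=
        f.hasCompactSupport.comp_left (g := fun v => M *ᵥ v) (Matrix.mulVec_zero M)
      tsupport_subset' := by simp }
  map_add' f g := by
    ext x : 1
    exact Matrix.mulVec_add M (f x) (g x)
  map_smul' a f := by
    ext x : 1
    exact Matrix.mulVec_smul M a (f x)

/-- The spin operators `σᵢ`. -/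
def sigma (i : Fin 3) : Op := matrixOp (pauli i)

/-- Multiplication of spinors by a smooth real function. -/
def mulOp (a : Space → ℝ) (ha : ContDiff ℝ ∞ a) : Op where
  toFun f :=
    { toFun := fun x => a x • f x
      contDiff' := by
        have h : ContDiff ℝ ∞ (f : Space → Fin 2 → ℂ) := f.contDiff
        have h1 : ContDiff ℝ ∞ fun x => a x • f x := ha.smul h
        exact h1
      hasCompactSupport' := HasCompactSupport.smul_left (f := a) f.hasCompactSupport
      tsupport_subset' := by simp }
  map_add' f g := by
    ext x : 1
    exact smul_add (a x) (f x) (g x)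
  map_smul' z f := by
    ext x : 1
    exact smul_comm (a x) z (f x)

/-- The canonical momentum operators `pᵢ = -iħ ∂ᵢ`. -/
def momentum (ħ : ℝ) (i : Fin 3) : Op where
  toFun f :=
    { toFun := fun x => (-Complex.I * (ħ : ℂ)) • partialDeriv i f x
      contDiff' := by
        have h : ContDiff ℝ ∞ (f : Space → Fin 2 → ℂ) := f.contDiff
        have h1 : ContDiff ℝ ∞ (partialDeriv i f) :=
          (h.fderiv_right (m := ∞) (by simp)).clm_apply contDiff_const
        exact h1.const_smul (-Complex.I * (ħ : ℂ))
      hasCompactSupport' := by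
        have h1 : HasCompactSupport (partialDeriv i f) :=
          (f.hasCompactSupport.fderiv (𝕜 := ℝ)).comp_left
            (g := fun L : Space →L[ℝ] (Fin 2 → ℂ) => L (EuclideanSpace.single i 1)) rfl
        exact h1.smul_left (f := fun _ => -Complex.I * (ħ : ℂ))
      tsupport_subset' := by simp }
  map_add' f g := by
    have hf : Differentiable ℝ (f : Space → Fin 2 → ℂ) := f.contDiff.differentiable (by simp)
    have hg : Differentiable ℝ (g : Space → Fin 2 → ℂ) := g.contDiff.differentiable (by simp)
    ext x : 1
    change (-Complex.I * (ħ : ℂ)) • fderiv ℝ ((f : Space → Fin 2 → ℂ) + (g : Space → Fin 2 → ℂ)) x _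
      = (-Complex.I * (ħ : ℂ)) • fderiv ℝ f x _ + (-Complex.I * (ħ : ℂ)) • fderiv ℝ g x _
    rw [fderiv_add (hf x) (hg x), ← smul_add]
    rfl
  map_smul' z f := by
    have hf : Differentiable ℝ (f : Space → Fin 2 → ℂ) := f.contDiff.differentiable (by simp)
    ext x : 1
    change (-Complex.I * (ħ : ℂ)) • fderiv ℝ (z • (f : Space → Fin 2 → ℂ)) x _
      = z • ((-Complex.I * (ħ : ℂ)) • fderiv ℝ f x _)
    rw [fderiv_const_smul (hf x), smul_comm z]
    rfl

/-- `T` is a formal adjoint of `S`: `⟨S f, g⟩ = ⟨f, T g⟩` for all wave functions `f`, `g`. -/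
def IsFormalAdjoint (S T : Op) : Prop :=
  ∀ f g : Spinor, ∫ x, star (S f x) ⬝ᵥ g x = ∫ x, star (f x) ⬝ᵥ T g x

/-- Formal adjointness of Laurent series in the real variable `1/c`, coefficient by coefficient. -/
def IsSeriesAdjoint (S T : LaurentSeries Op) : Prop :=
  ∀ k : ℤ, IsFormalAdjoint (S.coeff k) (T.coeff k)

/-! ### Static homogeneous fields -/

/-- A static homogeneous electromagnetic field: smooth time-independent potentials `φ`, `A` whose
fields `E = -∇φ` and `B = ∇ × A` are constant. -/
structure HomogeneousField where
  φ : Space → ℝ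
  A : Fin 3 → Space → ℝ
  E : Fin 3 → ℝ
  B : Fin 3 → ℝ
  smooth_φ : ContDiff ℝ ∞ φ
  smooth_A : ∀ i, ContDiff ℝ ∞ (A i)
  electric : ∀ x i, E i = -partialDeriv i φ x
  magnetic : ∀ x, B = ![partialDeriv 1 (A 2) x - partialDeriv 2 (A 1) x,
    partialDeriv 2 (A 0) x - partialDeriv 0 (A 2) x,
    partialDeriv 0 (A 1) x - partialDeriv 1 (A 0) x]

theorem partialDeriv_const_mul (t : ℝ) (i : Fin 3) (f : Space → ℝ) (hf : ContDiff ℝ ∞ f)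
    (x : Space) : partialDeriv i (fun y => t * f y) x = t * partialDeriv i f x := by
  have h : Differentiable ℝ f := hf.differentiable (by simp)
  simp [partialDeriv, fderiv_const_mul (h x)]

/-- The field `(tφ, tA, tE, tB)`. -/
def HomogeneousField.scale (F : HomogeneousField) (t : ℝ) : HomogeneousField where
  φ x := t * F.φ x
  A i x := t * F.A i x
  E := t • F.E
  B := t • F.B
  smooth_φ := contDiff_const.mul F.smooth_φ
  smooth_A i := contDiff_const.mul (F.smooth_A i)
  electric x i := by
    rw [partialDeriv_const_mul t i F.φ F.smooth_φ]
    simp [F.electric x i]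
  magnetic x := by
    simp only [fun i j => partialDeriv_const_mul t i (F.A j) (F.smooth_A j) x]
    rw [F.magnetic x]
    ext i
    fin_cases i <;> simp [mul_sub]

/-- The potential `φ` as an operator. -/
def potential (F : HomogeneousField) : Op := mulOp F.φ F.smooth_φ

/-- The kinematic momentum `π = p - (q/c) A`. -/
def kinematic (ħ q : ℝ) (F : HomogeneousField) (i : Fin 3) : PowerSeries Op :=
  PowerSeries.C (momentum ħ i) - PowerSeries.X * PowerSeries.C (q • mulOp (F.A i) (F.smooth_A i))

/-- `π` as a vector of Laurent series. -/
def kinematicL (ħ q : ℝ) (F : HomogeneousField) (i : Fin 3) : LaurentSeries Op :=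
  toLaurent (kinematic ħ q F i)

/-- The spin vector `σ` as a vector of Laurent series. -/
def sigmaL (i : Fin 3) : LaurentSeries Op := const (sigma i)

/-- `σ·π` -/
def sigmaPi (ħ q : ℝ) (F : HomogeneousField) : LaurentSeries Op := sigmaL ⬝ᵥ kinematicL ħ q F

/-- `σ·E` -/
def sigmaE (F : HomogeneousField) : LaurentSeries Op := sigmaL ⬝ᵥ realVec Op F.E

/-- `σ·B` -/
def sigmaB (F : HomogeneousField) : LaurentSeries Op := sigmaL ⬝ᵥ realVec Op F.B

/-- `qφ` -/
def qPhi (q : ℝ) (F : HomogeneousField) : LaurentSeries Op := q • const (potential F)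

/-- The anomalous magnetic moment `μ' = μ''/c`, with `μ''` independent of `c`. -/
def muPrime (μ : ℝ) : LaurentSeries Op := μ • invLight Op

/-! ### Kutzelnigg's Foldy-Wouthuysen transformation -/

/-- The rest energy `mc²`. -/
def restEnergy (m : ℝ) : LaurentSeries Op := m • light Op ^ 2

/-- The Dirac-Pauli Hamiltonian, in `2 × 2` blocks:
`[[mc² + qφ - μ'σ·B, cσ·π + iμ'σ·E], [cσ·π - iμ'σ·E, -mc² + qφ + μ'σ·B]]`. -/
def hamiltonian (m ħ q μ : ℝ) (F : HomogeneousField) :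
    Matrix (Fin 2) (Fin 2) (LaurentSeries Op) :=
  !![restEnergy m + qPhi q F - muPrime μ * sigmaB F,
      light Op * sigmaPi ħ q F + Complex.I • (muPrime μ * sigmaE F);
    light Op * sigmaPi ħ q F - Complex.I • (muPrime μ * sigmaE F),
      -restEnergy m + qPhi q F + muPrime μ * sigmaB F]

/-- Kutzelnigg's condition on `𝒳 = ∑ 𝒳ⱼ/cʲ`:
`2mc²𝒳 = -𝒳 cσ·π 𝒳 + cσ·π + q[φ, 𝒳] - iμ'σ·E - iμ'𝒳 σ·E 𝒳 + μ'{𝒳, σ·B}`. -/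
def KutzelniggCondition (m ħ q μ : ℝ) (F : HomogeneousField) (𝒳 : PowerSeries Op) : Prop :=
  let x : LaurentSeries Op := toLaurent 𝒳
  (2 : ℝ) • (restEnergy m * x) =
    -(x * (light Op * sigmaPi ħ q F) * x) + light Op * sigmaPi ħ q F
      + (qPhi q F * x - x * qPhi q F)
      - Complex.I • (muPrime μ * sigmaE F)
      - Complex.I • (muPrime μ * (x * sigmaE F * x))
      + muPrime μ * (x * sigmaB F + sigmaB F * x)

/-- `(1 + S T)^(-1/2)` -/
def invSqrt (S T : PowerSeries Op) : LaurentSeries Op :=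
  toLaurent (taylorOnePlus (fun u => 1 / √u) (S * T))

/-- Kutzelnigg's `U = [[𝒴, 𝒴𝒳†], [-𝒵𝒳, 𝒵]]`, where `𝒴 = (1 + 𝒳†𝒳)^(-1/2)` and
`𝒵 = (1 + 𝒳𝒳†)^(-1/2)`; `Xd` is `𝒳†`. -/
def transform (𝒳 Xd : PowerSeries Op) : Matrix (Fin 2) (Fin 2) (LaurentSeries Op) :=
  !![invSqrt Xd 𝒳, invSqrt Xd 𝒳 * toLaurent Xd;
    -(invSqrt 𝒳 Xd * toLaurent 𝒳), invSqrt 𝒳 Xd]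

/-- `U† = [[𝒴, -𝒳†𝒵], [𝒳𝒴, 𝒵]]`. -/
def transformAdjoint (𝒳 Xd : PowerSeries Op) : Matrix (Fin 2) (Fin 2) (LaurentSeries Op) :=
  !![invSqrt Xd 𝒳, -(toLaurent Xd * invSqrt 𝒳 Xd);
    toLaurent 𝒳 * invSqrt Xd 𝒳, invSqrt 𝒳 Xd]

/-- The transformed Hamiltonian `U H U†`. -/
def transformed (m ħ q μ : ℝ) (F : HomogeneousField) (𝒳 Xd : PowerSeries Op) :
    Matrix (Fin 2) (Fin 2) (LaurentSeries Op) :=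
  transform 𝒳 Xd * hamiltonian m ħ q μ F * transformAdjoint 𝒳 Xd

/-- The Foldy-Wouthuysen Hamiltonian of the particle: the upper left block of `U H U†`. -/
def fwHamiltonian (m ħ q μ : ℝ) (F : HomogeneousField) (𝒳 Xd : PowerSeries Op) :
    LaurentSeries Op :=
  transformed m ħ q μ F 𝒳 Xd 0 0

/-- `mc² + √(1+𝒳†𝒳) (qφ + cσ·π𝒳 - μ'σ·B + iμ'σ·E𝒳) (1+𝒳†𝒳)^(-1/2)` -/
def kutzelniggHamiltonian (m ħ q μ : ℝ) (F : HomogeneousField) (𝒳 Xd : PowerSeries Op) :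
    LaurentSeries Op :=
  restEnergy m + toLaurent (taylorOnePlus (fun u => √u) (Xd * 𝒳)) *
    (qPhi q F + light Op * sigmaPi ħ q F * toLaurent 𝒳 - muPrime μ * sigmaB F
      + Complex.I • (muPrime μ * sigmaE F * toLaurent 𝒳)) * invSqrt Xd 𝒳

/-- Equality modulo terms of order `tⁿ` as `t → 0`, at each order in `1/c`, for each wave
function and at each point. -/
def EqModOrder (n : ℕ) (S T : ℝ → LaurentSeries Op) : Prop :=
  ∀ (k : ℤ) (f : Spinor) (x : Space),
    (fun t : ℝ => (S t).coeff k f x - (T t).coeff k f x) =O[𝓝 0] fun t : ℝ => t ^ n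

/-! ### The weak-field Hamiltonians -/

/-- The vector `π/(mc)`. -/
def unitKinematic (m ħ q : ℝ) (F : HomogeneousField) (i : Fin 3) : LaurentSeries Op :=
  (1 / m) • (invLight Op * kinematicL ħ q F i)

/-- The weak-field Foldy-Wouthuysen Hamiltonian of the Dirac-Pauli theory,
`√(m²c⁴ + c²π²) + qφ - σ·[(μ' + qħ/(2mc) 1/γ) B - μ' 1/(γ(1+γ)) (π/(mc)·B) π/(mc)
  - (μ' 1/γ + qħ/(2mc) 1/(γ(1+γ))) (π/(mc) × E)]`. -/
def weakFieldDiracPauli (m ħ q μ : ℝ) (F : HomogeneousField) : LaurentSeries Op :=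
  let π := kinematic ħ q F
  let u := unitKinematic m ħ q F
  let e : LaurentSeries Op := (q * ħ / (2 * m)) • invLight Op
  kineticEnergy m π + qPhi q F
    - sigmaL ⬝ᵥ fun i =>
        (muPrime μ + e * invLorentz m π) * realVec Op F.B i
          - muPrime μ * invLorentzMul m π * (u ⬝ᵥ realVec Op F.B) * u i
          - (muPrime μ * invLorentz m π + e * invLorentzMul m π) * cross u (realVec Op F.E) i

/-- The weak-field Foldy-Wouthuysen Hamiltonian of the Dirac theory,
`qφ + √(m²c⁴ + c²π²) - qħ/(2mc) 1/γ σ·B + qħ/(2mc) (1/γ - 1/(1+γ)) σ·(π/(mc) × E)`. -/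
def weakFieldDirac (m ħ q : ℝ) (F : HomogeneousField) : LaurentSeries Op :=
  let π := kinematic ħ q F
  let u := unitKinematic m ħ q F
  let e : LaurentSeries Op := (q * ħ / (2 * m)) • invLight Op
  qPhi q F + kineticEnergy m π - e * invLorentz m π * sigmaB F
    + e * (invLorentz m π - invOneAddLorentz m π) * (sigmaL ⬝ᵥ cross u (realVec Op F.E))

end DiracPauli

end

/-! Divided by `c²`, the blocks of the Hamiltonian are power series in `X = 1/c`, and Kutzelnigg's
condition becomes `x = X * Ψ x` with a map `Ψ` that never looks ahead: the coefficient of `x` at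
order `k` is determined by those below `k`. This X-adic contraction gives existence, uniqueness and
the vanishing constant term. Formal adjunction reverses products and `i`, which has the same effect
on the equation as reversing `φ` and `E`; hence `𝒳†` is the solution of the reversed system
(`adjointSeries_solution`). The equations of `𝒳` and `𝒳†` cancel the two off-diagonal blocks of `U H
U†`. The rest of the exact statement is algebra of `2 × 2` blocks (`block_unitary`,
`block_diagonal`).

The weak-field expansion uses only commutation relations (`System.Laws`). They persist when the
fields are multiplied by a polynomial variable `t`, and by uniqueness the solution commutes with
homomorphisms of the coefficients. It therefore suffices to compare coefficients of `t⁰` and `t¹`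
over `Polynomial R`: `zerothPart` is a ring homomorphism and `firstPart` a derivation over it. At
each order in `1/c` one has a polynomial in `t`, so evaluation at real `t` turns equal coefficients
into `O(t²)`.

In units of `mc²`, put `U = σ·π/(mc)`, `Γ = √(1 + U²)` and `W = 1/(1 + Γ)`. Without `φ` and `μ'`,
the product `U W` solves the condition exactly. To first order the correction `δ` satisfies `Γδ + δΓ
= ρ`. Since the fields are constant, `[φ, U]`, `σ·E` and `σ·B` commute with `p²` at this order, so
`ρ` commutes with the free `Γ` and `δ = ρ/(2Γ)`. The transformed Hamiltonian is `Γ` plus a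
first-order term, and conjugation by the normalization matters only through its commutator with `φ`
(`firstOrder_weak`, `weak_identity`).

The Pauli identity `U² = (π/(mc))² - (qħ/(m²c³)) σ·B` replaces `Γ` by `γ_π` and produces the
magnetic term of the Dirac theory. The double commutator of `U` with `φ` gives its spin-orbit term;
the commutator of `U` with `iμ'σ·E` and the anticommutator of `U` with `μ'σ·B` give the anomalous
terms (`System.fw_parts`).

The classical series is the same expression with the factor `ħ/2` moved into the spin. It converges
because the functions of `γ²` involved are holomorphic on the disc `|z - 1| < 1`, and `π² < m²c²`
puts `γ²` inside this disc. -/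

namespace DiracPauli

/-! ### X-adic contractions and their fixed points. -/

section Agree

variable {R : Type*} [Ring R]

/-- Two power series agree below order `n`. -/
def AgreeBelow (n : ℕ) (a b : PowerSeries R) : Prop :=
  ∀ k < n, PowerSeries.coeff k a = PowerSeries.coeff k b

theorem AgreeBelow.add {n : ℕ} {a b a' b' : PowerSeries R} (h : AgreeBelow n a b)
    (h' : AgreeBelow n a' b') : AgreeBelow n (a + a') (b + b') := fun k hk => by
  simp [h k hk, h' k hk]

theorem AgreeBelow.sub {n : ℕ} {a b a' b' : PowerSeries R} (h : AgreeBelow n a b)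
    (h' : AgreeBelow n a' b') : AgreeBelow n (a - a') (b - b') := fun k hk => by
  simp [h k hk, h' k hk]

theorem AgreeBelow.refl (n : ℕ) (a : PowerSeries R) : AgreeBelow n a a := fun _ _ => rfl

theorem AgreeBelow.mul {n : ℕ} {a b a' b' : PowerSeries R} (h : AgreeBelow n a b)
    (h' : AgreeBelow n a' b') : AgreeBelow n (a * a') (b * b') := fun k hk => by
  rw [PowerSeries.coeff_mul, PowerSeries.coeff_mul]
  refine Finset.sum_congr rfl fun p hp => ?_
  have := Finset.HasAntidiagonal.mem_antidiagonal.1 hp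
  rw [h p.1 (by omega), h' p.2 (by omega)]

theorem AgreeBelow.smul {S : Type*} [CommSemiring S] [Algebra S R] {n : ℕ} {a b : PowerSeries R} (r : S)
    (h : AgreeBelow n a b) : AgreeBelow n (r • a) (r • b) := fun k hk => by
  rw [PowerSeries.coeff_smul, PowerSeries.coeff_smul, h k hk]

theorem AgreeBelow.X_mul {n : ℕ} {a b : PowerSeries R} (h : AgreeBelow n a b) :
    AgreeBelow (n + 1) (PowerSeries.X * a) (PowerSeries.X * b) := by
  rintro (_ | k) hk
  · simp
  · simp [PowerSeries.coeff_succ_X_mul, h k (by omega)]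

theorem eq_of_agreeBelow {a b : PowerSeries R} (h : ∀ n, AgreeBelow n a b) : a = b :=
  PowerSeries.ext fun k => h (k + 1) k (by omega)

theorem agreeBelow_zero (a b : PowerSeries R) : AgreeBelow 0 a b := fun _ hk => by omega

/-- A map of power series is causal if the coefficients of the image below order `n` depend only
on those of the argument below order `n`. -/
def Causal (Ψ : PowerSeries R → PowerSeries R) : Prop :=
  ∀ n a b, AgreeBelow n a b → AgreeBelow n (Ψ a) (Ψ b)

/-- The fixed point of `x ↦ X * Ψ x`. -/
noncomputable def fixedSeries (Ψ : PowerSeries R → PowerSeries R) : PowerSeries R :=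
  PowerSeries.mk fun k => PowerSeries.coeff k ((fun x => PowerSeries.X * Ψ x)^[k + 1] 0)

/-- Every application of `X * Ψ` gains one order, so after `n` steps the starting point is forgotten
below order `n`. -/
theorem Causal.agree_iterate {Ψ : PowerSeries R → PowerSeries R} (h : Causal Ψ) (n : ℕ)
    (a b : PowerSeries R) :
    AgreeBelow n ((fun x => PowerSeries.X * Ψ x)^[n] a) ((fun x => PowerSeries.X * Ψ x)^[n] b) := by
  induction n with
  | zero => exact agreeBelow_zero _ _
  | succ n ih =>
    rw [Function.iterate_succ_apply', Function.iterate_succ_apply']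
    exact (h _ _ _ ih).X_mul

/-- The coefficient of order `k` is frozen from step `k + 1` on: `r` further steps only change the
starting point of the last `k + 1`. -/
theorem Causal.agree_fixedSeries {Ψ : PowerSeries R → PowerSeries R} (h : Causal Ψ) (n : ℕ) :
    AgreeBelow n (fixedSeries Ψ) ((fun x => PowerSeries.X * Ψ x)^[n] 0) := by
  intro k hk
  obtain ⟨r, rfl⟩ := Nat.exists_eq_add_of_lt hk
  rw [fixedSeries, PowerSeries.coeff_mk, show k + r + 1 = (k + 1) + r by omega,
    Function.iterate_add_apply _ (k + 1) r]
  exact h.agree_iterate (k + 1) _ _ k (by omega)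

theorem Causal.fixedSeries_eq {Ψ : PowerSeries R → PowerSeries R} (h : Causal Ψ) :
    fixedSeries Ψ = PowerSeries.X * Ψ (fixedSeries Ψ) := by
  refine eq_of_agreeBelow fun n => ?_
  have h1 := h.agree_fixedSeries (n + 1)
  have h2 := (h _ _ _ (h.agree_fixedSeries n)).X_mul
  rw [Function.iterate_succ_apply'] at h1
  intro k hk
  rw [h1 k (by omega), h2 k (by omega)]

theorem Causal.unique {Ψ : PowerSeries R → PowerSeries R} (h : Causal Ψ) {a b : PowerSeries R}
    (ha : a = PowerSeries.X * Ψ a) (hb : b = PowerSeries.X * Ψ b) : a = b := by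
  refine eq_of_agreeBelow fun n => ?_
  induction n with
  | zero => exact agreeBelow_zero _ _
  | succ n ih =>
    rw [ha, hb]
    exact (h _ _ _ ih).X_mul

end Agree

/-! ### The Sylvester equation for power series. -/

section Sylvester

variable {R : Type*} [Ring R] [Algebra ℝ R]

theorem eq_zero_of_add_self {x : R} (h : x + x = 0) : x = 0 := by
  have h2 : (2 : ℝ) • x = 0 := by rw [two_smul, h]
  simpa using h2

/-- If the coefficients of `z` below order `n` vanish, order `n` of the equation reads `z_n + z_n =
0`. This replaces the division by noncommuting quantities throughout: a quantity is identified by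
exhibiting a Sylvester equation that it satisfies. -/
theorem sylvester_eq_zero {a b z : PowerSeries R} (ha : PowerSeries.constantCoeff a = 1)
    (hb : PowerSeries.constantCoeff b = 1) (h : a * z + z * b = 0) : z = 0 := by
  ext n
  induction n using Nat.strong_induction_on with
  | _ n ih =>
    have h0 := congrArg (PowerSeries.coeff n) h
    rw [map_add, PowerSeries.coeff_mul, PowerSeries.coeff_mul,
      Finset.sum_eq_single (0, n), Finset.sum_eq_single (n, 0)] at h0
    · simp only [PowerSeries.coeff_zero_eq_constantCoeff_apply, ha, hb, one_mul, mul_one,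
        map_zero] at h0
      simpa using eq_zero_of_add_self h0
    · intro p hp hne
      have := Finset.HasAntidiagonal.mem_antidiagonal.1 hp
      rw [ih p.1 (by rcases p with ⟨i, j⟩; simp at this hne ⊢; omega)]
      simp
    · intro hh; simp at hh
    · intro p hp hne
      have := Finset.HasAntidiagonal.mem_antidiagonal.1 hp
      rw [ih p.2 (by rcases p with ⟨i, j⟩; simp at this hne ⊢; omega)]
      simp
    · intro hh; simp at hh

end Sylvester

/-! ### Functional calculus by Taylor series at `1`. -/

section Taylor

variable {R : Type*} [Ring R] [Algebra ℝ R]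

theorem coeff_pow_eq_zero {R : Type*} [Ring R] {T : PowerSeries R} (hT : PowerSeries.constantCoeff T = 0) {k n : ℕ}
    (h : k < n) : PowerSeries.coeff k (T ^ n) = 0 := by
  obtain ⟨w, rfl⟩ := PowerSeries.X_dvd_iff.2 hT
  rw [(PowerSeries.commute_X w).symm.mul_pow, PowerSeries.coeff_X_pow_mul', if_neg (by omega)]

/-- The formal Taylor series of `f` at `1`. -/
noncomputable def formalTaylor (f : ℝ → ℝ) : PowerSeries ℝ :=
  PowerSeries.mk fun n => iteratedDeriv n f 1 / (n.factorial : ℝ)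

theorem coeff_taylorOnePlus {T : PowerSeries R} (hT : PowerSeries.constantCoeff T = 0)
    (f : ℝ → ℝ) {k N : ℕ} (h : k < N) :
    PowerSeries.coeff k (taylorOnePlus f T) = ∑ n ∈ Finset.range N,
      PowerSeries.coeff n (formalTaylor f) • PowerSeries.coeff k (T ^ n) := by
  rw [taylorOnePlus, PowerSeries.coeff_mk]
  simp only [formalTaylor, PowerSeries.coeff_mk]
  refine Finset.sum_subset (by simpa using h) fun n _ hn => ?_
  rw [coeff_pow_eq_zero hT (by simpa using hn), smul_zero]

/-- Since `T ^ n` is divisible by `X ^ n`, only the Taylor coefficients below `N` are seen below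
order `N`, and `f(1 + T)` may be replaced by a polynomial in `T`. Identities between functions thus
reduce to polynomial algebra, valid in any noncommutative ring because a single element `T` occurs.
-/
theorem agreeBelow_aeval {T : PowerSeries R} (hT : PowerSeries.constantCoeff T = 0) (f : ℝ → ℝ)
    (p : Polynomial ℝ) {N : ℕ} (h : AgreeBelow N (p : PowerSeries ℝ) (formalTaylor f)) :
    AgreeBelow N (Polynomial.aeval T p) (taylorOnePlus f T) := by
  intro k hk
  rw [coeff_taylorOnePlus hT f (N := max N (p.natDegree + 1)) (by omega),
    Polynomial.aeval_eq_sum_range' (n := max N (p.natDegree + 1)) (by omega), map_sum]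
  refine Finset.sum_congr rfl fun n _ => ?_
  rw [PowerSeries.coeff_smul]
  by_cases hn : n < N
  · rw [← h n hn, Polynomial.coeff_coe]
  · rw [coeff_pow_eq_zero hT (by omega), smul_zero, smul_zero]

theorem formalTaylor_mul {f g : ℝ → ℝ} (hf : ContDiffAt ℝ ∞ f 1) (hg : ContDiffAt ℝ ∞ g 1) :
    formalTaylor (fun u => f u * g u) = formalTaylor f * formalTaylor g := by
  ext n
  simp only [formalTaylor, PowerSeries.coeff_mk, PowerSeries.coeff_mul]
  rw [iteratedDeriv_fun_mul (hf.of_le (by exact_mod_cast le_top)) (hg.of_le (by exact_mod_cast le_top)),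
    Finset.Nat.sum_antidiagonal_eq_sum_range_succ_mk, Finset.sum_div]
  refine Finset.sum_congr rfl fun i hi => ?_
  have hi' : i ≤ n := by simpa [Nat.lt_succ_iff] using hi
  rw [Nat.cast_choose ℝ hi']
  have h1 : (n.factorial : ℝ) ≠ 0 := by positivity
  have h2 : (i.factorial : ℝ) ≠ 0 := by positivity
  have h3 : ((n - i).factorial : ℝ) ≠ 0 := by positivity
  field_simp

/-- Leibniz's rule at `1` makes the formal Taylor series multiplicative, and polynomial truncations
in `T` inherit this. With `taylorOnePlus_congr`, every identity between functions that holds near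
`1` passes to series. -/
theorem taylorOnePlus_mul {T : PowerSeries R} (hT : PowerSeries.constantCoeff T = 0)
    {f g : ℝ → ℝ} (hf : ContDiffAt ℝ ∞ f 1) (hg : ContDiffAt ℝ ∞ g 1) :
    taylorOnePlus (fun u => f u * g u) T = taylorOnePlus f T * taylorOnePlus g T := by
  refine eq_of_agreeBelow fun N => ?_
  have key : ∀ h : ℝ → ℝ, AgreeBelow N ((PowerSeries.trunc N (formalTaylor h) : Polynomial ℝ) : PowerSeries ℝ)
      (formalTaylor h) := fun h k hk => by
    rw [Polynomial.coeff_coe, PowerSeries.coeff_trunc, if_pos hk]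
  have h1 := (agreeBelow_aeval hT f _ (key f)).mul (agreeBelow_aeval hT g _ (key g))
  rw [← map_mul] at h1
  have h2 := agreeBelow_aeval hT (fun u => f u * g u)
    (PowerSeries.trunc N (formalTaylor f) * PowerSeries.trunc N (formalTaylor g)) (N := N) (by
      rw [formalTaylor_mul hf hg, Polynomial.coe_mul]
      exact (key f).mul (key g))
  intro k hk
  rw [← h1 k hk, h2 k hk]

theorem taylorOnePlus_congr {f g : ℝ → ℝ} (h : f =ᶠ[𝓝 1] g) (T : PowerSeries R) :
    taylorOnePlus f T = taylorOnePlus g T := by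
  unfold taylorOnePlus
  simp only [fun n => h.iteratedDeriv_eq n]

theorem taylorOnePlus_add {f g : ℝ → ℝ} (hf : ContDiffAt ℝ ∞ f 1) (hg : ContDiffAt ℝ ∞ g 1)
    (T : PowerSeries R) :
    taylorOnePlus (fun u => f u + g u) T = taylorOnePlus f T + taylorOnePlus g T := by
  ext k
  simp only [taylorOnePlus, map_add, PowerSeries.coeff_mk, ← Finset.sum_add_distrib]
  refine Finset.sum_congr rfl fun n _ => ?_
  rw [iteratedDeriv_fun_add (hf.of_le (by exact_mod_cast le_top)) (hg.of_le (by exact_mod_cast le_top)),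
    add_div, add_smul]

theorem taylorOnePlus_const (c : ℝ) (T : PowerSeries R) :
    taylorOnePlus (fun _ => c) T = c • 1 := by
  ext k
  simp only [taylorOnePlus, PowerSeries.coeff_mk, iteratedDeriv_const, PowerSeries.coeff_smul]
  rw [Finset.sum_eq_single 0]
  · simp
  · intro n _ hn; simp [hn]
  · simp

theorem taylorOnePlus_id {T : PowerSeries R} (hT : PowerSeries.constantCoeff T = 0) :
    taylorOnePlus (fun u => u) T = 1 + T := by
  refine eq_of_agreeBelow fun N => ?_
  have h := agreeBelow_aeval hT (fun u => u) (1 + Polynomial.X) (N := N) (by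
    intro k _
    simp only [formalTaylor, PowerSeries.coeff_mk, Polynomial.coe_add, Polynomial.coe_one,
      Polynomial.coe_X, map_add, PowerSeries.coeff_one, PowerSeries.coeff_X]
    rcases k with _ | _ | k
    · simp
    · simp
    · simp [iteratedDeriv_succ'])
  intro k hk
  rw [← h k hk]
  simp

theorem constantCoeff_taylorOnePlus (f : ℝ → ℝ) (T : PowerSeries R) :
    PowerSeries.constantCoeff (taylorOnePlus f T) = f 1 • 1 := by
  rw [← PowerSeries.coeff_zero_eq_constantCoeff_apply, taylorOnePlus, PowerSeries.coeff_mk]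
  simp

theorem map_taylorOnePlus {S : Type*} [Ring S] [Algebra ℝ S] (g : R →ₐ[ℝ] S) (f : ℝ → ℝ)
    (T : PowerSeries R) :
    PowerSeries.map (g : R →+* S) (taylorOnePlus f T)
      = taylorOnePlus f (PowerSeries.map (g : R →+* S) T) := by
  ext k
  simp [taylorOnePlus, ← map_pow]

theorem commute_taylorOnePlus (f : ℝ → ℝ) {T z : PowerSeries R}
    (hT : PowerSeries.constantCoeff T = 0) (h : Commute z T) :
    Commute z (taylorOnePlus f T) := by
  refine eq_of_agreeBelow fun N => ?_
  have key : AgreeBelow N ((PowerSeries.trunc N (formalTaylor f) : Polynomial ℝ) : PowerSeries ℝ)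
      (formalTaylor f) := fun k hk => by
    rw [Polynomial.coeff_coe, PowerSeries.coeff_trunc, if_pos hk]
  have h1 := agreeBelow_aeval hT f _ key
  have hc : Commute z (Polynomial.aeval T (PowerSeries.trunc N (formalTaylor f))) := by
    rw [Polynomial.aeval_eq_sum_range]
    exact Commute.sum_right _ _ _ fun i _ => (h.pow_right i).smul_right _
  have h2 := (AgreeBelow.refl N z).mul h1
  have h3 := h1.mul (AgreeBelow.refl N z)
  intro k hk
  rw [← h2 k hk, ← h3 k hk, hc.eq]

theorem contDiffAt_sqrt_one : ContDiffAt ℝ ∞ (fun u : ℝ => √u) 1 :=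
  Real.contDiffAt_sqrt one_ne_zero

theorem contDiffAt_inv_sqrt_one : ContDiffAt ℝ ∞ (fun u : ℝ => 1 / √u) 1 :=
  contDiffAt_const.div contDiffAt_sqrt_one (by simp)

theorem contDiffAt_inv_one_add_sqrt_one : ContDiffAt ℝ ∞ (fun u : ℝ => 1 / (1 + √u)) 1 :=
  contDiffAt_const.div (contDiffAt_const.add contDiffAt_sqrt_one) (by norm_num)

theorem contDiffAt_inv_sqrt_mul_one : ContDiffAt ℝ ∞ (fun u : ℝ => 1 / (√u * (1 + √u))) 1 :=
  contDiffAt_const.div (contDiffAt_sqrt_one.mul (contDiffAt_const.add contDiffAt_sqrt_one))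
    (by norm_num)

theorem eventually_pos_one : ∀ᶠ u : ℝ in 𝓝 1, 0 < u := eventually_gt_nhds one_pos

theorem taylor_sqrt_mul_self {T : PowerSeries R} (hT : PowerSeries.constantCoeff T = 0) :
    taylorOnePlus (fun u => √u) T * taylorOnePlus (fun u => √u) T = 1 + T := by
  rw [← taylorOnePlus_mul hT contDiffAt_sqrt_one contDiffAt_sqrt_one, ← taylorOnePlus_id hT]
  refine taylorOnePlus_congr ?_ T
  filter_upwards [eventually_pos_one] with u hu
  exact Real.mul_self_sqrt hu.le

theorem taylor_sqrt_mul_inv {T : PowerSeries R} (hT : PowerSeries.constantCoeff T = 0) :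
    taylorOnePlus (fun u => √u) T * taylorOnePlus (fun u => 1 / √u) T = 1 := by
  rw [← taylorOnePlus_mul hT contDiffAt_sqrt_one contDiffAt_inv_sqrt_one]
  refine (taylorOnePlus_congr ?_ T).trans ((taylorOnePlus_const 1 T).trans (one_smul _ _))
  filter_upwards [eventually_pos_one] with u hu
  have := Real.sqrt_pos.2 hu
  field_simp

theorem taylor_inv_mul_sqrt {T : PowerSeries R} (hT : PowerSeries.constantCoeff T = 0) :
    taylorOnePlus (fun u => 1 / √u) T * taylorOnePlus (fun u => √u) T = 1 := by
  rw [(commute_taylorOnePlus (fun u => √u) hT (commute_taylorOnePlus (fun u => 1 / √u) hT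
    (Commute.refl T)).symm).eq, taylor_sqrt_mul_inv hT]

theorem taylor_one_add_mul_inv {T : PowerSeries R} (hT : PowerSeries.constantCoeff T = 0) :
    (1 + taylorOnePlus (fun u => √u) T) * taylorOnePlus (fun u => 1 / (1 + √u)) T = 1 := by
  have h1 : (1 : PowerSeries R) = taylorOnePlus (fun _ => 1) T := by
    rw [taylorOnePlus_const, one_smul]
  nth_rewrite 1 [h1]
  rw [← taylorOnePlus_add contDiffAt_const contDiffAt_sqrt_one,
    ← taylorOnePlus_mul hT (contDiffAt_const.add contDiffAt_sqrt_one)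
      contDiffAt_inv_one_add_sqrt_one]
  refine (taylorOnePlus_congr ?_ T).trans ((taylorOnePlus_const 1 T).trans (one_smul _ _))
  filter_upwards [eventually_pos_one] with u hu
  have := Real.sqrt_pos.2 hu
  field_simp

theorem taylor_inv_sqrt_mul {T : PowerSeries R} (hT : PowerSeries.constantCoeff T = 0) :
    taylorOnePlus (fun u => 1 / (√u * (1 + √u))) T
      = taylorOnePlus (fun u => 1 / √u) T * taylorOnePlus (fun u => 1 / (1 + √u)) T := by
  rw [← taylorOnePlus_mul hT contDiffAt_inv_sqrt_one contDiffAt_inv_one_add_sqrt_one]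
  refine taylorOnePlus_congr ?_ T
  filter_upwards [eventually_pos_one] with u hu
  have := Real.sqrt_pos.2 hu
  field_simp

theorem taylor_inv_sqrt_mul_add (T : PowerSeries R) :
    taylorOnePlus (fun u => 1 / (√u * (1 + √u))) T + taylorOnePlus (fun u => 1 / (1 + √u)) T
      = taylorOnePlus (fun u => 1 / √u) T := by
  rw [← taylorOnePlus_add contDiffAt_inv_sqrt_mul_one contDiffAt_inv_one_add_sqrt_one]
  refine taylorOnePlus_congr ?_ T
  filter_upwards [eventually_pos_one] with u hu
  have := Real.sqrt_pos.2 hu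
  field_simp

end Taylor

/-! ### Commutation relations of the operators on spinors. -/

section Operators

open MeasureTheory

theorem spinor_contDiff (f : Spinor) : ContDiff ℝ ∞ (f : Space → Fin 2 → ℂ) := f.contDiff

theorem matrixOp_apply (M : Matrix (Fin 2) (Fin 2) ℂ) (f : Spinor) (x : Space) :
    matrixOp M f x = M *ᵥ f x := rfl

theorem mulOp_apply (a : Space → ℝ) (ha : ContDiff ℝ ∞ a) (f : Spinor) (x : Space) :
    mulOp a ha f x = a x • f x := rfl

theorem momentum_apply (ħ : ℝ) (i : Fin 3) (f : Spinor) (x : Space) :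
    momentum ħ i f x = (-Complex.I * (ħ : ℂ)) • partialDeriv i f x := rfl

theorem op_ext {S T : Op} (h : ∀ (f : Spinor) (x : Space), S f x = T f x) : S = T := by
  refine LinearMap.ext fun f => ?_
  ext x : 1
  exact h f x

theorem add_op_apply (S T : Op) (f : Spinor) (x : Space) : (S + T) f x = S f x + T f x := rfl
theorem sub_op_apply (S T : Op) (f : Spinor) (x : Space) : (S - T) f x = S f x - T f x := rfl
theorem mul_op_apply (S T : Op) (f : Spinor) : (S * T) f = S (T f) := rfl
theorem smul_op_apply (r : ℝ) (S : Op) (f : Spinor) (x : Space) : (r • S) f x = r • S f x := rfl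
theorem csmul_op_apply (r : ℂ) (S : Op) (f : Spinor) (x : Space) : (r • S) f x = r • S f x := rfl

theorem matrixOp_mul (M N : Matrix (Fin 2) (Fin 2) ℂ) :
    matrixOp M * matrixOp N = matrixOp (M * N) :=
  op_ext fun f x => by
    rw [mul_op_apply, matrixOp_apply, matrixOp_apply, matrixOp_apply, Matrix.mulVec_mulVec]

theorem matrixOp_one : matrixOp 1 = 1 :=
  op_ext fun f x => by rw [matrixOp_apply, Matrix.one_mulVec]; rfl

theorem matrixOp_smul (z : ℂ) (M : Matrix (Fin 2) (Fin 2) ℂ) :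
    matrixOp (z • M) = z • matrixOp M :=
  op_ext fun f x => by
    rw [csmul_op_apply, matrixOp_apply, matrixOp_apply, Matrix.smul_mulVec]

theorem partialDeriv_clm_comp {F G : Type*} [NormedAddCommGroup F] [NormedSpace ℝ F]
    [NormedAddCommGroup G] [NormedSpace ℝ G] (L : F →L[ℝ] G) (i : Fin 3) (f : Space → F)
    (hf : ContDiff ℝ ∞ f) (x : Space) :
    partialDeriv i (fun y => L (f y)) x = L (partialDeriv i f x) := by
  have h : DifferentiableAt ℝ f x := hf.differentiable (by simp) x
  unfold partialDeriv
  have h1 : HasFDerivAt (fun y => L (f y)) (L.comp (fderiv ℝ f x)) x :=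
    L.hasFDerivAt.comp x h.hasFDerivAt
  rw [h1.fderiv]
  rfl

theorem partialDeriv_smul {F : Type*} [NormedAddCommGroup F] [NormedSpace ℝ F] (i : Fin 3)
    (a : Space → ℝ) (f : Space → F) (ha : ContDiff ℝ ∞ a) (hf : ContDiff ℝ ∞ f) (x : Space) :
    partialDeriv i (fun y => a y • f y) x = a x • partialDeriv i f x + partialDeriv i a x • f x := by
  have h : DifferentiableAt ℝ f x := hf.differentiable (by simp) x
  have h' : DifferentiableAt ℝ a x := ha.differentiable (by simp) x
  unfold partialDeriv
  rw [fderiv_fun_smul h' h]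
  rfl

theorem partialDeriv_partialDeriv_comm {F : Type*} [NormedAddCommGroup F] [NormedSpace ℝ F]
    (i j : Fin 3) (f : Space → F) (hf : ContDiff ℝ ∞ f) (x : Space) :
    partialDeriv i (partialDeriv j f) x = partialDeriv j (partialDeriv i f) x := by
  have h2 : IsSymmSndFDerivAt ℝ f x := hf.contDiffAt.isSymmSndFDerivAt (by
    simpa using (by exact_mod_cast le_top : ((2 : ℕ∞) : WithTop ℕ∞) ≤ ∞))
  have key : ∀ i j : Fin 3, partialDeriv i (partialDeriv j f) x
      = fderiv ℝ (fderiv ℝ f) x (EuclideanSpace.single i 1) (EuclideanSpace.single j 1) := by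
    intro i j
    have hd : DifferentiableAt ℝ (fderiv ℝ f) x :=
      ((hf.fderiv_right (m := ∞) (by simp)).differentiable (by simp)) x
    change fderiv ℝ (fun y => fderiv ℝ f y (EuclideanSpace.single j 1)) x _ = _
    rw [fderiv_clm_apply hd (differentiableAt_const _)]
    simp
  rw [key, key]
  exact h2.eq _ _

theorem matrixOp_commute_mulOp (M : Matrix (Fin 2) (Fin 2) ℂ) (a : Space → ℝ)
    (ha : ContDiff ℝ ∞ a) : Commute (matrixOp M) (mulOp a ha) :=
  op_ext fun f x => by
    simp only [mul_op_apply, matrixOp_apply, mulOp_apply, Matrix.mulVec_smul]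

theorem matrixOp_commute_momentum (M : Matrix (Fin 2) (Fin 2) ℂ) (ħ : ℝ) (i : Fin 3) :
    Commute (matrixOp M) (momentum ħ i) :=
  op_ext fun f x => by
    simp only [mul_op_apply, matrixOp_apply, momentum_apply, Matrix.mulVec_smul]
    congr 1
    exact (partialDeriv_clm_comp ((M.mulVecLin.restrictScalars ℝ).toContinuousLinearMap) i f
      (spinor_contDiff f) x).symm

theorem momentum_commute (ħ : ℝ) (i j : Fin 3) : Commute (momentum ħ i) (momentum ħ j) :=
  op_ext fun f x => by
    have key : ∀ i j : Fin 3, momentum ħ i (momentum ħ j f) x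
        = (-Complex.I * (ħ : ℂ)) • (-Complex.I * (ħ : ℂ)) • partialDeriv i (partialDeriv j f) x := by
      intro i j
      rw [momentum_apply]
      congr 1
      have h1 : ContDiff ℝ ∞ (partialDeriv j (f : Space → Fin 2 → ℂ)) :=
        ((spinor_contDiff f).fderiv_right (m := ∞) (by simp)).clm_apply contDiff_const
      exact partialDeriv_clm_comp
        ((LinearMap.lsmul ℂ (Fin 2 → ℂ) (-Complex.I * (ħ : ℂ))).restrictScalars
          ℝ).toContinuousLinearMap i _ h1 x
    rw [mul_op_apply, mul_op_apply, key, key,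
      partialDeriv_partialDeriv_comm i j _ (spinor_contDiff f)]

theorem mulOp_commute (a b : Space → ℝ) (ha : ContDiff ℝ ∞ a) (hb : ContDiff ℝ ∞ b) :
    Commute (mulOp a ha) (mulOp b hb) :=
  op_ext fun f x => by
    simp only [mul_op_apply, mulOp_apply, smul_comm (a x)]

theorem partialDeriv_contDiff {F : Type*} [NormedAddCommGroup F] [NormedSpace ℝ F] (i : Fin 3)
    {a : Space → F} (ha : ContDiff ℝ ∞ a) : ContDiff ℝ ∞ (partialDeriv i a) :=
  (ha.fderiv_right (m := ∞) (by simp)).clm_apply contDiff_const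

theorem momentum_mulOp (ħ : ℝ) (i : Fin 3) (a : Space → ℝ) (ha : ContDiff ℝ ∞ a) :
    momentum ħ i * mulOp a ha - mulOp a ha * momentum ħ i
      = (-Complex.I * (ħ : ℂ)) • mulOp (partialDeriv i a) (partialDeriv_contDiff i ha) :=
  op_ext fun f x => by
    rw [sub_op_apply, mul_op_apply, mul_op_apply, csmul_op_apply, mulOp_apply, mulOp_apply,
      momentum_apply, momentum_apply]
    have h : partialDeriv i (mulOp a ha f : Space → Fin 2 → ℂ) x
        = a x • partialDeriv i f x + partialDeriv i a x • f x :=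
      partialDeriv_smul i a f ha (spinor_contDiff f) x
    rw [h, smul_add, smul_comm (a x) (-Complex.I * (ħ : ℂ)), add_sub_cancel_left]

end Operators

/-! ### Formal adjoints for the `L²` pairing. -/

section Adjoint

open MeasureTheory

theorem integrable_pairing (f g : Spinor) :
    Integrable (fun x : Space => star (f x) ⬝ᵥ g x) := by
  have hf := (spinor_contDiff f).continuous
  have hg := (spinor_contDiff g).continuous
  refine Continuous.integrable_of_hasCompactSupport ?_ ?_
  · simp only [dotProduct, Pi.star_apply]
    fun_prop
  · refine g.hasCompactSupport.mono' ?_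
    refine (Function.support_subset_iff'.2 fun x hx => ?_)
    have : g x = 0 := image_eq_zero_of_notMem_tsupport hx
    simp [this]

theorem IsFormalAdjoint.add {S T S' T' : Op} (h : IsFormalAdjoint S T)
    (h' : IsFormalAdjoint S' T') : IsFormalAdjoint (S + S') (T + T') := by
  intro f g
  simp only [add_op_apply, star_add, add_dotProduct, dotProduct_add]
  rw [integral_add (integrable_pairing _ _) (integrable_pairing _ _),
    integral_add (integrable_pairing _ _) (integrable_pairing _ _), h f g, h' f g]

theorem IsFormalAdjoint.csmul {S T : Op} (z : ℂ) (h : IsFormalAdjoint S T) :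
    IsFormalAdjoint (z • S) (star z • T) := by
  intro f g
  simp only [csmul_op_apply, star_smul, smul_dotProduct, dotProduct_smul]
  rw [integral_smul, integral_smul, h f g]

theorem IsFormalAdjoint.smul {S T : Op} (r : ℝ) (h : IsFormalAdjoint S T) :
    IsFormalAdjoint (r • S) (r • T) := by
  intro f g
  simp only [smul_op_apply, star_smul, smul_dotProduct, dotProduct_smul, star_trivial]
  rw [integral_smul, integral_smul, h f g]

theorem IsFormalAdjoint.mul {S T S' T' : Op} (h : IsFormalAdjoint S T)
    (h' : IsFormalAdjoint S' T') : IsFormalAdjoint (S * S') (T' * T) := by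
  intro f g
  rw [mul_op_apply, mul_op_apply, h, h']

theorem isFormalAdjoint_zero : IsFormalAdjoint 0 0 := by
  intro f g
  simp

theorem isFormalAdjoint_one : IsFormalAdjoint 1 1 := fun _ _ => rfl

theorem IsFormalAdjoint.symm {S T : Op} (h : IsFormalAdjoint S T) : IsFormalAdjoint T S := by
  intro f g
  have h1 := congrArg (starRingEnd ℂ) (h g f)
  rw [← integral_conj, ← integral_conj] at h1
  have key : ∀ a b : Fin 2 → ℂ, (starRingEnd ℂ) (star a ⬝ᵥ b) = star b ⬝ᵥ a := by
    intro a b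
    rw [Matrix.star_dotProduct a b]
    simp
  simp only [key] at h1
  exact h1.symm

theorem isFormalAdjoint_mulOp (a : Space → ℝ) (ha : ContDiff ℝ ∞ a) :
    IsFormalAdjoint (mulOp a ha) (mulOp a ha) := by
  intro f g
  simp only [mulOp_apply, star_smul, smul_dotProduct, dotProduct_smul, star_trivial]

theorem isFormalAdjoint_matrixOp {M : Matrix (Fin 2) (Fin 2) ℂ} (hM : M.IsHermitian) :
    IsFormalAdjoint (matrixOp M) (matrixOp M) := by
  intro f g
  simp only [matrixOp_apply, Matrix.star_mulVec, hM.eq, Matrix.dotProduct_mulVec]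

theorem pauli_isHermitian (i : Fin 3) : (pauli i).IsHermitian := by
  fin_cases i <;> ext a b <;> fin_cases a <;> fin_cases b <;> simp [pauli]

theorem isFormalAdjoint_sigma (i : Fin 3) : IsFormalAdjoint (sigma i) (sigma i) :=
  isFormalAdjoint_matrixOp (pauli_isHermitian i)

/-- The pairing `⟨a, b⟩ = ∑ₛ conj(aₛ) bₛ` on `ℂ²`, as a real bilinear map. -/
noncomputable def pairing : (Fin 2 → ℂ) →L[ℝ] (Fin 2 → ℂ) →L[ℝ] ℂ :=
  LinearMap.toContinuousLinearMap ((LinearMap.toContinuousLinearMap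
    (𝕜 := ℝ) (E := Fin 2 → ℂ) (F' := ℂ)).toLinearMap ∘ₗ
    LinearMap.mk₂ ℝ (fun a b : Fin 2 → ℂ => star a ⬝ᵥ b)
      (fun a b c => by simp only [star_add, add_dotProduct])
      (fun r a b => by simp only [star_smul, smul_dotProduct, star_trivial])
      (fun a b c => by simp only [dotProduct_add])
      (fun r a b => by simp only [dotProduct_smul]))

theorem isFormalAdjoint_momentum (ħ : ℝ) (i : Fin 3) :
    IsFormalAdjoint (momentum ħ i) (momentum ħ i) := by
  intro f g
  -- A partial derivative of a wave function is again a wave function, namely `I • momentum 1 i f`;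
  -- `integrable_pairing` then supplies the integrability needed to integrate by parts.
  have hd : ∀ (f : Spinor) (x : Space),
      (Complex.I • momentum 1 i f) x = fderiv ℝ f x (EuclideanSpace.single i 1) := by
    intro f x
    change Complex.I • ((-Complex.I * ((1 : ℝ) : ℂ)) • partialDeriv i f x) = _
    rw [smul_smul]
    simp [partialDeriv]
  have hB : ∀ a b : Fin 2 → ℂ, pairing a b = star a ⬝ᵥ b := fun _ _ => rfl
  have key := integral_bilinear_fderiv_right_eq_neg_left_of_integrable (μ := (volume : Measure Space))
    (f := (f : Space → Fin 2 → ℂ)) (g := (g : Space → Fin 2 → ℂ))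
    (v := EuclideanSpace.single i 1) (B := pairing)
    (by
      simp only [hB, ← hd]
      exact integrable_pairing _ _)
    (by
      simp only [hB, ← hd]
      exact integrable_pairing _ _)
    (integrable_pairing _ _)
    (fun x _ => (spinor_contDiff f).differentiable (by simp) x)
    (fun x _ => (spinor_contDiff g).differentiable (by simp) x)
  simp only [hB] at key
  simp only [momentum_apply, partialDeriv, star_smul, smul_dotProduct, dotProduct_smul]
  rw [integral_smul, integral_smul, key]
  simp

/-- Pairing the difference `d = T g - T' g` with itself gives `∫ |d|² = 0`; the integrand is
continuous and nonnegative, hence zero everywhere. -/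
theorem IsFormalAdjoint.unique {S T T' : Op} (h : IsFormalAdjoint S T)
    (h' : IsFormalAdjoint S T') : T = T' := by
  refine LinearMap.ext fun g => ?_
  rw [← sub_eq_zero]
  set d : Spinor := T g - T' g with hd
  have h1 : ∫ x, star (d x) ⬝ᵥ d x = 0 := by
    have h2 : ∀ x, star (d x) ⬝ᵥ d x = star (d x) ⬝ᵥ T g x - star (d x) ⬝ᵥ T' g x := by
      intro x
      rw [← dotProduct_sub]
      rfl
    simp only [h2]
    rw [integral_sub (integrable_pairing _ _) (integrable_pairing _ _), ← h, ← h', sub_self]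
  have h2 : ∀ x, star (d x) ⬝ᵥ d x = ((‖d x 0‖ ^ 2 + ‖d x 1‖ ^ 2 : ℝ) : ℂ) := by
    intro x
    simp only [dotProduct, Fin.sum_univ_two, Pi.star_apply, RCLike.star_def,
      ← Complex.normSq_eq_conj_mul_self, Complex.normSq_eq_norm_sq]
    push_cast
    rfl
  simp only [h2] at h1
  rw [integral_complex_ofReal, Complex.ofReal_eq_zero] at h1
  have hc : Continuous fun x => ‖d x 0‖ ^ 2 + ‖d x 1‖ ^ 2 := by
    have := (spinor_contDiff d).continuous
    fun_prop
  have hi : Integrable fun x => ‖d x 0‖ ^ 2 + ‖d x 1‖ ^ 2 := by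
    have h3 := (integrable_pairing d d).re
    simp only [h2] at h3
    exact h3
  have h3 := (integral_eq_zero_iff_of_nonneg (fun x => by positivity) hi).1 h1
  have h4 := (hc.ae_eq_iff_eq volume continuous_const).1 h3
  ext x : 1
  have h5 : ‖d x 0‖ ^ 2 + ‖d x 1‖ ^ 2 = 0 := congrFun h4 x
  have h6 : d x 0 = 0 := by
    rw [← norm_eq_zero]
    nlinarith [sq_nonneg ‖d x 0‖, sq_nonneg ‖d x 1‖]
  have h7 : d x 1 = 0 := by
    rw [← norm_eq_zero]
    nlinarith [sq_nonneg ‖d x 0‖, sq_nonneg ‖d x 1‖]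
  ext s
  fin_cases s
  · exact h6
  · exact h7

end Adjoint

/-! ### The Dirac-Pauli problem over an abstract coefficient ring. -/

/-- The operators that enter the Dirac-Pauli Hamiltonian, over an arbitrary coefficient ring:
the imaginary unit `j`, momentum `p`, potentials `A` and `φ`, spin `σ` and fields `E` and `B`. -/
structure System (R : Type*) where
  j : R
  φ : R
  p : Fin 3 → R
  A : Fin 3 → R
  σ : Fin 3 → R
  E : Fin 3 → R
  B : Fin 3 → R

namespace System

section Definitions

variable {R : Type*} [Ring R] [Algebra ℝ R] (d : System R)

/-- The image of a system under a homomorphism of the coefficients. -/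
def map {S : Type*} [Ring S] [Algebra ℝ S] (g : R →ₐ[ℝ] S) : System S where
  j := g d.j
  φ := g d.φ
  p i := g (d.p i)
  A i := g (d.A i)
  σ i := g (d.σ i)
  E i := g (d.E i)
  B i := g (d.B i)

/-- The system with `φ` and `E` reversed, which governs `𝒳†`. -/
def conj : System R := { d with φ := -d.φ, E := -d.E }

/-- The kinematic momentum `p - (q/c) A`. -/
noncomputable def kin (q : ℝ) (i : Fin 3) : PowerSeries R :=
  PowerSeries.C (d.p i) - PowerSeries.X * PowerSeries.C (q • d.A i)

/-- `σ·π` -/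
noncomputable def sP (q : ℝ) : PowerSeries R := (fun i => PowerSeries.C (d.σ i)) ⬝ᵥ d.kin q

/-- `σ·E` -/
noncomputable def sE : PowerSeries R :=
  (fun i => PowerSeries.C (d.σ i)) ⬝ᵥ fun i => PowerSeries.C (d.E i)

/-- `σ·B` -/
noncomputable def sB : PowerSeries R :=
  (fun i => PowerSeries.C (d.σ i)) ⬝ᵥ fun i => PowerSeries.C (d.B i)

/-- Upper left block of the Hamiltonian, times `1/c²`. -/
noncomputable def h11 (m q μ : ℝ) : PowerSeries R :=
  m • 1 + q • (PowerSeries.X ^ 2 * PowerSeries.C d.φ) - μ • (PowerSeries.X ^ 3 * d.sB)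

/-- Upper right block of the Hamiltonian, times `1/c²`. -/
noncomputable def h12 (q μ : ℝ) : PowerSeries R :=
  PowerSeries.X * d.sP q + μ • (PowerSeries.X ^ 3 * (PowerSeries.C d.j * d.sE))

/-- Lower left block of the Hamiltonian, times `1/c²`. -/
noncomputable def h21 (q μ : ℝ) : PowerSeries R :=
  PowerSeries.X * d.sP q - μ • (PowerSeries.X ^ 3 * (PowerSeries.C d.j * d.sE))

/-- Lower right block of the Hamiltonian, times `1/c²`. -/
noncomputable def h22 (m q μ : ℝ) : PowerSeries R :=
  -(m • 1) + q • (PowerSeries.X ^ 2 * PowerSeries.C d.φ) + μ • (PowerSeries.X ^ 3 * d.sB)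

/-- Kutzelnigg's condition: the lower left block of the transformed Hamiltonian vanishes. -/
def Decouples (m q μ : ℝ) (x : PowerSeries R) : Prop :=
  x * d.h11 m q μ + x * d.h12 q μ * x = d.h21 q μ + d.h22 m q μ * x

/-- The map whose fixed points, after multiplication by `1/c`, solve Kutzelnigg's condition. -/
noncomputable def iteration (m q μ : ℝ) (x : PowerSeries R) : PowerSeries R :=
  (1 / (2 * m)) • ((d.sP q - x * d.sP q * x)
    + (PowerSeries.X * (q • (PowerSeries.C d.φ * x - x * PowerSeries.C d.φ))
      + PowerSeries.X ^ 2 * (μ • ((x * d.sB + d.sB * x)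
        - (PowerSeries.C d.j * d.sE + x * (PowerSeries.C d.j * d.sE) * x)))))

/-- The solution of Kutzelnigg's condition. -/
noncomputable def solution (m q μ : ℝ) : PowerSeries R := fixedSeries (d.iteration m q μ)

/-- The Foldy-Wouthuysen Hamiltonian, times `1/c²`. -/
noncomputable def fw (m q μ : ℝ) (x xd : PowerSeries R) : PowerSeries R :=
  taylorOnePlus (fun u => √u) (xd * x) * (d.h11 m q μ + d.h12 q μ * x)
    * taylorOnePlus (fun u => 1 / √u) (xd * x)

/-- The argument `(π/(mc))²` of the Lorentz factor. -/
noncomputable def velocitySq (m q : ℝ) : PowerSeries R :=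
  (1 / m ^ 2) • (PowerSeries.X ^ 2 * (d.kin q ⬝ᵥ d.kin q))

/-- The vector `π/(mc)`. -/
noncomputable def velocity (m q : ℝ) (i : Fin 3) : PowerSeries R :=
  (1 / m) • (PowerSeries.X * d.kin q i)

/-- The weak-field Hamiltonian, times `1/c²`. -/
noncomputable def weak (m ħ q μ : ℝ) : PowerSeries R :=
  let T := d.velocitySq m q
  let u := d.velocity m q
  let μ' : PowerSeries R := μ • PowerSeries.X
  let e : PowerSeries R := (q * ħ / (2 * m)) • PowerSeries.X
  let il := taylorOnePlus (fun u => 1 / √u) T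
  let ilm := taylorOnePlus (fun u => 1 / (√u * (1 + √u))) T
  m • taylorOnePlus (fun u => √u) T + q • (PowerSeries.X ^ 2 * PowerSeries.C d.φ)
    - PowerSeries.X ^ 2 * ((fun i => PowerSeries.C (d.σ i)) ⬝ᵥ fun i =>
      (μ' + e * il) * PowerSeries.C (d.B i)
        - μ' * ilm * (u ⬝ᵥ fun i => PowerSeries.C (d.B i)) * u i
        - (μ' * il + e * ilm) * cross u (fun i => PowerSeries.C (d.E i)) i)

end Definitions

/-! ### Kutzelnigg's condition as a fixed-point equation. -/

section Equation

variable {R : Type*} [Ring R] [Algebra ℝ R] (d : System R)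

theorem causal_iteration (m q μ : ℝ) : Causal (d.iteration m q μ) := by
  intro n a b h
  have hr : ∀ c : PowerSeries R, AgreeBelow n c c := AgreeBelow.refl n
  unfold iteration
  exact ((((hr _).sub ((h.mul (hr _)).mul h)).add (((hr _).mul ((((hr _).mul h).sub
    (h.mul (hr _))).smul q)).add ((hr _).mul ((((h.mul (hr _)).add ((hr _).mul h)).sub
      ((hr _).add ((h.mul (hr _)).mul h))).smul μ))))).smul _

theorem mul_X_pow_mul {R : Type*} [Ring R] (k : ℕ) (x y : PowerSeries R) :
    x * (PowerSeries.X ^ k * y) = PowerSeries.X ^ k * (x * y) := by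
  rw [← mul_assoc, ← mul_assoc, (PowerSeries.commute_X_pow x k).eq]

/-- The rest energies of the diagonal blocks contribute `m x` and `-m x` on opposite sides, together
`2m x`; every other term carries a factor `X`. Division by `2m` isolates `x`. -/
theorem X_mul_iteration (m q μ : ℝ) (hm : m ≠ 0) (x : PowerSeries R) :
    PowerSeries.X * d.iteration m q μ x = x + (1 / (2 * m)) • ((d.h21 q μ + d.h22 m q μ * x)
      - (x * d.h11 m q μ + x * d.h12 q μ * x)) := by
  have h1 : ∀ y : PowerSeries R, PowerSeries.X * y = PowerSeries.X ^ 1 * y := fun y => by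
    rw [pow_one]
  have h2 : ∀ (a b : ℕ) (y : PowerSeries R),
      PowerSeries.X ^ a * (PowerSeries.X ^ b * y) = PowerSeries.X ^ (a + b) * y := fun a b y => by
    rw [pow_add, mul_assoc]
  unfold iteration h11 h12 h21 h22
  simp only [h1, mul_add, add_mul, mul_sub, smul_mul_assoc, mul_smul_comm, mul_assoc,
    smul_add, smul_sub, mul_X_pow_mul, h2, neg_mul, one_mul, mul_one, smul_neg, smul_smul]
  match_scalars <;> field_simp
  ring

theorem decouples_iff (m q μ : ℝ) (hm : m ≠ 0) (x : PowerSeries R) :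
    d.Decouples m q μ x ↔ x = PowerSeries.X * d.iteration m q μ x := by
  rw [X_mul_iteration d m q μ hm, Decouples, left_eq_add, smul_eq_zero, sub_eq_zero]
  simp [hm, eq_comm]

theorem decouples_solution (m q μ : ℝ) (hm : m ≠ 0) :
    d.Decouples m q μ (d.solution m q μ) :=
  (d.decouples_iff m q μ hm _).2 (d.causal_iteration m q μ).fixedSeries_eq

theorem Decouples.eq_solution {m q μ : ℝ} {d : System R} (hm : m ≠ 0) {x : PowerSeries R}
    (h : d.Decouples m q μ x) : x = d.solution m q μ :=
  (d.causal_iteration m q μ).unique ((d.decouples_iff m q μ hm _).1 h)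
    (d.causal_iteration m q μ).fixedSeries_eq

theorem constantCoeff_solution (m q μ : ℝ) :
    PowerSeries.constantCoeff (d.solution m q μ) = 0 := by
  unfold solution
  rw [(d.causal_iteration m q μ).fixedSeries_eq]
  simp

end Equation

/-! ### Naturality under homomorphisms of the coefficients. -/

section Map

variable {R S : Type*} [Ring R] [Algebra ℝ R] [Ring S] [Algebra ℝ S] (d : System R)
  (g : R →ₐ[ℝ] S)

theorem map_smul_series (r : ℝ) (x : PowerSeries R) :
    PowerSeries.map (g : R →+* S) (r • x) = r • PowerSeries.map (g : R →+* S) x := by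
  ext k
  simp

theorem map_kin (q : ℝ) (i : Fin 3) :
    PowerSeries.map (g : R →+* S) (d.kin q i) = (d.map g).kin q i := by
  simp [kin, map]

theorem map_dotProduct (a b : Fin 3 → PowerSeries R) :
    PowerSeries.map (g : R →+* S) (a ⬝ᵥ b)
      = (fun i => PowerSeries.map (g : R →+* S) (a i))
        ⬝ᵥ fun i => PowerSeries.map (g : R →+* S) (b i) := by
  simp [dotProduct]

theorem map_cross (a b : Fin 3 → PowerSeries R) (i : Fin 3) :
    PowerSeries.map (g : R →+* S) (cross a b i)
      = cross (fun i => PowerSeries.map (g : R →+* S) (a i))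
        (fun i => PowerSeries.map (g : R →+* S) (b i)) i := by
  fin_cases i <;> simp [cross]

theorem map_sP (q : ℝ) : PowerSeries.map (g : R →+* S) (d.sP q) = (d.map g).sP q := by
  rw [sP, map_dotProduct, sP]
  simp only [map_kin, PowerSeries.map_C]
  rfl

theorem map_sE : PowerSeries.map (g : R →+* S) d.sE = (d.map g).sE := by
  rw [sE, map_dotProduct, sE]
  simp only [PowerSeries.map_C]
  rfl

theorem map_sB : PowerSeries.map (g : R →+* S) d.sB = (d.map g).sB := by
  rw [sB, map_dotProduct, sB]
  simp only [PowerSeries.map_C]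
  rfl

theorem map_h11 (m q μ : ℝ) :
    PowerSeries.map (g : R →+* S) (d.h11 m q μ) = (d.map g).h11 m q μ := by
  simp [h11, map_smul_series, map_sB, map]

theorem map_h12 (q μ : ℝ) :
    PowerSeries.map (g : R →+* S) (d.h12 q μ) = (d.map g).h12 q μ := by
  simp [h12, map_smul_series, map_sE, map_sP, map]

theorem map_h21 (q μ : ℝ) :
    PowerSeries.map (g : R →+* S) (d.h21 q μ) = (d.map g).h21 q μ := by
  simp [h21, map_smul_series, map_sE, map_sP, map]

theorem map_h22 (m q μ : ℝ) :
    PowerSeries.map (g : R →+* S) (d.h22 m q μ) = (d.map g).h22 m q μ := by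
  simp [h22, map_smul_series, map_sB, map]

/-- The image of the solution satisfies the image of the equation, and that equation has only one
solution. This is what allows the field strength to be a formal variable that is specialized
afterwards. -/
theorem map_solution (m q μ : ℝ) (hm : m ≠ 0) :
    PowerSeries.map (g : R →+* S) (d.solution m q μ) = (d.map g).solution m q μ := by
  refine Decouples.eq_solution hm ?_
  have h := congrArg (PowerSeries.map (g : R →+* S)) (d.decouples_solution m q μ hm)
  simp only [map_mul, map_add, map_h11, map_h12, map_h21, map_h22] at h
  exact h

theorem map_conj : d.conj.map g = (d.map g).conj := by
  simp only [map, conj, map_neg, Pi.neg_apply]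
  rfl

theorem map_fw (m q μ : ℝ) (x xd : PowerSeries R) :
    PowerSeries.map (g : R →+* S) (d.fw m q μ x xd)
      = (d.map g).fw m q μ (PowerSeries.map (g : R →+* S) x)
        (PowerSeries.map (g : R →+* S) xd) := by
  simp only [fw, map_mul, map_add, map_taylorOnePlus, map_h11, map_h12]

theorem map_velocity (m q : ℝ) (i : Fin 3) :
    PowerSeries.map (g : R →+* S) (d.velocity m q i) = (d.map g).velocity m q i := by
  simp only [velocity, map_smul_series, map_mul, PowerSeries.map_X, map_kin]

theorem map_velocitySq (m q : ℝ) :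
    PowerSeries.map (g : R →+* S) (d.velocitySq m q) = (d.map g).velocitySq m q := by
  simp only [velocitySq, map_smul_series, map_mul, map_pow, PowerSeries.map_X, map_dotProduct,
    map_kin]

theorem map_weak (m ħ q μ : ℝ) :
    PowerSeries.map (g : R →+* S) (d.weak m ħ q μ) = (d.map g).weak m ħ q μ := by
  simp only [weak, map_sub, map_add, map_smul_series, map_mul, map_pow, PowerSeries.map_X,
    map_dotProduct, map_cross, map_taylorOnePlus, map_velocitySq, map_velocity, PowerSeries.map_C]
  rfl

end Map

end System

/-! ### Laurent series and the central unit `c`. -/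

section Laurent

variable {R : Type*} [Ring R]

theorem laurent_smul_mul {S : Type*} [CommSemiring S] [Algebra S R] (r : S)
    (x y : LaurentSeries R) : (r • x) * y = r • (x * y) := smul_mul_assoc r x y

theorem laurent_mul_smul {S : Type*} [CommSemiring S] [Algebra S R] (r : S)
    (x y : LaurentSeries R) : x * (r • y) = r • (x * y) := mul_smul_comm r x y

theorem laurent_smul_comm {S S' : Type*} [CommSemiring S] [Algebra S R] [CommSemiring S']
    [Algebra S' R] [SMulCommClass S S' R] (r : S) (r' : S') (x : LaurentSeries R) :
    r • r' • x = r' • r • x := smul_comm r r' x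

theorem laurent_two_smul [Algebra ℝ R] (x : LaurentSeries R) : (2 : ℝ) • x = x + x :=
  two_smul ℝ x

theorem laurent_neg_mul (x y : LaurentSeries R) : -x * y = -(x * y) := neg_mul x y

theorem light_pow_two : light R ^ 2 = HahnSeries.single (-2) 1 := by
  rw [light, pow_two, HahnSeries.single_mul_single]
  norm_num

theorem light_mul_invLight : light R * invLight R = 1 := by
  rw [light, invLight, HahnSeries.single_mul_single]
  simp

theorem invLight_mul_light : invLight R * light R = 1 := by
  rw [light, invLight, HahnSeries.single_mul_single]
  simp

theorem light_comm (x : LaurentSeries R) : x * light R = light R * x := by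
  ext k
  rw [light, HahnSeries.coeff_single_mul, HahnSeries.coeff_mul_single, one_mul, mul_one]

theorem invLight_comm (x : LaurentSeries R) : x * invLight R = invLight R * x := by
  ext k
  rw [invLight, HahnSeries.coeff_single_mul, HahnSeries.coeff_mul_single, one_mul, mul_one]

theorem toLaurent_X : toLaurent (PowerSeries.X : PowerSeries R) = invLight R :=
  HahnSeries.ofPowerSeries_X

theorem toLaurent_C (r : R) : toLaurent (PowerSeries.C r) = const r := rfl

theorem coeff_toLaurent_natCast (y : PowerSeries R) (n : ℕ) :
    (toLaurent y).coeff (n : ℤ) = PowerSeries.coeff n y :=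
  HahnSeries.ofPowerSeries_apply_coeff y n

theorem coeff_toLaurent_of_neg (y : PowerSeries R) {k : ℤ} (hk : k < 0) :
    (toLaurent y).coeff k = 0 := by
  unfold toLaurent
  rw [HahnSeries.ofPowerSeries_apply]
  refine HahnSeries.embDomain_of_notMem_range ?_
  rintro ⟨n, hn⟩
  have : (n : ℤ) = k := hn
  omega

theorem coeff_light_sq_mul (x : LaurentSeries R) (k : ℤ) :
    (light R ^ 2 * x).coeff k = x.coeff (k + 2) := by
  rw [light_pow_two, HahnSeries.coeff_single_mul, one_mul, sub_neg_eq_add]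

theorem toLaurent_smul {S : Type*} [CommSemiring S] [Algebra S R] (r : S) (y : PowerSeries R) :
    toLaurent (r • y) = r • toLaurent y := by
  ext k
  rcases lt_or_ge k 0 with hk | hk
  · rw [HahnSeries.coeff_smul, coeff_toLaurent_of_neg _ hk, coeff_toLaurent_of_neg _ hk, smul_zero]
  · lift k to ℕ using hk
    rw [HahnSeries.coeff_smul, coeff_toLaurent_natCast, coeff_toLaurent_natCast,
      PowerSeries.coeff_smul]

theorem toLaurent_injective : Function.Injective (toLaurent : PowerSeries R → LaurentSeries R) :=
  HahnSeries.ofPowerSeries_injective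

theorem light_sq_mul_injective : Function.Injective fun x : LaurentSeries R => light R ^ 2 * x := by
  intro x y h
  have h1 := congrArg (fun z => invLight R * (invLight R * z)) h
  simp only [pow_two, ← mul_assoc] at h1
  simpa [mul_assoc, ← mul_assoc (invLight R) (light R), invLight_mul_light] using h1

theorem light_sq_mul_invLight_sq (x : LaurentSeries R) :
    light R ^ 2 * (invLight R ^ 2 * x) = x := by
  rw [pow_two, pow_two, mul_assoc, mul_assoc, ← mul_assoc (light R) (invLight R),
    light_mul_invLight, one_mul, ← mul_assoc, light_mul_invLight, one_mul]

theorem light_sq_mul_invLight (x : LaurentSeries R) :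
    light R ^ 2 * (invLight R * x) = light R * x := by
  rw [pow_two, mul_assoc, ← mul_assoc (light R) (invLight R), light_mul_invLight, one_mul]

theorem light_sq_mul_invLight_cube (x : LaurentSeries R) :
    light R ^ 2 * (invLight R ^ 3 * x) = invLight R * x := by
  rw [pow_succ (invLight R), mul_assoc (invLight R ^ 2), light_sq_mul_invLight_sq]

theorem light_sq_comm (x : LaurentSeries R) : x * light R ^ 2 = light R ^ 2 * x := by
  rw [pow_two, ← mul_assoc, light_comm, mul_assoc, light_comm, ← mul_assoc]

end Laurent

/-! ### From the operators to the abstract system. -/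

/-- The system of operators of a homogeneous field. -/
noncomputable def opSystem (ħ : ℝ) (F : HomogeneousField) : System Op where
  j := Complex.I • 1
  φ := potential F
  p := momentum ħ
  A i := mulOp (F.A i) (F.smooth_A i)
  σ := sigma
  E i := algebraMap ℝ Op (F.E i)
  B i := algebraMap ℝ Op (F.B i)

section Bridge

variable (m ħ q μ : ℝ) (F : HomogeneousField)

theorem toLaurent_kin (i : Fin 3) :
    toLaurent ((opSystem ħ F).kin q i) = kinematicL ħ q F i := rfl

theorem toLaurent_sP : toLaurent ((opSystem ħ F).sP q) = sigmaPi ħ q F := by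
  simp only [System.sP, dotProduct, map_sum, map_mul]
  rfl

theorem toLaurent_sE : toLaurent (opSystem ħ F).sE = sigmaE F := by
  simp only [System.sE, dotProduct, map_sum, map_mul]
  rfl

theorem toLaurent_sB : toLaurent (opSystem ħ F).sB = sigmaB F := by
  simp only [System.sB, dotProduct, map_sum, map_mul]
  rfl

/-- The imaginary unit enters the abstract system as an element `j`, so that only `ℝ`-algebras are
needed there; this translates `j` back into the complex scalar. -/
theorem toLaurent_C_j_mul (y : PowerSeries Op) :
    toLaurent (PowerSeries.C (opSystem ħ F).j * y) = Complex.I • toLaurent y := by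
  rw [← toLaurent_smul]
  congr 1
  ext k : 1
  rw [PowerSeries.coeff_C_mul, PowerSeries.coeff_smul]
  exact smul_one_mul Complex.I _

theorem hamiltonian_00 : hamiltonian m ħ q μ F 0 0
    = light Op ^ 2 * toLaurent ((opSystem ħ F).h11 m q μ) := by
  simp only [System.h11, map_add, map_sub, toLaurent_smul, map_mul, map_pow, map_one, toLaurent_X,
    toLaurent_C, toLaurent_sB, mul_add, mul_sub, laurent_mul_smul, mul_one, light_sq_mul_invLight_sq,
    light_sq_mul_invLight_cube]
  simp only [hamiltonian, restEnergy, qPhi, muPrime, laurent_smul_mul, opSystem]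
  rfl

theorem hamiltonian_01 : hamiltonian m ħ q μ F 0 1
    = light Op ^ 2 * toLaurent ((opSystem ħ F).h12 q μ) := by
  simp only [System.h12, map_add, toLaurent_smul, map_mul (toLaurent) (_ ^ _), map_mul toLaurent PowerSeries.X, map_pow,
    toLaurent_C_j_mul, toLaurent_X, toLaurent_sP,
    toLaurent_sE, mul_add, laurent_mul_smul, light_sq_mul_invLight,
    light_sq_mul_invLight_cube]
  simp only [hamiltonian, muPrime, laurent_smul_mul, laurent_smul_comm Complex.I μ]
  rfl

theorem hamiltonian_10 : hamiltonian m ħ q μ F 1 0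
    = light Op ^ 2 * toLaurent ((opSystem ħ F).h21 q μ) := by
  simp only [System.h21, map_sub, toLaurent_smul, map_mul (toLaurent) (_ ^ _), map_mul toLaurent PowerSeries.X, map_pow,
    toLaurent_C_j_mul, toLaurent_X, toLaurent_sP,
    toLaurent_sE, mul_sub, laurent_mul_smul, light_sq_mul_invLight,
    light_sq_mul_invLight_cube]
  simp only [hamiltonian, muPrime, laurent_smul_mul, laurent_smul_comm Complex.I μ]
  rfl

theorem hamiltonian_11 : hamiltonian m ħ q μ F 1 1
    = light Op ^ 2 * toLaurent ((opSystem ħ F).h22 m q μ) := by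
  simp only [System.h22, map_add, map_neg, toLaurent_smul, map_mul, map_pow, map_one, toLaurent_X,
    toLaurent_C, toLaurent_sB, mul_add, mul_neg, laurent_mul_smul, mul_one, light_sq_mul_invLight_sq,
    light_sq_mul_invLight_cube]
  simp only [hamiltonian, restEnergy, qPhi, muPrime, laurent_smul_mul, opSystem]
  rfl

/-- Moving the two rest-energy terms to one side gives `2mc²𝒳`, because `mc²` and `μ'` are central.
In this form the condition says that the lower left block of `U H U†`, stripped of its outer factors
`𝒵` and `𝒴`, vanishes. -/
theorem kutzelniggCondition_iff_hamiltonian (𝒳 : PowerSeries Op) :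
    KutzelniggCondition m ħ q μ F 𝒳 ↔
      toLaurent 𝒳 * hamiltonian m ħ q μ F 0 0
        + toLaurent 𝒳 * hamiltonian m ħ q μ F 0 1 * toLaurent 𝒳
      = hamiltonian m ħ q μ F 1 0 + hamiltonian m ħ q μ F 1 1 * toLaurent 𝒳 := by
  have h00 : hamiltonian m ħ q μ F 0 0 = restEnergy m + qPhi q F - muPrime μ * sigmaB F := rfl
  have h01 : hamiltonian m ħ q μ F 0 1
    = light Op * sigmaPi ħ q F + Complex.I • (muPrime μ * sigmaE F) := rfl
  have h10 : hamiltonian m ħ q μ F 1 0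
    = light Op * sigmaPi ħ q F - Complex.I • (muPrime μ * sigmaE F) := rfl
  have h11 : hamiltonian m ħ q μ F 1 1 = -restEnergy m + qPhi q F + muPrime μ * sigmaB F := rfl
  rw [h00, h01, h10, h11, KutzelniggCondition]
  set x := toLaurent 𝒳
  have hr : x * restEnergy m = restEnergy m * x := by
    rw [restEnergy, laurent_mul_smul, laurent_smul_mul, light_sq_comm]
  have hmu : ∀ z : LaurentSeries Op, z * muPrime μ = muPrime μ * z := fun z => by
    rw [muPrime, laurent_mul_smul, laurent_smul_mul, invLight_comm]
  have hmu' : ∀ z w : LaurentSeries Op, z * (muPrime μ * w) = muPrime μ * (z * w) := fun z w => by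
    rw [← mul_assoc, hmu, mul_assoc]
  rw [← sub_eq_zero, ← sub_eq_zero (a := x * _ + _)]
  have key : (2 : ℝ) • (restEnergy m * x) -
      (-(x * (light Op * sigmaPi ħ q F) * x) + light Op * sigmaPi ħ q F
      + (qPhi q F * x - x * qPhi q F)
      - Complex.I • (muPrime μ * sigmaE F)
      - Complex.I • (muPrime μ * (x * sigmaE F * x))
      + muPrime μ * (x * sigmaB F + sigmaB F * x)) =
      x * (restEnergy m + qPhi q F - muPrime μ * sigmaB F)
        + x * (light Op * sigmaPi ħ q F + Complex.I • (muPrime μ * sigmaE F)) * x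
      - (light Op * sigmaPi ħ q F - Complex.I • (muPrime μ * sigmaE F)
        + (-restEnergy m + qPhi q F + muPrime μ * sigmaB F) * x) := by
    rw [laurent_two_smul]
    simp only [mul_add, add_mul, mul_sub, laurent_smul_mul, laurent_mul_smul, hr, mul_assoc,
      hmu', laurent_neg_mul]
    abel
  rw [key]

theorem kutzelniggCondition_iff (𝒳 : PowerSeries Op) :
    KutzelniggCondition m ħ q μ F 𝒳 ↔ (opSystem ħ F).Decouples m q μ 𝒳 := by
  rw [kutzelniggCondition_iff_hamiltonian, hamiltonian_00, hamiltonian_01, hamiltonian_10,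
    hamiltonian_11, System.Decouples]
  refine Iff.trans ?_ toLaurent_injective.eq_iff
  refine Iff.trans ?_ light_sq_mul_injective.eq_iff
  simp only [map_add, map_mul, mul_add, ← mul_assoc, light_sq_comm (toLaurent 𝒳)]

theorem weakFieldDiracPauli_eq : weakFieldDiracPauli m ħ q μ F
    = light Op ^ 2 * toLaurent ((opSystem ħ F).weak m ħ q μ) := by
  have hu : ∀ i, toLaurent ((opSystem ħ F).velocity m q i) = unitKinematic m ħ q F i := fun i => by
    rw [System.velocity, toLaurent_smul, map_mul, toLaurent_X, toLaurent_kin, unitKinematic]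
  have hcross : ∀ (a b : Fin 3 → PowerSeries Op) (i : Fin 3), toLaurent (cross a b i)
      = cross (fun i => toLaurent (a i)) (fun i => toLaurent (b i)) i := by
    intro a b i
    fin_cases i <;> simp [cross]
  have hdot : ∀ a b : Fin 3 → PowerSeries Op, toLaurent (a ⬝ᵥ b)
      = (fun i => toLaurent (a i)) ⬝ᵥ fun i => toLaurent (b i) := by
    intro a b
    simp only [dotProduct, map_sum, map_mul]
  simp only [System.weak, map_sub, map_add, hdot, hcross, map_mul, toLaurent_smul, map_pow,
    toLaurent_X, hu, mul_sub (light Op ^ 2), mul_add (light Op ^ 2), light_sq_mul_invLight_sq,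
    laurent_mul_smul]
  simp only [weakFieldDiracPauli, kineticEnergy, qPhi, muPrime]
  rfl

end Bridge

/-! ### Adjoints of formal series, and the equation for `𝒳†`. -/

section SeriesAdjoint

/-- Coefficientwise formal adjointness of power series. -/
def AdjointSeries (S T : PowerSeries Op) : Prop :=
  ∀ n, IsFormalAdjoint (PowerSeries.coeff n S) (PowerSeries.coeff n T)

theorem isSeriesAdjoint_toLaurent {S T : PowerSeries Op} :
    IsSeriesAdjoint (toLaurent S) (toLaurent T) ↔ AdjointSeries S T := by
  constructor
  · intro h n
    simpa only [coeff_toLaurent_natCast] using h n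
  · intro h k
    rcases lt_or_ge k 0 with hk | hk
    · rw [coeff_toLaurent_of_neg _ hk, coeff_toLaurent_of_neg _ hk]
      exact isFormalAdjoint_zero
    · lift k to ℕ using hk
      rw [coeff_toLaurent_natCast, coeff_toLaurent_natCast]
      exact h k

theorem IsSeriesAdjoint.light_sq_mul {S T : LaurentSeries Op} (h : IsSeriesAdjoint S T) :
    IsSeriesAdjoint (light Op ^ 2 * S) (light Op ^ 2 * T) := by
  intro k
  rw [coeff_light_sq_mul, coeff_light_sq_mul]
  exact h _

namespace AdjointSeries

variable {S T S' T' : PowerSeries Op}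

theorem symm (h : AdjointSeries S T) : AdjointSeries T S := fun n => (h n).symm

theorem unique (h : AdjointSeries S T) (h' : AdjointSeries S T') : T = T' :=
  PowerSeries.ext fun n => (h n).unique (h' n)

theorem add (h : AdjointSeries S T) (h' : AdjointSeries S' T') :
    AdjointSeries (S + S') (T + T') := fun n => by
  simpa only [map_add] using (h n).add (h' n)

theorem smul (r : ℝ) (h : AdjointSeries S T) : AdjointSeries (r • S) (r • T) := fun n => by
  simpa only [PowerSeries.coeff_smul] using (h n).smul r

theorem neg (h : AdjointSeries S T) : AdjointSeries (-S) (-T) := by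
  simpa using h.smul (-1)

theorem sub (h : AdjointSeries S T) (h' : AdjointSeries S' T') :
    AdjointSeries (S - S') (T - T') := by
  simpa only [sub_eq_add_neg] using h.add h'.neg

theorem rel_sum {R ι : Type*} [Ring R] {r : R → R → Prop} (h0 : r 0 0)
    (hadd : ∀ {a b a' b' : R}, r a b → r a' b' → r (a + a') (b + b'))
    (s : Finset ι) {f g : ι → R} (h : ∀ i ∈ s, r (f i) (g i)) :
    r (∑ i ∈ s, f i) (∑ i ∈ s, g i) := by
  classical
  induction s using Finset.induction_on with
  | empty => simpa using h0
  | insert a s ha ih =>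
    rw [Finset.sum_insert ha, Finset.sum_insert ha]
    exact hadd (h a (by simp)) (ih fun i hi => h i (by simp [hi]))

/-- Swapping the antidiagonal matches each product of coefficients with the reversed product. Only
additivity of the relation and its compatibility with reversed products are used. -/
theorem rel_coeff_mul {R : Type*} [Ring R] {r : R → R → Prop} (h0 : r 0 0)
    (hadd : ∀ {a b a' b' : R}, r a b → r a' b' → r (a + a') (b + b'))
    (hmul : ∀ {a b a' b' : R}, r a b → r a' b' → r (a * a') (b' * b))
    {a b a' b' : PowerSeries R} (h : ∀ n, r (PowerSeries.coeff n a) (PowerSeries.coeff n b))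
    (h' : ∀ n, r (PowerSeries.coeff n a') (PowerSeries.coeff n b')) (n : ℕ) :
    r (PowerSeries.coeff n (a * a')) (PowerSeries.coeff n (b' * b)) := by
  rw [PowerSeries.coeff_mul, PowerSeries.coeff_mul,
    ← Finset.Nat.sum_antidiagonal_swap (n := n)
      (f := fun p => PowerSeries.coeff p.1 b' * PowerSeries.coeff p.2 b)]
  exact rel_sum h0 hadd _ fun p _ => hmul (h p.1) (h' p.2)

theorem mul (h : AdjointSeries S T) (h' : AdjointSeries S' T') :
    AdjointSeries (S * S') (T' * T) :=
  rel_coeff_mul isFormalAdjoint_zero IsFormalAdjoint.add IsFormalAdjoint.mul h h'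

theorem mul_mul {S'' T'' : PowerSeries Op} (h : AdjointSeries S T) (h' : AdjointSeries S' T')
    (h'' : AdjointSeries S'' T'') : AdjointSeries (S * S' * S'') (T'' * T' * T) := by
  rw [mul_assoc T'']
  exact (h.mul h').mul h''

theorem C {a b : Op} (h : IsFormalAdjoint a b) :
    AdjointSeries (PowerSeries.C a) (PowerSeries.C b) := fun n => by
  rw [PowerSeries.coeff_C, PowerSeries.coeff_C]
  split_ifs
  · exact h
  · exact isFormalAdjoint_zero

theorem one : AdjointSeries 1 1 := C isFormalAdjoint_one

theorem zero : AdjointSeries 0 0 := fun n => by simpa using isFormalAdjoint_zero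

theorem X : AdjointSeries PowerSeries.X PowerSeries.X := fun n => by
  rw [PowerSeries.coeff_X]
  split_ifs
  · exact isFormalAdjoint_one
  · exact isFormalAdjoint_zero

theorem pow (h : AdjointSeries S T) (n : ℕ) : AdjointSeries (S ^ n) (T ^ n) := by
  induction n with
  | zero => simpa using one
  | succ n ih =>
    rw [pow_succ, pow_succ']
    exact ih.mul h

theorem X_pow_mul (k : ℕ) (h : AdjointSeries S T) :
    AdjointSeries (PowerSeries.X ^ k * S) (PowerSeries.X ^ k * T) := by
  have := (X.pow k).mul h
  rwa [(PowerSeries.commute_X_pow T k).eq] at this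

theorem X_mul (h : AdjointSeries S T) :
    AdjointSeries (PowerSeries.X * S) (PowerSeries.X * T) := by
  simpa using h.X_pow_mul 1

theorem taylor (f : ℝ → ℝ) (h : AdjointSeries S T) :
    AdjointSeries (taylorOnePlus f S) (taylorOnePlus f T) := fun k => by
  rw [taylorOnePlus, taylorOnePlus, PowerSeries.coeff_mk, PowerSeries.coeff_mk]
  exact rel_sum isFormalAdjoint_zero IsFormalAdjoint.add _ fun n _ => (h.pow n k).smul _

end AdjointSeries

variable (m ħ q μ : ℝ) (F : HomogeneousField)

theorem sigma_commute_momentum (i j : Fin 3) : Commute (sigma i) (momentum ħ j) :=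
  matrixOp_commute_momentum _ _ _

theorem sigma_commute_mulOp (i : Fin 3) (a : Space → ℝ) (ha : ContDiff ℝ ∞ a) :
    Commute (sigma i) (mulOp a ha) :=
  matrixOp_commute_mulOp _ _ _

theorem sigma_commute_kinematic (i j : Fin 3) :
    Commute (PowerSeries.C (sigma i)) (kinematic ħ q F j) := by
  refine Commute.sub_right ?_ (Commute.mul_right (PowerSeries.commute_X _) ?_)
  · exact (sigma_commute_momentum ħ i j).map PowerSeries.C
  · exact ((sigma_commute_mulOp i _ _).smul_right q).map PowerSeries.C

theorem isFormalAdjoint_algebraMap (r : ℝ) :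
    IsFormalAdjoint (algebraMap ℝ Op r) (algebraMap ℝ Op r) := by
  rw [Algebra.algebraMap_eq_smul_one]
  exact isFormalAdjoint_one.smul r

theorem adjointSeries_kin (i : Fin 3) :
    AdjointSeries ((opSystem ħ F).kin q i) ((opSystem ħ F).kin q i) :=
  (AdjointSeries.C (isFormalAdjoint_momentum ħ i)).sub
    (AdjointSeries.C ((isFormalAdjoint_mulOp (F.A i) (F.smooth_A i)).smul q)).X_mul

/-- Adjunction sends `σᵢ aᵢ` to `aᵢ σᵢ`, and commutativity with the spin restores the order. -/
theorem adjointSeries_dot {a : Fin 3 → PowerSeries Op} (ha : ∀ i, AdjointSeries (a i) (a i))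
    (hc : ∀ i, Commute (PowerSeries.C (sigma i)) (a i)) :
    AdjointSeries ((fun i => PowerSeries.C (sigma i)) ⬝ᵥ a)
      ((fun i => PowerSeries.C (sigma i)) ⬝ᵥ a) := by
  have key : ∀ i, AdjointSeries (PowerSeries.C (sigma i) * a i) (PowerSeries.C (sigma i) * a i) :=
    fun i => by
      have := (AdjointSeries.C (isFormalAdjoint_sigma i)).mul (ha i)
      rwa [← (hc i).eq] at this
  simp only [dotProduct, Fin.sum_univ_three]
  exact ((key 0).add (key 1)).add (key 2)

theorem adjointSeries_sP : AdjointSeries ((opSystem ħ F).sP q) ((opSystem ħ F).sP q) :=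
  adjointSeries_dot (adjointSeries_kin ħ q F) fun i => sigma_commute_kinematic ħ q F i i

theorem adjointSeries_sE : AdjointSeries (opSystem ħ F).sE (opSystem ħ F).sE :=
  adjointSeries_dot (fun i => AdjointSeries.C (isFormalAdjoint_algebraMap (F.E i)))
    fun i => (Algebra.commute_algebraMap_right (F.E i) (sigma i)).map PowerSeries.C

theorem adjointSeries_sB : AdjointSeries (opSystem ħ F).sB (opSystem ħ F).sB :=
  adjointSeries_dot (fun i => AdjointSeries.C (isFormalAdjoint_algebraMap (F.B i)))
    fun i => (Algebra.commute_algebraMap_right (F.B i) (sigma i)).map PowerSeries.C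

theorem conj_sP (ħ q : ℝ) (F : HomogeneousField) :
    (opSystem ħ F).conj.sP q = (opSystem ħ F).sP q := rfl

theorem conj_sB (ħ : ℝ) (F : HomogeneousField) :
    (opSystem ħ F).conj.sB = (opSystem ħ F).sB := rfl

theorem conj_sE (ħ : ℝ) (F : HomogeneousField) :
    (opSystem ħ F).conj.sE = -(opSystem ħ F).sE := by
  simp [System.sE, System.conj, dotProduct, Finset.sum_neg_distrib]

theorem adjointSeries_j_sE : AdjointSeries (PowerSeries.C (opSystem ħ F).j * (opSystem ħ F).sE)
    (PowerSeries.C (opSystem ħ F).conj.j * (opSystem ħ F).conj.sE) := by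
  have h1 : IsFormalAdjoint (opSystem ħ F).j (-(opSystem ħ F).j) := by
    have := isFormalAdjoint_one.csmul Complex.I
    simpa [opSystem] using this
  have h2 := (AdjointSeries.C h1).mul (adjointSeries_sE ħ F)
  have h3 : Commute (PowerSeries.C (opSystem ħ F).j) (opSystem ħ F).sE := by
    refine PowerSeries.ext fun n => ?_
    rw [PowerSeries.coeff_C_mul, PowerSeries.coeff_mul_C, opSystem, smul_one_mul, mul_smul_one]
  rw [map_neg, mul_neg, ← h3.eq] at h2
  rw [conj_sE, mul_neg]
  exact h2

/-- Reversing products maps `[φ, a]` to `-[φ, b]` and `iσ·E` to `-iσ·E`, and leaves the terms in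
`σ·π` and `σ·B` in the same form. These sign changes are exactly those of `conj`. -/
theorem adjointSeries_iteration {a b : PowerSeries Op} (h : AdjointSeries a b) :
    AdjointSeries ((opSystem ħ F).iteration m q μ a) ((opSystem ħ F).conj.iteration m q μ b) := by
  unfold System.iteration
  have hP := adjointSeries_sP ħ q F
  have hB := adjointSeries_sB ħ F
  have hj := adjointSeries_j_sE ħ F
  have hφ : AdjointSeries (PowerSeries.C (opSystem ħ F).φ) (PowerSeries.C (opSystem ħ F).φ) :=
    AdjointSeries.C (isFormalAdjoint_mulOp F.φ F.smooth_φ)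
  rw [conj_sP, conj_sB]
  have h1 : PowerSeries.C (opSystem ħ F).conj.φ * b - b * PowerSeries.C (opSystem ħ F).conj.φ
      = b * PowerSeries.C (opSystem ħ F).φ - PowerSeries.C (opSystem ħ F).φ * b := by
    simp only [System.conj, map_neg]
    noncomm_ring
  rw [h1, add_comm (b * (opSystem ħ F).sB)]
  refine ((hP.sub (h.mul_mul hP h)).add (AdjointSeries.add ?_ ?_)).smul _
  · exact (((hφ.mul h).sub (h.mul hφ)).smul q).X_mul
  · exact ((((h.mul hB).add (hB.mul h)).sub (hj.add (h.mul_mul hj h))).smul μ).X_pow_mul 2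

/-- Both iterations start at `0` and stay adjoint at every step, and each coefficient of a solution
is read off from a finite iterate. In particular the adjoint of `𝒳` exists, which is not automatic
for operators on test functions. -/
theorem adjointSeries_solution :
    AdjointSeries ((opSystem ħ F).solution m q μ) ((opSystem ħ F).conj.solution m q μ) := by
  have key : ∀ n, AdjointSeries
      ((fun x => PowerSeries.X * (opSystem ħ F).iteration m q μ x)^[n] 0)
      ((fun x => PowerSeries.X * (opSystem ħ F).conj.iteration m q μ x)^[n] 0) := by
    intro n
    induction n with
    | zero => exact AdjointSeries.zero
    | succ n ih =>
      rw [Function.iterate_succ_apply', Function.iterate_succ_apply']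
      exact (adjointSeries_iteration m ħ q μ F ih).X_mul
  intro n
  unfold System.solution fixedSeries
  rw [PowerSeries.coeff_mk, PowerSeries.coeff_mk]
  exact key (n + 1) n

end SeriesAdjoint

/-! ### Algebra of the `2 × 2` block transformation. -/

section Block

variable {𝓛 : Type*} [Ring 𝓛] {x xd N Y M Z a b c d : 𝓛}

theorem block_inverse (hN : N * N = 1 + xd * x) (hNY : N * Y = 1) (hYN : Y * N = 1) :
    Y * Y * (1 + xd * x) = 1 ∧ (1 + xd * x) * (Y * Y) = 1 ∧ Y * (1 + xd * x) * Y = 1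
      ∧ Y * (1 + xd * x) = N := by
  rw [← hN]
  refine ⟨?_, ?_, ?_, ?_⟩
  · rw [mul_assoc, ← mul_assoc Y N, hYN, one_mul, hYN]
  · rw [mul_assoc, ← mul_assoc N Y, hNY, one_mul, hNY]
  · rw [← mul_assoc, hYN, one_mul, hNY]
  · rw [← mul_assoc, hYN, one_mul]

/-- From `x (1 + xd x) = (1 + x xd) x` one may pass to the inverses, which are `Y²` and `Z²`. No
intertwining of the square roots themselves is needed. -/
theorem block_intertwine (hN : N * N = 1 + xd * x) (hNY : N * Y = 1) (hYN : Y * N = 1)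
    (hM : M * M = 1 + x * xd) (hMZ : M * Z = 1) (hZM : Z * M = 1) :
    Z * Z * x = x * (Y * Y) := by
  obtain ⟨-, h2, -, -⟩ := block_inverse hN hNY hYN
  obtain ⟨h1, -, -, -⟩ := block_inverse hM hMZ hZM
  calc Z * Z * x = Z * Z * (x * ((1 + xd * x) * (Y * Y))) := by rw [h2, mul_one]
    _ = Z * Z * (1 + x * xd) * (x * (Y * Y)) := by noncomm_ring
    _ = x * (Y * Y) := by rw [h1, one_mul]

/-- In the first product the off-diagonal entries cancel identically and the diagonal ones are `Y (1
+ xd x) Y` and `Z (1 + x xd) Z`. The second product contains `Y` and `Z` only through their squares,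
so `block_intertwine` suffices. -/
theorem block_unitary (hN : N * N = 1 + xd * x) (hNY : N * Y = 1) (hYN : Y * N = 1)
    (hM : M * M = 1 + x * xd) (hMZ : M * Z = 1) (hZM : Z * M = 1) :
    (!![Y, Y * xd; -(Z * x), Z] : Matrix (Fin 2) (Fin 2) 𝓛) * !![Y, -(xd * Z); x * Y, Z] = 1 ∧
    (!![Y, -(xd * Z); x * Y, Z] : Matrix (Fin 2) (Fin 2) 𝓛) * !![Y, Y * xd; -(Z * x), Z] = 1 := by
  have h1 := block_intertwine hN hNY hYN hM hMZ hZM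
  have h2 := block_intertwine hM hMZ hZM hN hNY hYN
  obtain ⟨-, h3, h4, -⟩ := block_inverse hN hNY hYN
  obtain ⟨-, h5, h6, -⟩ := block_inverse hM hMZ hZM
  constructor
  · rw [Matrix.mul_fin_two, Matrix.one_fin_two]
    congr 1
    ext i j
    fin_cases i <;> fin_cases j <;> simp only [Matrix.cons_val', Matrix.cons_val_zero,
      Matrix.cons_val_one, Fin.zero_eta, Fin.mk_one, Matrix.cons_val_fin_one]
    · rw [← h4]; noncomm_ring
    · noncomm_ring
    · noncomm_ring
    · rw [← h6]; noncomm_ring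
  · rw [Matrix.mul_fin_two, Matrix.one_fin_two]
    congr 1
    ext i j
    fin_cases i <;> fin_cases j <;> simp only [Matrix.cons_val', Matrix.cons_val_zero,
      Matrix.cons_val_one, Fin.zero_eta, Fin.mk_one, Matrix.cons_val_fin_one]
    · rw [← h3, add_mul, mul_assoc xd x, ← h1]; noncomm_ring
    · rw [← mul_assoc, h2]; noncomm_ring
    · rw [mul_assoc, ← h1]; noncomm_ring
    · rw [← h5, add_mul, mul_assoc x xd, ← h2]; noncomm_ring

/-- Each off-diagonal entry is the defect of one of the two decoupling equations, between outer
factors `Y` and `Z`. In the upper left entry `h10` turns `c + d x` into `x (a + b x)`, so a factor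
`1 + xd x` splits off and `Y (1 + xd x) = N`. The second, symmetric form of that entry serves to
prove self-adjointness. -/
theorem block_diagonal (hN : N * N = 1 + xd * x) (hNY : N * Y = 1) (hYN : Y * N = 1)
    (h10 : x * a + x * b * x = c + d * x) (h01 : a * xd + xd * c * xd = b + xd * d)
    (H : Matrix (Fin 2) (Fin 2) 𝓛) (hH : H = (!![Y, Y * xd; -(Z * x), Z] : Matrix (Fin 2) (Fin 2) 𝓛)
      * !![a, b; c, d] * !![Y, -(xd * Z); x * Y, Z]) :
    H 0 1 = 0 ∧ H 1 0 = 0 ∧ H 0 0 = N * (a + b * x) * Y ∧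
      H 0 0 = Y * (a + xd * c + b * x + xd * d * x) * Y := by
  obtain ⟨-, -, -, h4⟩ := block_inverse hN hNY hYN
  have e : H 0 0 = Y * (a + xd * c + b * x + xd * d * x) * Y := by
    rw [hH]
    simp [Matrix.mul_apply, Fin.sum_univ_two]
    noncomm_ring
  refine ⟨?_, ?_, ?_, e⟩
  · have : H 0 1 = Y * ((b + xd * d) - (a * xd + xd * c * xd)) * Z := by
      rw [hH]
      simp [Matrix.mul_apply, Fin.sum_univ_two]
      noncomm_ring
    rw [this, h01]
    simp
  · have : H 1 0 = Z * ((c + d * x) - (x * a + x * b * x)) * Y := by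
      rw [hH]
      simp [Matrix.mul_apply, Fin.sum_univ_two]
      noncomm_ring
    rw [this, h10]
    simp
  · rw [e, ← h4]
    have : a + xd * c + b * x + xd * d * x = a + b * x + xd * (c + d * x) := by noncomm_ring
    rw [this, ← h10]
    noncomm_ring

end Block

/-! ### Exact block diagonalization. -/

section Exact

variable {m ħ q μ : ℝ} {F : HomogeneousField} {x xd : PowerSeries Op}

/-- Reversing `φ` and `E` exchanges `h11` with `-h22` and `h12` with `h21`; the condition of the
reversed system is thereby the one that makes the upper right block vanish. -/
theorem conj_decouples (h : (opSystem ħ F).conj.Decouples m q μ xd) :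
    (opSystem ħ F).h11 m q μ * xd + xd * (opSystem ħ F).h21 q μ * xd
      = (opSystem ħ F).h12 q μ + xd * (opSystem ħ F).h22 m q μ := by
  have e1 : (opSystem ħ F).conj.h11 m q μ = -(opSystem ħ F).h22 m q μ := by
    rw [System.h11, System.h22, conj_sB]
    simp only [System.conj, map_neg, mul_neg, smul_neg]
    abel
  have e2 : (opSystem ħ F).conj.h22 m q μ = -(opSystem ħ F).h11 m q μ := by
    rw [System.h11, System.h22, conj_sB]
    simp only [System.conj, map_neg, mul_neg, smul_neg]
    abel
  have e3 : (opSystem ħ F).conj.h12 q μ = (opSystem ħ F).h21 q μ := by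
    rw [System.h12, System.h21, conj_sP, conj_sE, mul_neg, mul_neg, smul_neg, ← sub_eq_add_neg]
    rfl
  have e4 : (opSystem ħ F).conj.h21 q μ = (opSystem ħ F).h12 q μ := by
    rw [System.h12, System.h21, conj_sP, conj_sE, mul_neg, mul_neg, smul_neg, sub_neg_eq_add]
    rfl
  rw [System.Decouples, e1, e2, e3, e4] at h
  have h2 : (opSystem ħ F).h11 m q μ * xd + xd * (opSystem ħ F).h21 q μ * xd
      - ((opSystem ħ F).h12 q μ + xd * (opSystem ħ F).h22 m q μ)
      = (xd * -(opSystem ħ F).h22 m q μ + xd * (opSystem ħ F).h21 q μ * xd)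
      - ((opSystem ħ F).h12 q μ + -(opSystem ħ F).h11 m q μ * xd) := by noncomm_ring
  rw [← sub_eq_zero, h2, h, sub_self]

theorem hamiltonian_eq (m ħ q μ : ℝ) (F : HomogeneousField) : hamiltonian m ħ q μ F =
    !![hamiltonian m ħ q μ F 0 0, hamiltonian m ħ q μ F 0 1;
      hamiltonian m ħ q μ F 1 0, hamiltonian m ħ q μ F 1 1] :=
  Matrix.eta_fin_two _

theorem toLaurent_sqrt_mul_self {T : PowerSeries Op} (hT : PowerSeries.constantCoeff T = 0) :
    toLaurent (taylorOnePlus (fun u => √u) T) * toLaurent (taylorOnePlus (fun u => √u) T)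
      = 1 + toLaurent T := by
  rw [← map_mul, taylor_sqrt_mul_self hT, map_add, map_one]

theorem toLaurent_sqrt_mul_inv {T : PowerSeries Op} (hT : PowerSeries.constantCoeff T = 0) :
    toLaurent (taylorOnePlus (fun u => √u) T) * toLaurent (taylorOnePlus (fun u => 1 / √u) T)
      = 1 := by
  rw [← map_mul, taylor_sqrt_mul_inv hT, map_one]

theorem toLaurent_inv_mul_sqrt {T : PowerSeries Op} (hT : PowerSeries.constantCoeff T = 0) :
    toLaurent (taylorOnePlus (fun u => 1 / √u) T) * toLaurent (taylorOnePlus (fun u => √u) T)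
      = 1 := by
  rw [← map_mul, taylor_inv_mul_sqrt hT, map_one]

/-- Existence and uniqueness of `𝒳` and `𝒳†`. -/
theorem existsUnique_solution (hm : m ≠ 0) :
    (∃! 𝒳 : PowerSeries Op, KutzelniggCondition m ħ q μ F 𝒳) ∧
      ∀ 𝒳 : PowerSeries Op, KutzelniggCondition m ħ q μ F 𝒳 →
        PowerSeries.constantCoeff 𝒳 = 0 ∧
        ∃! Xd : PowerSeries Op, IsSeriesAdjoint (toLaurent 𝒳) (toLaurent Xd) := by
  refine ⟨⟨(opSystem ħ F).solution m q μ, (kutzelniggCondition_iff _ _ _ _ _ _).2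
    ((opSystem ħ F).decouples_solution m q μ hm), fun y hy =>
      ((kutzelniggCondition_iff _ _ _ _ _ _).1 hy).eq_solution hm⟩, fun 𝒳 h => ?_⟩
  rw [((kutzelniggCondition_iff _ _ _ _ _ _).1 h).eq_solution hm]
  refine ⟨System.constantCoeff_solution _ _ _ _, (opSystem ħ F).conj.solution m q μ,
    isSeriesAdjoint_toLaurent.2 (adjointSeries_solution m ħ q μ F), fun y hy => ?_⟩
  exact (isSeriesAdjoint_toLaurent.1 hy).unique (adjointSeries_solution m ħ q μ F)

theorem eq_solution_of_condition (hm : m ≠ 0) (hx : KutzelniggCondition m ħ q μ F x) :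
    x = (opSystem ħ F).solution m q μ :=
  ((kutzelniggCondition_iff _ _ _ _ _ _).1 hx).eq_solution hm

theorem eq_conj_solution_of_adjoint (hm : m ≠ 0) (hx : KutzelniggCondition m ħ q μ F x)
    (hxd : IsSeriesAdjoint (toLaurent x) (toLaurent xd)) :
    xd = (opSystem ħ F).conj.solution m q μ := by
  rw [eq_solution_of_condition hm hx] at hxd
  exact (isSeriesAdjoint_toLaurent.1 hxd).unique (adjointSeries_solution m ħ q μ F)

theorem adjointSeries_h12 (ħ q μ : ℝ) (F : HomogeneousField) :
    AdjointSeries ((opSystem ħ F).h12 q μ) ((opSystem ħ F).h21 q μ) := by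
  have h := adjointSeries_j_sE ħ F
  rw [conj_sE] at h
  have e : (opSystem ħ F).h21 q μ = PowerSeries.X * (opSystem ħ F).sP q
      + μ • (PowerSeries.X ^ 3 * (PowerSeries.C (opSystem ħ F).conj.j * -(opSystem ħ F).sE)) := by
    rw [mul_neg, mul_neg, smul_neg, ← sub_eq_add_neg]
    rfl
  rw [e]
  exact (adjointSeries_sP ħ q F).X_mul.add ((h.X_pow_mul 3).smul μ)

theorem adjointSeries_h11 (m ħ q μ : ℝ) (F : HomogeneousField) :
    AdjointSeries ((opSystem ħ F).h11 m q μ) ((opSystem ħ F).h11 m q μ) := by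
  have hφ : AdjointSeries (PowerSeries.C (opSystem ħ F).φ) (PowerSeries.C (opSystem ħ F).φ) :=
    AdjointSeries.C (isFormalAdjoint_mulOp F.φ F.smooth_φ)
  exact ((AdjointSeries.one.smul m).add ((hφ.X_pow_mul 2).smul q)).sub
    (((adjointSeries_sB ħ F).X_pow_mul 3).smul μ)

theorem adjointSeries_h22 (m ħ q μ : ℝ) (F : HomogeneousField) :
    AdjointSeries ((opSystem ħ F).h22 m q μ) ((opSystem ħ F).h22 m q μ) := by
  have hφ : AdjointSeries (PowerSeries.C (opSystem ħ F).φ) (PowerSeries.C (opSystem ħ F).φ) :=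
    AdjointSeries.C (isFormalAdjoint_mulOp F.φ F.smooth_φ)
  exact ((AdjointSeries.one.smul m).neg.add ((hφ.X_pow_mul 2).smul q)).add
    (((adjointSeries_sB ħ F).X_pow_mul 3).smul μ)

theorem transform_adjoint (h : AdjointSeries x xd) (i j : Fin 2) :
    IsSeriesAdjoint (transform x xd i j) (transformAdjoint x xd j i) := by
  have h1 := (h.symm.mul h).taylor fun u => 1 / √u
  have h2 := (h.mul h.symm).taylor fun u => 1 / √u
  fin_cases i <;> fin_cases j <;>
    simp only [transform, transformAdjoint, invSqrt, Matrix.of_apply, Matrix.cons_val',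
      Matrix.cons_val_zero, Matrix.cons_val_one, Fin.zero_eta, Fin.mk_one,
      Matrix.cons_val_fin_one, ← map_mul, ← map_neg, isSeriesAdjoint_toLaurent]
  · exact h1
  · exact h1.mul h.symm
  · exact (h2.mul h).neg
  · exact h2

theorem constantCoeff_of_condition (hm : m ≠ 0) (hx : KutzelniggCondition m ħ q μ F x) :
    PowerSeries.constantCoeff x = 0 := by
  rw [eq_solution_of_condition hm hx, System.constantCoeff_solution]

theorem transform_unitary (hm : m ≠ 0) (hx : KutzelniggCondition m ħ q μ F x) :
    transform x xd * transformAdjoint x xd = 1 ∧ transformAdjoint x xd * transform x xd = 1 := by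
  have hx0 := constantCoeff_of_condition hm hx
  have h1 : PowerSeries.constantCoeff (xd * x) = 0 := by rw [map_mul, hx0, mul_zero]
  have h2 : PowerSeries.constantCoeff (x * xd) = 0 := by rw [map_mul, hx0, zero_mul]
  refine block_unitary (N := toLaurent (taylorOnePlus (fun u => √u) (xd * x)))
    (M := toLaurent (taylorOnePlus (fun u => √u) (x * xd))) ?_ ?_ ?_ ?_ ?_ ?_
  · rw [toLaurent_sqrt_mul_self h1, map_mul]
  · exact toLaurent_sqrt_mul_inv h1
  · exact toLaurent_inv_mul_sqrt h1
  · rw [toLaurent_sqrt_mul_self h2, map_mul]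
  · exact toLaurent_sqrt_mul_inv h2
  · exact toLaurent_inv_mul_sqrt h2

theorem transformed_blocks (hm : m ≠ 0) (hx : KutzelniggCondition m ħ q μ F x)
    (hxd : IsSeriesAdjoint (toLaurent x) (toLaurent xd)) :
    transformed m ħ q μ F x xd 0 1 = 0 ∧ transformed m ħ q μ F x xd 1 0 = 0 ∧
    transformed m ħ q μ F x xd 0 0 = toLaurent (taylorOnePlus (fun u => √u) (xd * x))
      * (hamiltonian m ħ q μ F 0 0 + hamiltonian m ħ q μ F 0 1 * toLaurent x)
      * invSqrt xd x ∧
    transformed m ħ q μ F x xd 0 0 = invSqrt xd x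
      * (hamiltonian m ħ q μ F 0 0 + toLaurent xd * hamiltonian m ħ q μ F 1 0
        + hamiltonian m ħ q μ F 0 1 * toLaurent x
        + toLaurent xd * hamiltonian m ħ q μ F 1 1 * toLaurent x) * invSqrt xd x := by
  have hx0 := constantCoeff_of_condition hm hx
  have h1 : PowerSeries.constantCoeff (xd * x) = 0 := by rw [map_mul, hx0, mul_zero]
  refine block_diagonal (Z := invSqrt x xd) (d := hamiltonian m ħ q μ F 1 1) ?_ ?_ ?_ ?_ ?_ _ ?_
  · rw [toLaurent_sqrt_mul_self h1, map_mul]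
  · exact toLaurent_sqrt_mul_inv h1
  · exact toLaurent_inv_mul_sqrt h1
  · exact (kutzelniggCondition_iff_hamiltonian _ _ _ _ _ _).1 hx
  · have h2 : (opSystem ħ F).conj.Decouples m q μ xd := by
      rw [eq_conj_solution_of_adjoint hm hx hxd]
      exact System.decouples_solution _ _ _ _ hm
    have h3 := congrArg (fun y => light Op ^ 2 * toLaurent y) (conj_decouples h2)
    simp only [map_add, map_mul, mul_add] at h3
    rw [hamiltonian_00, hamiltonian_01, hamiltonian_10, hamiltonian_11]
    simp only [← mul_assoc, light_sq_comm (toLaurent xd)] at h3 ⊢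
    exact h3
  · rw [← hamiltonian_eq]
    rfl

theorem fwHamiltonian_eq_fw (hm : m ≠ 0) (hx : KutzelniggCondition m ħ q μ F x)
    (hxd : IsSeriesAdjoint (toLaurent x) (toLaurent xd)) :
    fwHamiltonian m ħ q μ F x xd = light Op ^ 2 * toLaurent ((opSystem ħ F).fw m q μ x xd) := by
  obtain ⟨-, -, h, -⟩ := transformed_blocks hm hx hxd
  rw [fwHamiltonian, h, hamiltonian_00, hamiltonian_01, System.fw]
  simp only [map_mul, map_add, mul_assoc, ← mul_add]
  rw [← mul_assoc, light_sq_comm, mul_assoc]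
  rfl

/-- The form `N (a + b x) Y` hides the symmetry. In `Y (a + xd c + b x + xd d x) Y` the outer terms
are self-adjoint and the two middle ones are adjoint to each other. -/
theorem fwHamiltonian_adjoint (hm : m ≠ 0) (hx : KutzelniggCondition m ħ q μ F x)
    (hxd : IsSeriesAdjoint (toLaurent x) (toLaurent xd)) :
    IsSeriesAdjoint (fwHamiltonian m ħ q μ F x xd) (fwHamiltonian m ħ q μ F x xd) := by
  obtain ⟨-, -, -, h⟩ := transformed_blocks hm hx hxd
  have hA := isSeriesAdjoint_toLaurent.1 hxd
  set d := opSystem ħ F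
  have e : fwHamiltonian m ħ q μ F x xd = light Op ^ 2 * toLaurent
      (taylorOnePlus (fun u => 1 / √u) (xd * x) * (d.h11 m q μ + (xd * d.h21 q μ + d.h12 q μ * x)
        + xd * d.h22 m q μ * x) * taylorOnePlus (fun u => 1 / √u) (xd * x)) := by
    rw [fwHamiltonian, h, hamiltonian_00, hamiltonian_01, hamiltonian_10, hamiltonian_11]
    simp only [map_mul, map_add, mul_assoc, mul_add, add_mul, add_assoc]
    simp only [← mul_assoc, light_sq_comm]
    rfl
  rw [e]
  refine IsSeriesAdjoint.light_sq_mul (isSeriesAdjoint_toLaurent.2 ?_)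
  have hY := (hA.symm.mul hA).taylor fun u => 1 / √u
  have h12 := adjointSeries_h12 ħ q μ F
  have hK : AdjointSeries (xd * d.h21 q μ + d.h12 q μ * x) (xd * d.h21 q μ + d.h12 q μ * x) := by
    have := (hA.symm.mul h12.symm).add (h12.mul hA)
    rwa [add_comm (d.h12 q μ * x)] at this
  have h22 := hA.symm.mul_mul (adjointSeries_h22 m ħ q μ F) hA
  exact hY.mul_mul (((adjointSeries_h11 m ħ q μ F).add hK).add h22) hY

theorem fwHamiltonian_eq_kutzelnigg (hm : m ≠ 0) (hx : KutzelniggCondition m ħ q μ F x)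
    (hxd : IsSeriesAdjoint (toLaurent x) (toLaurent xd)) :
    fwHamiltonian m ħ q μ F x xd = kutzelniggHamiltonian m ħ q μ F x xd := by
  obtain ⟨-, -, h, -⟩ := transformed_blocks hm hx hxd
  have hx0 := constantCoeff_of_condition hm hx
  have h1 : PowerSeries.constantCoeff (xd * x) = 0 := by rw [map_mul, hx0, mul_zero]
  rw [fwHamiltonian, h, kutzelniggHamiltonian]
  have hNY := toLaurent_sqrt_mul_inv h1
  have h00 : hamiltonian m ħ q μ F 0 0 = restEnergy m + qPhi q F - muPrime μ * sigmaB F := rfl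
  have h01 : hamiltonian m ħ q μ F 0 1
    = light Op * sigmaPi ħ q F + Complex.I • (muPrime μ * sigmaE F) := rfl
  rw [h00, h01]
  have hr : ∀ y, y * restEnergy m = restEnergy m * y := fun y => by
    rw [restEnergy, laurent_mul_smul, laurent_smul_mul, light_sq_comm]
  have e : restEnergy m + qPhi q F - muPrime μ * sigmaB F
      + (light Op * sigmaPi ħ q F + Complex.I • (muPrime μ * sigmaE F)) * toLaurent x
      = restEnergy m + (qPhi q F + light Op * sigmaPi ħ q F * toLaurent x - muPrime μ * sigmaB F
        + Complex.I • (muPrime μ * sigmaE F * toLaurent x)) := by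
    rw [add_mul, laurent_smul_mul]
    abel
  -- The rest energy is central, so the conjugation by `√(1 + 𝒳†𝒳)` leaves it unchanged.
  rw [e, mul_add, add_mul, hr, mul_assoc (restEnergy m)]
  congr 1
  change restEnergy m * (toLaurent (taylorOnePlus (fun u => √u) (xd * x))
    * toLaurent (taylorOnePlus (fun u => 1 / √u) (xd * x))) = _
  rw [hNY, mul_one]

end Exact

/-! ### Commutators and the free solution. -/

section Perturbation

theorem commute_inverse {𝒬 : Type*} [Ring 𝒬] {g r z : 𝒬} (hgr : g * r = 1) (hrg : r * g = 1)
    (h : Commute z g) : Commute z r := by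
  have h1 : z * r = r * g * (z * r) := by rw [hrg, one_mul]
  calc z * r = r * g * (z * r) := h1
    _ = r * (g * z) * r := by noncomm_ring
    _ = r * (z * g) * r := by rw [h.eq]
    _ = r * z * (g * r) := by noncomm_ring
    _ = r * z := by rw [hgr, mul_one]

/-- The commutator `[z, a]` solves the homogeneous Sylvester equation `a y + y a = [z, a²] = 0`. -/
theorem commute_of_commute_sq {R : Type*} [Ring R] [Algebra ℝ R] {a z : PowerSeries R}
    (ha : PowerSeries.constantCoeff a = 1) (h : Commute z (a * a)) : Commute z a := by
  have h1 : a * (z * a - a * z) + (z * a - a * z) * a = 0 := by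
    have : a * (z * a - a * z) + (z * a - a * z) * a = z * (a * a) - a * a * z := by noncomm_ring
    rw [this, h.eq, sub_self]
  exact sub_eq_zero.1 (sylvester_eq_zero ha ha h1)

/-- One half, as a power series. -/
noncomputable def half (R : Type*) [Ring R] [Algebra ℝ R] : PowerSeries R := (1 / 2 : ℝ) • 1

theorem two_mul_half (R : Type*) [Ring R] [Algebra ℝ R] : 2 * half R = 1 := by
  rw [half, mul_smul_comm, mul_one, one_div, inv_smul_eq_iff₀ two_ne_zero, ofNat_smul_eq_nsmul]
  simp

theorem commute_half {R : Type*} [Ring R] [Algebra ℝ R] (z : PowerSeries R) :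
    Commute z (half R) := (Commute.one_right z).smul_right _

/-- When `ρ` commutes with `g`, the series `ρ/(2g)` visibly solves the equation; `sylvester_eq_zero`
excludes any other solution. -/
theorem sylvester_solve {R : Type*} [Ring R] [Algebra ℝ R] {g r p ρ : PowerSeries R}
    (hg : PowerSeries.constantCoeff g = 1) (hgr : g * r = 1) (hrg : r * g = 1)
    (hρ : Commute ρ g) (h : g * p + p * g = ρ) : p = half R * (r * ρ) := by
  have h2 : g * (r * ρ) = ρ := by rw [← mul_assoc, hgr, one_mul]
  have h3 : r * ρ * g = ρ := by rw [mul_assoc, hρ.eq, ← mul_assoc, hrg, one_mul]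
  have h1 : g * (p - half R * (r * ρ)) + (p - half R * (r * ρ)) * g = 0 := by
    have h4 : g * (p - half R * (r * ρ)) + (p - half R * (r * ρ)) * g
        = (g * p + p * g) - g * half R * (r * ρ) - half R * (r * ρ * g) := by noncomm_ring
    rw [h4, h, h3, (commute_half g).eq, mul_assoc, h2,
      show ρ - half R * ρ - half R * ρ = ρ - 2 * half R * ρ by noncomm_ring, two_mul_half, one_mul,
      sub_self]
  exact sub_eq_zero.1 (sylvester_eq_zero hg hg h1)

/-- The algebra behind the weak-field Hamiltonian, over commuting scalars. -/
theorem weak_identity {K 𝒜 : Type*} [CommRing K] [Ring 𝒜] [Algebra K 𝒜]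
    (g r w h : K) (hgr : g * r = 1) (hw : (1 + g) * w = 1) (hh : 2 * h = 1) (u e s T : 𝒜)
    (hu : u * u = (g * g - 1) • 1) :
    u * (h • r • (w • e - w • w • r • u * (h • (e * u + u * e))
        - s - (w • u) * s * (w • u) + (w • u) * T + T * (w • u)))
      - h • r • r • w • h • (e * u + u * e) - T + s * (w • u)
    = h • h • r • w • (u * e - e * u) + h • r • (s * u - u * s) - T
      + h • r • w • ((u * T + T * u) * u) := by
  have hu' : ∀ y, u * (u * y) = (g * g - 1) • y := fun y => by
    rw [← mul_assoc, hu, smul_mul_assoc, one_mul]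
  simp only [mul_add, add_mul, mul_sub, smul_mul_assoc, mul_smul_comm, mul_assoc, hu', hu,
    mul_one, smul_add, smul_sub, smul_smul]
  match_scalars <;> grind

/-- All elements lie in the centralizer of `g`, and `g`, its inverse `r`, `w = 1/(1 + g)` and `h =
1/2` are central there. Over the centre as ring of scalars the claim is `weak_identity`, where these
four are commuting coefficients while `u`, `e`, `s`, `T` need not commute. -/
theorem weak_identity_ring {𝒬 : Type*} [Ring 𝒬] {g r w h : 𝒬} (hgr : g * r = 1)
    (hrg : r * g = 1) (hw : (1 + g) * w = 1) (hw' : w * (1 + g) = 1) (hh : 2 * h = 1)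
    (hc : ∀ z, Commute z h) {u e s T : 𝒬}
    (hu : u * u = g * g - 1) (hug : Commute u g) (he : Commute e g) (hs : Commute s g)
    (hT : Commute T g) :
    u * (h * (r * (w * e - w * (w * (r * u)) * (h * (e * u + u * e))
        - s - (w * u) * s * (w * u) + (w * u) * T + T * (w * u))))
      - h * (r * (r * (w * (h * (e * u + u * e))))) - T + s * (w * u)
    = h * (h * (r * (w * (u * e - e * u)))) + h * (r * (s * u - u * s)) - T
      + h * (r * (w * ((u * T + T * u) * u))) := by
  let 𝒜 : Subring 𝒬 := Subring.centralizer {g}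
  have mem : ∀ {z}, Commute z g → z ∈ 𝒜 := fun {z} hz => by
    rw [Subring.mem_centralizer_iff]
    rintro a rfl
    exact hz.symm.eq
  have comm : ∀ z : 𝒜, Commute (z : 𝒬) g := fun z =>
    (Subring.mem_centralizer_iff.1 z.2 g rfl).symm
  have hwg : ∀ {z}, Commute z g → Commute z w := fun {z} hz =>
    commute_inverse hw hw' ((Commute.one_right z).add_right hz)
  have hrg' : ∀ {z}, Commute z g → Commute z r := fun {z} hz => commute_inverse hgr hrg hz
  have hgg : Commute g g := Commute.refl g
  let K := Subring.center 𝒜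
  have memK : ∀ {z} (hz : Commute z g), (∀ y, Commute y g → Commute y z) →
      (⟨z, mem hz⟩ : 𝒜) ∈ K := fun {z} hz h => by
    rw [Subring.mem_center_iff]
    intro y
    exact Subtype.ext (h y (comm y)).eq
  let _ : Algebra K 𝒜 := RingHom.toAlgebra' K.subtype fun c x =>
    (Subring.mem_center_iff.1 c.2 x).symm
  have hrr : Commute r g := (hrg' hgg).symm
  have hww : Commute w g := (hwg hgg).symm
  have hhh : Commute h g := (hc g).symm
  have key := weak_identity (K := K) (𝒜 := 𝒜) ⟨⟨g, mem hgg⟩, memK hgg fun y hy => hy⟩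
    ⟨⟨r, mem hrr⟩, memK hrr fun y hy => hrg' hy⟩ ⟨⟨w, mem hww⟩, memK hww fun y hy => hwg hy⟩
    ⟨⟨h, mem hhh⟩, memK hhh fun y _ => hc y⟩ (Subtype.ext (Subtype.ext hgr))
    (Subtype.ext (Subtype.ext hw)) (Subtype.ext (Subtype.ext hh)) ⟨u, mem hug⟩ ⟨e, mem he⟩
    ⟨s, mem hs⟩ ⟨T, mem hT⟩ (Subtype.ext (by
      rw [Algebra.smul_def, mul_one]
      exact hu))
  have key' := congrArg Subtype.val key
  simp only [Algebra.smul_def] at key'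
  exact key'

/-- From `U² = Γ² - 1 = (Γ - 1)(Γ + 1)` follows `U²/(1 + Γ) = Γ - 1`. The last identity says that
`U/(1 + Γ)` solves the condition exactly when `φ` and `μ'` are absent, with the vector potential
still present in `U`. -/
theorem zeroth_solution {𝒮 : Type*} [Ring 𝒮] {U Γ W : 𝒮} (hΓ : Γ * Γ = 1 + U * U)
    (hW : (1 + Γ) * W = 1) (hW' : W * (1 + Γ) = 1) (hUΓ : Commute U Γ) :
    U * W * U = Γ - 1 ∧ U * (U * W) = Γ - 1 ∧ U * W + U * W + U * W * U * (U * W) = U := by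
  have hUW : Commute U W := commute_inverse hW hW' ((Commute.one_right U).add_right hUΓ)
  have h1 : U * (U * W) = Γ - 1 := by
    calc U * (U * W) = (1 + U * U) * W - W := by noncomm_ring
      _ = (Γ - 1) * ((1 + Γ) * W) := by rw [← hΓ]; noncomm_ring
      _ = Γ - 1 := by rw [hW, mul_one]
  have h2 : U * W * U = Γ - 1 := by rw [mul_assoc, ← hUW.eq, h1]
  refine ⟨h2, h1, ?_⟩
  have hWΓ : Commute (U * W) Γ := hUΓ.mul_left
    (commute_inverse hW hW' ((Commute.one_right Γ).add_right (Commute.refl Γ))).symm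
  calc U * W + U * W + U * W * U * (U * W) = U * W + U * W + (Γ - 1) * (U * W) := by rw [h2]
    _ = U * W + Γ * (U * W) := by noncomm_ring
    _ = U * (W * (1 + Γ)) := by rw [← hWΓ.eq]; noncomm_ring
    _ = U := by rw [hW', mul_one]

variable {R : Type*} [Ring R] [Algebra ℝ R]

/-- The difference of two solutions satisfies a homogeneous Sylvester equation with coefficients `1
+ b u` and `1 + u a`, whose constant terms are `1`. -/
theorem zeroth_unique {u a b : PowerSeries R} (hu : PowerSeries.constantCoeff u = 0)
    (ha : a + a + a * u * a = u) (hb : b + b + b * u * b = u) : a = b := by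
  have h : (1 + b * u) * (a - b) + (a - b) * (1 + u * a) = 0 := by
    have : (1 + b * u) * (a - b) + (a - b) * (1 + u * a)
        = (a + a + a * u * a) - (b + b + b * u * b) := by noncomm_ring
    rw [this, ha, hb, sub_self]
  exact sub_eq_zero.1 (sylvester_eq_zero (by simp [hu]) (by simp [hu]) h)

/-- Commutators of `φ` with functions of the velocity. -/
theorem commutator_velocity {f u g r w : PowerSeries R}
    (hg : PowerSeries.constantCoeff g = 1) (hgr : g * r = 1) (hrg : r * g = 1)
    (hw : (1 + g) * w = 1) (hw' : w * (1 + g) = 1) (hgg : g * g = 1 + u * u) (hug : Commute u g)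
    (he : Commute (f * u - u * f) g) :
    let e := f * u - u * f
    let p := r * (half R * (e * u + u * e))
    f * g - g * f = p ∧ f * w - w * f = -(w * p * w) ∧
      f * (u * w) - u * w * f = w * e - w * (w * (r * u)) * (half R * (e * u + u * e)) := by
  intro e p
  have hgc : Commute g r := commute_inverse hgr hrg (Commute.refl g)
  have hewg : Commute (e * u + u * e) g := (he.mul_left hug).add_left (hug.mul_left he)
  have h1 : f * g - g * f = p := by
    -- The derivation `[f, ·]` applied to `g² = 1 + u²` gives a Sylvester equation for `[f, g]`.
    have h2 : g * (f * g - g * f) + (f * g - g * f) * g = e * u + u * e := by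
      calc g * (f * g - g * f) + (f * g - g * f) * g = f * (g * g) - g * g * f := by noncomm_ring
        _ = e * u + u * e := by rw [hgg]; simp only [e]; noncomm_ring
    rw [sylvester_solve hg hgr hrg hewg h2, ← mul_assoc, ← (commute_half r).eq, mul_assoc]
  have h3 : f * w - w * f = -(w * p * w) := by
    calc f * w - w * f = w * (1 + g) * f * w - w * f * ((1 + g) * w) := by
          rw [hw, hw', mul_one, one_mul]
      _ = -(w * (f * g - g * f) * w) := by noncomm_ring
      _ = -(w * p * w) := by rw [h1]
  refine ⟨h1, h3, ?_⟩
  have hwz : ∀ {z}, Commute z g → Commute z w := fun {z} hz =>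
    commute_inverse hw hw' ((Commute.one_right z).add_right hz)
  have hur : Commute u r := commute_inverse hgr hrg hug
  have hwr : Commute w r := commute_inverse hgr hrg (hwz (Commute.refl g)).symm
  have hbw : Commute (half R * (e * u + u * e)) w :=
    (commute_half w).symm.mul_left (hwz hewg)
  calc f * (u * w) - u * w * f = e * w + u * (f * w - w * f) := by simp only [e]; noncomm_ring
    _ = e * w - u * w * r * ((half R * (e * u + u * e)) * w) := by
        rw [h3]; simp only [p]; noncomm_ring
    _ = w * e - w * (w * (r * u)) * (half R * (e * u + u * e)) := by
        rw [hbw.eq, (hwz he).eq, (hwz hug).eq, mul_assoc w u r, hur.eq,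
          show w * (r * u) * (w * (half R * (e * u + u * e)))
            = w * ((r * u) * w) * (half R * (e * u + u * e)) by noncomm_ring,
          (hwr.symm.mul_left (hwz hug)).eq]

/-- The free normalization satisfies `n² = 1 + (u w)² = 2g/(1 + g)`. Applying the derivation `[f,
·]` yields `n [f, n] + [f, n] n = 2 [f, g]/(1 + g)²`, whose right side commutes with `n`, so that
`sylvester_solve` gives `[f, n]`; then `y² = (1 + g)/(2g)` removes the square roots. -/
theorem commutator_normalization {f u g r w n y : PowerSeries R}
    (hg : PowerSeries.constantCoeff g = 1) (hn : PowerSeries.constantCoeff n = 1)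
    (hgr : g * r = 1) (hrg : r * g = 1)
    (hw : (1 + g) * w = 1) (hw' : w * (1 + g) = 1) (hgg : g * g = 1 + u * u) (hug : Commute u g)
    (he : Commute (f * u - u * f) g) (hnn : n * n = 1 + u * w * (u * w)) (hny : n * y = 1)
    (hyn : y * n = 1) :
    let e := f * u - u * f
    (∀ z, Commute z g → Commute z n) ∧
    (f * n - n * f) * y = half R * (r * (r * (w * (half R * (e * u + u * e))))) := by
  intro e
  obtain ⟨h1, h2, -⟩ := commutator_velocity hg hgr hrg hw hw' hgg hug he
  set b := half R * (e * u + u * e) with hb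
  have hwz : ∀ {z}, Commute z g → Commute z w := fun {z} hz =>
    commute_inverse hw hw' ((Commute.one_right z).add_right hz)
  have hrz : ∀ {z}, Commute z g → Commute z r := fun {z} hz => commute_inverse hgr hrg hz
  obtain ⟨h3, h4, -⟩ := zeroth_solution hgg hw hw' hug
  have hn2 : n * n = 2 * (g * w) := by
    calc n * n = 1 + u * w * u * w := by rw [hnn]; noncomm_ring
      _ = (1 + g) * w + (g - 1) * w := by rw [h3, hw]
      _ = 2 * (g * w) := by noncomm_ring
  have hnz : ∀ z, Commute z g → Commute z n := fun z hz =>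
    commute_of_commute_sq hn (by
      rw [hn2]
      exact (Commute.ofNat_right z 2).mul_right (hz.mul_right (hwz hz)))
  refine ⟨hnz, ?_⟩
  have hyz : ∀ {z}, Commute z g → Commute z y := fun {z} hz => commute_inverse hny hyn (hnz z hz)
  have hbg : Commute b g := (commute_half g).symm.mul_left
    ((he.mul_left hug).add_left (hug.mul_left he))
  have hww : Commute w g := (hwz (Commute.refl g)).symm
  have hrr : Commute r g := (hrz (Commute.refl g)).symm
  have hpg : Commute (r * b) g := hrr.mul_left hbg
  have hgw : 1 - g * w = w := by rw [← hw]; noncomm_ring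
  set ρ := 2 * (r * b * w * w) with hρ
  have hρg : Commute ρ g :=
    (Commute.ofNat_left 2 g).mul_left ((hpg.mul_left hww).mul_left hww)
  have h5 : n * (f * n - n * f) + (f * n - n * f) * n = ρ := by
    calc n * (f * n - n * f) + (f * n - n * f) * n = f * (n * n) - n * n * f := by noncomm_ring
      _ = 2 * ((f * g - g * f) * w + g * (f * w - w * f)) := by rw [hn2]; noncomm_ring
      _ = 2 * (r * b * w - g * (w * (r * b) * w)) := by rw [h1, h2]; noncomm_ring
      _ = 2 * (r * b * (1 - g * w) * w) := by
          rw [show g * (w * (r * b) * w) = (g * w) * (r * b) * w by noncomm_ring,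
            ← (hpg.mul_right (hwz hpg)).eq]
          noncomm_ring
      _ = ρ := by rw [hgw, hρ]
  rw [sylvester_solve hn hny hyn (hnz _ hρg) h5]
  have hyy : y * y = half R * ((1 + g) * r) := by
    have h6 : half R * ((1 + g) * r) * (n * n) = 1 := by
      rw [hn2]
      calc half R * ((1 + g) * r) * (2 * (g * w)) = 2 * half R * ((1 + g) * (r * g) * w) := by
            noncomm_ring
        _ = 1 := by rw [two_mul_half, hrg, mul_one, hw, one_mul]
    calc y * y = half R * ((1 + g) * r) * (n * n) * (y * y) := by rw [h6, one_mul]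
      _ = half R * ((1 + g) * r) * (n * (n * y) * y) := by noncomm_ring
      _ = half R * ((1 + g) * r) := by rw [hny, mul_one, hny, mul_one]
  have hgr' : Commute (1 + g) r := (Commute.one_left r).add_left (hrz (Commute.refl g))
  calc half R * (y * ρ) * y = half R * (y * (ρ * y)) := by noncomm_ring
    _ = half R * (y * y * ρ) := by rw [(hyz hρg).eq]; noncomm_ring
    _ = 2 * half R * (half R * ((1 + g) * r) * (r * (b * (w * w)))) := by
        rw [hyy, hρ]; noncomm_ring
    _ = half R * ((1 + g) * (r * r) * (b * (w * w))) := by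
        rw [two_mul_half]; noncomm_ring
    _ = half R * (r * (r * ((1 + g) * w * (w * b)))) := by
        rw [(hgr'.mul_right hgr').eq, ((hwz hbg).mul_right (hwz hbg)).eq]; noncomm_ring
    _ = half R * (r * (r * (w * b))) := by rw [hw, one_mul]

end Perturbation

/-! ### First-order perturbation theory with a derivation `c₁` over `c₀`. -/

section FirstOrder

variable {𝒮 R : Type*} [Ring 𝒮] [Ring R] [Algebra ℝ R]
  {c₀ : 𝒮 →+* PowerSeries R} {c₁ : 𝒮 →+ PowerSeries R}

/-- The first-order part `d` of the solution `x` of Kutzelnigg's condition. -/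
theorem firstOrder_solution (hc : ∀ a b, c₁ (a * b) = c₀ a * c₁ b + c₁ a * c₀ b)
    {U Γ W x φ T s : 𝒮} (hφ : c₀ φ = 0) (hT : c₀ T = 0) (hs : c₀ s = 0)
    (hΓ : Γ * Γ = 1 + U * U) (hW : (1 + Γ) * W = 1) (hW' : W * (1 + Γ) = 1) (hUΓ : Commute U Γ)
    (hU : PowerSeries.constantCoeff (c₀ U) = 0)
    (hx : x * (1 + φ - T) + x * (U + s) * x = U - s + (-1 + φ + T) * x) :
    c₀ x = c₀ U * c₀ W ∧
      c₀ Γ * c₁ (x - U * W) + c₁ (x - U * W) * c₀ Γ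
        = (c₁ φ * (c₀ U * c₀ W) - c₀ U * c₀ W * c₁ φ) - c₁ s
          - c₀ U * c₀ W * c₁ s * (c₀ U * c₀ W) + c₀ U * c₀ W * c₁ T + c₁ T * (c₀ U * c₀ W) := by
  obtain ⟨h1, h2, h3⟩ := zeroth_solution hΓ hW hW' hUΓ
  have hx0 : c₀ x = c₀ U * c₀ W := by
    have h4 := congrArg c₀ hx
    simp only [map_add, map_sub, map_mul, map_neg, map_one, hφ, hT, hs, add_zero, sub_zero,
      mul_one, neg_mul, one_mul] at h4
    have h5 := congrArg c₀ h3
    simp only [map_add, map_mul] at h5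
    refine zeroth_unique hU ?_ h5
    rw [show c₀ x + c₀ x + c₀ x * c₀ U * c₀ x = c₀ x + (c₀ x + c₀ x * c₀ U * c₀ x) by abel, h4]
    abel
  refine ⟨hx0, ?_⟩
  set δ := x - U * W with hδ
  have hδ0 : c₀ δ = 0 := by rw [hδ, map_sub, map_mul, hx0, sub_self]
  -- The exact equation for `δ`, obtained by subtracting the free equation of `U W`. As `c₀ δ = 0`,
  -- applying `c₁` leaves `δ` linear, and `U (U W) = U W U = Γ - 1` turns its coefficients into `Γ`
  -- on either side.
  have h4 : δ + δ + δ * U * x + U * W * U * δ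
      = (φ * x - x * φ) - s - x * s * x + x * T + T * x := by
    have h5 : δ + δ + δ * U * x + U * W * U * δ
        = (x + x + x * U * x) - (U * W + U * W + U * W * U * (U * W)) := by
      rw [hδ]; noncomm_ring
    have h6 : x + x + x * U * x = (x * (1 + φ - T) + x * (U + s) * x) - (-1 + φ + T) * x
        + (φ * x - x * φ) - x * s * x + x * T + T * x := by noncomm_ring
    rw [h5, h3, h6, hx]
    noncomm_ring
  have h7 := congrArg c₁ h4
  rw [h1] at h7
  have hc1 : c₁ 1 = 0 := by
    have := hc 1 1
    simpa using this
  simp only [map_add, map_sub, hc, map_mul, map_one, hδ0, hx0, hφ, hT, hs, hc1, zero_mul, mul_zero,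
    zero_add, add_zero, sub_zero] at h7
  have h8 : c₀ U * (c₀ U * c₀ W) = c₀ Γ - 1 := by
    have := congrArg c₀ h2
    simpa using this
  rw [mul_assoc (c₁ δ), h8] at h7
  rw [← sub_eq_zero] at h7 ⊢
  rw [← h7]
  noncomm_ring

/-- Writing `x = U W + δ` gives `1 + φ - T + (U + s) x = Γ + k` with `k = φ - T + s x + U δ` of
first order. Conjugation by `N` fixes `Γ` to first order. In `k`, all parts except `φ` commute with
the free `Γ` and hence with the free `N`, so that only `-[φ, N] Y` is added. The series `τ` measures
the first-order difference between `γ²` and `Γ²`. The hypotheses `he`, `hTg`, `hsg` and `hτg`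
express the constancy of the fields; `φ` itself is not assumed to commute with `Γ`. -/
theorem firstOrder_weak (hc : ∀ a b, c₁ (a * b) = c₀ a * c₁ b + c₁ a * c₀ b)
    {U γ Γ W x xd N Y φ T s : 𝒮} {r τ : PowerSeries R}
    (hφ : c₀ φ = 0) (hT : c₀ T = 0) (hs : c₀ s = 0)
    (hΓ : Γ * Γ = 1 + U * U) (hW : (1 + Γ) * W = 1) (hW' : W * (1 + Γ) = 1) (hUΓ : Commute U Γ)
    (hU : PowerSeries.constantCoeff (c₀ U) = 0) (hg : PowerSeries.constantCoeff (c₀ Γ) = 1)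
    (hn : PowerSeries.constantCoeff (c₀ N) = 1)
    (hx : x * (1 + φ - T) + x * (U + s) * x = U - s + (-1 + φ + T) * x)
    (hxd : xd * (1 + -φ - T) + xd * (U + -s) * xd = U - -s + (-1 + -φ + T) * xd)
    (hN : N * N = 1 + xd * x) (hNY : N * Y = 1) (hYN : Y * N = 1)
    (hγ : c₀ γ = c₀ Γ) (hτ : c₁ (γ * γ) = c₁ (U * U) + τ)
    (hgr : c₀ Γ * r = 1) (hrg : r * c₀ Γ = 1)
    (he : Commute (c₁ φ * c₀ U - c₀ U * c₁ φ) (c₀ Γ)) (hTg : Commute (c₁ T) (c₀ Γ))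
    (hsg : Commute (c₁ s) (c₀ Γ)) (hτg : Commute τ (c₀ Γ)) :
    let u := c₀ U
    let w := c₀ W
    let e := c₁ φ * u - u * c₁ φ
    let h := half R
    c₀ (N * (1 + φ - T + (U + s) * x) * Y) = c₀ γ ∧
    c₁ (N * (1 + φ - T + (U + s) * x) * Y) = c₁ γ - h * (r * τ) + c₁ φ
      + (h * (h * (r * (w * (u * e - e * u)))) + h * (r * (c₁ s * u - u * c₁ s)) - c₁ T
      + h * (r * (w * ((u * c₁ T + c₁ T * u) * u)))) := by
  intro u w e h
  obtain ⟨hx0, hd⟩ := firstOrder_solution hc hφ hT hs hΓ hW hW' hUΓ hU hx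
  obtain ⟨hxd0, hdd⟩ := firstOrder_solution hc (by rw [map_neg, hφ, neg_zero]) hT
    (by rw [map_neg, hs, neg_zero]) hΓ hW hW' hUΓ hU hxd
  set g := c₀ Γ with hgdef
  have hgg : g * g = 1 + u * u := by
    have := congrArg c₀ hΓ
    simpa using this
  have hw : (1 + g) * w = 1 := by
    have := congrArg c₀ hW
    simpa using this
  have hw' : w * (1 + g) = 1 := by
    have := congrArg c₀ hW'
    simpa using this
  have hug : Commute u g := hUΓ.map c₀
  have hwz : ∀ {z}, Commute z g → Commute z w := fun {z} hz =>
    commute_inverse hw hw' ((Commute.one_right z).add_right hz)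
  have hwg : Commute w g := (hwz (Commute.refl g)).symm
  have hx0g : Commute (u * w) g := hug.mul_left hwg
  obtain ⟨-, -, hcx⟩ := commutator_velocity hg hgr hrg hw hw' hgg hug he
  have hn2 : c₀ N * c₀ N = 1 + u * w * (u * w) := by
    have := congrArg c₀ hN
    simpa [hx0, hxd0] using this
  have hny : c₀ N * c₀ Y = 1 := by
    have := congrArg c₀ hNY
    simpa using this
  have hyn : c₀ Y * c₀ N = 1 := by
    have := congrArg c₀ hYN
    simpa using this
  obtain ⟨hnz, hζ⟩ := commutator_normalization hg hn hgr hrg hw hw' hgg hug he hn2 hny hyn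
  have hrz : ∀ {z}, Commute z g → Commute z r := fun {z} hz => commute_inverse hgr hrg hz
  have hrr : Commute r g := (hrz (Commute.refl g)).symm
  have hhg : Commute h g := (commute_half g).symm
  have heu : Commute (e * u + u * e) g := (he.mul_left hug).add_left (hug.mul_left he)
  have hcg : Commute (c₁ φ * (u * w) - u * w * c₁ φ) g := by
    rw [hcx]
    exact (hwg.mul_left he).sub_left ((hwg.mul_left (hwg.mul_left (hrr.mul_left hug))).mul_left
      (hhg.mul_left heu))
  have hρg : Commute ((c₁ φ * (u * w) - u * w * c₁ φ) - c₁ s - u * w * c₁ s * (u * w)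
      + u * w * c₁ T + c₁ T * (u * w)) g :=
    (((hcg.sub_left hsg).sub_left ((hx0g.mul_left hsg).mul_left hx0g)).add_left
      (hx0g.mul_left hTg)).add_left (hTg.mul_left hx0g)
  have hρg' : Commute ((c₁ (-φ) * (u * w) - u * w * c₁ (-φ)) - c₁ (-s) - u * w * c₁ (-s) * (u * w)
      + u * w * c₁ T + c₁ T * (u * w)) g := by
    refine ((Commute.sub_left (Commute.sub_left ?_ ?_) ?_).add_left
      (hx0g.mul_left hTg)).add_left (hTg.mul_left hx0g)
    · rw [map_neg, show -c₁ φ * (u * w) - u * w * -c₁ φ = -(c₁ φ * (u * w) - u * w * c₁ φ) by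
        noncomm_ring]
      exact hcg.neg_left
    · rw [map_neg]; exact hsg.neg_left
    · rw [map_neg]; exact (hx0g.mul_left hsg.neg_left).mul_left hx0g
  have hd1 := sylvester_solve hg hgr hrg hρg hd
  have hd2 := sylvester_solve hg hgr hrg hρg' hdd
  set δ := x - U * W with hδ
  set δ' := xd - U * W with hδ'
  have hδ0 : c₀ δ = 0 := by rw [hδ, map_sub, map_mul, hx0, sub_self]
  have hδ0' : c₀ δ' = 0 := by rw [hδ', map_sub, map_mul, hxd0, sub_self]
  have hdg : Commute (c₁ δ) g := by
    rw [hd1]; exact (commute_half g).symm.mul_left (hrr.mul_left hρg)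
  have hdg' : Commute (c₁ δ') g := by
    rw [hd2]; exact (commute_half g).symm.mul_left (hrr.mul_left hρg')
  -- the normalization commutes with `Γ` to first order
  have hNΓ0 : c₀ (N * Γ - Γ * N) = 0 := by
    rw [map_sub, map_mul, map_mul, sub_eq_zero]
    exact (hnz g (Commute.refl g)).symm
  have hNΓ1 : c₁ (N * Γ - Γ * N) = 0 := by
    -- The commutator of `N² = 1 + xd x` with `Γ`. The main part `(U W)²` commutes with `Γ` exactly,
    -- so `firstPart` of `Γ`, about which no commutation is known, never enters; the remainder is
    -- linear in `δ` and `δ'`, which commute with the free `Γ`.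
    have h5 : N * (N * Γ - Γ * N) + (N * Γ - Γ * N) * N
        = (U * W * δ + δ' * (U * W) + δ' * δ) * Γ - Γ * (U * W * δ + δ' * (U * W) + δ' * δ) := by
      have h6 : N * (N * Γ - Γ * N) + (N * Γ - Γ * N) * N = N * N * Γ - Γ * (N * N) := by
        noncomm_ring
      have h7 : xd * x = U * W * (U * W) + (U * W * δ + δ' * (U * W) + δ' * δ) := by
        rw [hδ, hδ']; noncomm_ring
      have hWΓ : Commute W Γ :=
        (commute_inverse hW hW' ((Commute.one_right Γ).add_right (Commute.refl Γ))).symm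
      have h8 : Commute (U * W * (U * W)) Γ :=
        (hUΓ.mul_left hWΓ).mul_left (hUΓ.mul_left hWΓ)
      rw [h6, hN, h7]
      have h9 : ∀ a b : 𝒮, (1 + (a + b)) * Γ - Γ * (1 + (a + b)) = (a * Γ - Γ * a)
          + (b * Γ - Γ * b) := fun a b => by noncomm_ring
      rw [h9, h8.eq, sub_self, zero_add]
    have h6 := congrArg c₁ h5
    simp only [map_add, map_sub, hc, map_mul, hδ0, hδ0', mul_zero, zero_mul, add_zero,
      zero_add] at h6
    have h7 : c₀ N * g - g * c₀ N = 0 := by rw [(hnz g (Commute.refl g)).eq, sub_self]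
    have h8 : Commute (c₀ U * c₀ W * c₁ δ + c₁ δ' * (c₀ U * c₀ W)) g :=
      (hx0g.mul_left hdg).add_left (hdg'.mul_left hx0g)
    rw [h8.eq, sub_self] at h6
    have h9 : c₀ N * c₁ (N * Γ - Γ * N) + c₁ (N * Γ - Γ * N) * c₀ N = 0 := by
      rw [← h6]
      simp only [map_sub, hc]
      rw [show c₁ N * (c₀ N * c₀ Γ - c₀ Γ * c₀ N) = 0 by rw [h7, mul_zero],
        show (c₀ N * c₀ Γ - c₀ Γ * c₀ N) * c₁ N = 0 by rw [h7, zero_mul]]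
      abel
    exact sylvester_eq_zero hn hn h9
  -- the transformed Hamiltonian
  set k := φ - T + s * x + U * δ with hk
  obtain ⟨-, h2, -⟩ := zeroth_solution hΓ hW hW' hUΓ
  have hfw : N * (1 + φ - T + (U + s) * x) * Y = Γ + (N * Γ - Γ * N) * Y + N * k * Y := by
    have h5 : 1 + φ - T + (U + s) * x = Γ + k := by
      rw [hk, hδ, mul_sub, h2]; noncomm_ring
    rw [h5, mul_add, add_mul, show N * Γ * Y = Γ * (N * Y) + (N * Γ - Γ * N) * Y by noncomm_ring,
      hNY, mul_one]
  have hk0 : c₀ k = 0 := by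
    simp only [hk, map_add, map_sub, map_mul, hφ, hT, hs, hδ0, mul_zero, zero_mul, sub_zero,
      add_zero]
  have hk1 : c₁ k = c₁ φ + (u * c₁ δ - c₁ T + c₁ s * (w * u)) := by
    simp only [hk, map_add, map_sub, hc, hs, hx0, hδ0, mul_zero, zero_mul, zero_add, add_zero]
    rw [(hwz hug).eq]
    abel
  have hwu : Commute (w * u) g := hwg.mul_left hug
  have hrest : Commute (u * c₁ δ - c₁ T + c₁ s * (w * u)) (c₀ N) :=
    hnz _ (((hug.mul_left hdg).sub_left hTg).add_left (hsg.mul_left hwu))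
  have hΓγ : c₁ Γ = c₁ γ - h * (r * τ) := by
    -- Since `γ` and `Γ` have the same zeroth part, the first-order part of `γ² - Γ²` is a Sylvester
    -- expression in the difference of their first parts.
    have h5 : g * (c₁ γ - c₁ Γ) + (c₁ γ - c₁ Γ) * g = τ := by
      have h6 : c₁ (Γ * Γ) = c₁ (U * U) := by
        rw [hΓ, map_add]
        have := hc 1 1
        simp only [mul_one, map_one, one_mul] at this
        rw [left_eq_add.1 this, zero_add]
      rw [← h6, hc, hc, hγ] at hτ
      calc g * (c₁ γ - c₁ Γ) + (c₁ γ - c₁ Γ) * g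
          = (g * c₁ γ + c₁ γ * g) - (g * c₁ Γ + c₁ Γ * g) := by noncomm_ring
        _ = τ := by rw [hτ, add_sub_cancel_left]
    rw [← sylvester_solve hg hgr hrg hτg h5]
    abel
  refine ⟨?_, ?_⟩
  · rw [hfw, map_add, map_add, map_mul, map_mul, map_mul, hNΓ0, hk0, hγ, zero_mul, mul_zero,
      zero_mul, add_zero, add_zero]
  · have h5 : c₁ (N * k * Y) = c₁ φ - (c₁ φ * c₀ N - c₀ N * c₁ φ) * c₀ Y
        + (u * c₁ δ - c₁ T + c₁ s * (w * u)) := by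
      rw [hc, hc, map_mul, hk0, hk1, mul_zero, zero_mul, mul_zero, zero_add, add_zero, mul_add,
        ← hrest.eq, add_mul, mul_assoc (u * c₁ δ - c₁ T + c₁ s * (w * u)), hny, mul_one]
      congr 1
      calc c₀ N * c₁ φ * c₀ Y = c₁ φ * (c₀ N * c₀ Y) - (c₁ φ * c₀ N - c₀ N * c₁ φ) * c₀ Y := by
            noncomm_ring
        _ = _ := by rw [hny, mul_one]
    have hugg : u * u = g * g - 1 := by rw [hgg]; noncomm_ring
    have key := weak_identity_ring (h := h) hgr hrg hw hw' (two_mul_half R)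
      (fun z => commute_half z) hugg hug he hsg hTg
    rw [hfw, map_add, map_add, hc, hNΓ0, hNΓ1, zero_mul, zero_mul, add_zero, add_zero, h5, hζ, hd1,
      hΓγ, hcx, (hwz hug).eq, ← key]
    abel
end FirstOrder

/-! ### Commutation relations and the formal field strength. -/

namespace System

/-- The commutation relations of a system. -/
structure Laws {R : Type*} [Ring R] [Algebra ℝ R] (d : System R) (ħ : ℝ) : Prop where
  j_comm : ∀ z, Commute d.j z
  j_sq : d.j * d.j = -1
  E_comm : ∀ i z, Commute (d.E i) z
  B_comm : ∀ i z, Commute (d.B i) z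
  σ_sq : ∀ i, d.σ i * d.σ i = 1
  σ_mul : ∀ i, d.σ i * d.σ (i + 1) = d.j * d.σ (i + 2)
  σ_mul' : ∀ i, d.σ (i + 1) * d.σ i = -(d.j * d.σ (i + 2))
  σ_p : ∀ i k, Commute (d.σ i) (d.p k)
  σ_A : ∀ i k, Commute (d.σ i) (d.A k)
  p_p : ∀ i k, Commute (d.p i) (d.p k)
  A_A : ∀ i k, Commute (d.A i) (d.A k)
  φ_A : ∀ i, Commute d.φ (d.A i)
  σ_φ : ∀ i, Commute (d.σ i) d.φ
  φ_p : ∀ i, d.φ * d.p i - d.p i * d.φ = -(ħ • (d.j * d.E i))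
  p_A : ∀ i, (d.p i * d.A (i + 1) - d.A (i + 1) * d.p i) - (d.p (i + 1) * d.A i - d.A i * d.p (i + 1))
    = -(ħ • (d.j * d.B (i + 2)))

/-- The system with potentials and fields multiplied by a formal parameter `t`. -/
noncomputable def scaled {R : Type*} [Ring R] (d : System R) : System (Polynomial R) where
  j := Polynomial.C d.j
  φ := Polynomial.X * Polynomial.C d.φ
  p i := Polynomial.C (d.p i)
  A i := Polynomial.X * Polynomial.C (d.A i)
  σ i := Polynomial.C (d.σ i)
  E i := Polynomial.X * Polynomial.C (d.E i)
  B i := Polynomial.X * Polynomial.C (d.B i)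

theorem commute_X_mul_C {R : Type*} [Ring R] {a b : R} (h : Commute a b) :
    Commute (Polynomial.C a) (Polynomial.X * Polynomial.C b) :=
  (Polynomial.commute_X (Polynomial.C a)).symm.mul_right (h.map Polynomial.C)

theorem commute_X_mul_C_all {R : Type*} [Ring R] {a : R} (h : ∀ b, Commute a b)
    (p : Polynomial R) : Commute (Polynomial.C a) p := by
  refine Polynomial.ext fun n => ?_
  rw [Polynomial.coeff_C_mul, Polynomial.coeff_mul_C, (h _).eq]

theorem X_mul_mul_X_mul {R : Type*} [Ring R] (a b : Polynomial R) :
    Polynomial.X * a * (Polynomial.X * b) = Polynomial.X * (Polynomial.X * (a * b)) := by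
  rw [mul_assoc, ← mul_assoc a, ← Polynomial.X_mul, mul_assoc]

/-- Each relation is homogeneous in the potentials and fields together: multiplying them by the
central variable multiplies both sides by the same power of it. -/
theorem Laws.scaled {R : Type*} [Ring R] [Algebra ℝ R] {d : System R} {ħ : ℝ} (h : d.Laws ħ) :
    d.scaled.Laws ħ where
  j_comm z := commute_X_mul_C_all h.j_comm z
  j_sq := by
    simp only [System.scaled]
    rw [← Polynomial.C_mul, h.j_sq, Polynomial.C_neg, Polynomial.C_1]
  E_comm i z := (Polynomial.commute_X z).mul_left (commute_X_mul_C_all (h.E_comm i) z)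
  B_comm i z := (Polynomial.commute_X z).mul_left (commute_X_mul_C_all (h.B_comm i) z)
  σ_sq i := by
    simp only [System.scaled]
    rw [← Polynomial.C_mul, h.σ_sq, Polynomial.C_1]
  σ_mul i := by
    simp only [System.scaled]
    rw [← Polynomial.C_mul, ← Polynomial.C_mul, h.σ_mul]
  σ_mul' i := by
    simp only [System.scaled]
    rw [← Polynomial.C_mul, ← Polynomial.C_mul, h.σ_mul', Polynomial.C_neg]
  σ_p i k := (h.σ_p i k).map Polynomial.C
  σ_A i k := commute_X_mul_C (h.σ_A i k)
  p_p i k := (h.p_p i k).map Polynomial.C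
  A_A i k := by
    change _ * _ = _ * _
    simp only [System.scaled]
    rw [X_mul_mul_X_mul, X_mul_mul_X_mul, ← Polynomial.C_mul, (h.A_A i k).eq, Polynomial.C_mul]
  φ_A i := by
    change _ * _ = _ * _
    simp only [System.scaled]
    rw [X_mul_mul_X_mul, X_mul_mul_X_mul, ← Polynomial.C_mul, (h.φ_A i).eq, Polynomial.C_mul]
  σ_φ i := commute_X_mul_C (h.σ_φ i)
  φ_p i := by
    have := congrArg (fun z => Polynomial.X * Polynomial.C z) (h.φ_p i)
    simp only [System.scaled, Polynomial.C_sub, Polynomial.C_mul, Polynomial.C_neg,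
      ← Polynomial.smul_C, mul_sub, mul_neg, mul_smul_comm] at this ⊢
    rw [mul_assoc, ← mul_assoc (Polynomial.C (d.p i)), ← Polynomial.X_mul, mul_assoc, this,
      ← mul_assoc (Polynomial.C d.j), ← Polynomial.X_mul, mul_assoc]
  p_A i := by
    have := congrArg (fun z => Polynomial.X * Polynomial.C z) (h.p_A i)
    have hX : ∀ a b : R, Polynomial.C a * (Polynomial.X * Polynomial.C b)
        = Polynomial.X * (Polynomial.C a * Polynomial.C b) := fun a b => by
      rw [← mul_assoc, ← Polynomial.X_mul, mul_assoc]
    simp only [System.scaled, Polynomial.C_sub, Polynomial.C_mul, Polynomial.C_neg,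
      ← Polynomial.smul_C, mul_sub, mul_neg, mul_smul_comm] at this ⊢
    simp only [hX, mul_assoc] at this ⊢
    exact this

section Identities

/-- `(σ·a)(σ·b)` for vectors that commute with the spin. -/
theorem sigma_dot_mul {R : Type*} [Ring R] {j : R} {σ a b : Fin 3 → R}
    (σ_sq : ∀ i, σ i * σ i = 1) (σ_mul : ∀ i, σ i * σ (i + 1) = j * σ (i + 2))
    (σ_mul' : ∀ i, σ (i + 1) * σ i = -(j * σ (i + 2)))
    (ha : ∀ i k, Commute (σ i) (a k)) :
    (σ ⬝ᵥ a) * (σ ⬝ᵥ b) = a ⬝ᵥ b + j * (σ 2 * (a 0 * b 1 - a 1 * b 0)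
      + σ 0 * (a 1 * b 2 - a 2 * b 1) + σ 1 * (a 2 * b 0 - a 0 * b 2)) := by
  have key : ∀ i k, σ i * a i * (σ k * b k) = σ i * σ k * (a i * b k) := fun i k => by
    rw [mul_assoc, ← mul_assoc (a i), ← (ha k i).eq]
    noncomm_ring
  have h01 : σ 0 * σ 1 = j * σ 2 := σ_mul 0
  have h12 : σ 1 * σ 2 = j * σ 0 := σ_mul 1
  have h20 : σ 2 * σ 0 = j * σ 1 := σ_mul 2
  have h10 : σ 1 * σ 0 = -(j * σ 2) := σ_mul' 0
  have h21 : σ 2 * σ 1 = -(j * σ 0) := σ_mul' 1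
  have h02 : σ 0 * σ 2 = -(j * σ 1) := σ_mul' 2
  simp only [dotProduct, Fin.sum_univ_three, mul_add, add_mul, key, σ_sq, h01, h12, h20, h10, h21,
    h02]
  noncomm_ring

end Identities

end System

/-- Constancy of the fields enters here. The commutators of `p` with the potentials are
multiplications by their derivatives; for `φ`, and for the antisymmetrized derivatives of `A`, these
are constants and hence central. Indices are taken cyclically in `Fin 3`. -/
theorem opSystem_laws (ħ : ℝ) (F : HomogeneousField) : (opSystem ħ F).Laws ħ where
  j_comm z := LinearMap.ext fun f => by simp [opSystem]
  j_sq := by simp [opSystem, smul_smul]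
  E_comm i z := Algebra.commute_algebraMap_left (F.E i) z
  B_comm i z := Algebra.commute_algebraMap_left (F.B i) z
  σ_sq i := by
    change matrixOp _ * matrixOp _ = 1
    rw [matrixOp_mul, ← matrixOp_one]
    congr 1
    fin_cases i <;> ext a b <;> fin_cases a <;> fin_cases b <;> simp [pauli, Matrix.mul_apply]
  σ_mul i := by
    change matrixOp _ * matrixOp _ = (Complex.I • 1) * matrixOp _
    rw [matrixOp_mul, smul_one_mul, ← matrixOp_smul]
    congr 1
    fin_cases i <;> ext a b <;> fin_cases a <;> fin_cases b <;> simp [pauli, Matrix.mul_apply]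
  σ_mul' i := by
    change matrixOp _ * matrixOp _ = -((Complex.I • 1) * matrixOp _)
    rw [matrixOp_mul, smul_one_mul, ← neg_smul, ← matrixOp_smul]
    congr 1
    fin_cases i <;> ext a b <;> fin_cases a <;> fin_cases b <;> simp [pauli, Matrix.mul_apply]
  σ_p i k := sigma_commute_momentum ħ i k
  σ_A i k := sigma_commute_mulOp i (F.A k) (F.smooth_A k)
  p_p i k := momentum_commute ħ i k
  A_A i k := mulOp_commute (F.A i) (F.A k) (F.smooth_A i) (F.smooth_A k)
  φ_A i := mulOp_commute F.φ (F.A i) F.smooth_φ (F.smooth_A i)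
  σ_φ i := sigma_commute_mulOp i F.φ F.smooth_φ
  φ_p i := by
    have h := momentum_mulOp ħ i F.φ F.smooth_φ
    have h2 : mulOp (partialDeriv i F.φ) (partialDeriv_contDiff i F.smooth_φ)
        = (-F.E i) • (1 : Op) := op_ext fun f x => by
      rw [mulOp_apply, smul_op_apply, ← neg_eq_iff_eq_neg.2 (F.electric x i)]
      rfl
    change potential F * momentum ħ i - momentum ħ i * potential F
      = -(ħ • ((Complex.I • 1) * algebraMap ℝ Op (F.E i)))
    rw [← neg_sub, potential, h, h2, smul_one_mul, Algebra.algebraMap_eq_smul_one]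
    congr 1
    refine op_ext fun f x => ?_
    simp only [smul_op_apply, csmul_op_apply]
    ext a
    simp
    ring
  p_A i := by
    have h := momentum_mulOp ħ i (F.A (i + 1)) (F.smooth_A (i + 1))
    have h' := momentum_mulOp ħ (i + 1) (F.A i) (F.smooth_A i)
    change (momentum ħ i * mulOp (F.A (i + 1)) (F.smooth_A (i + 1))
      - mulOp (F.A (i + 1)) (F.smooth_A (i + 1)) * momentum ħ i)
      - (momentum ħ (i + 1) * mulOp (F.A i) (F.smooth_A i)
        - mulOp (F.A i) (F.smooth_A i) * momentum ħ (i + 1))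
      = -(ħ • ((Complex.I • 1) * algebraMap ℝ Op (F.B (i + 2))))
    rw [h, h', smul_one_mul, Algebra.algebraMap_eq_smul_one]
    refine op_ext fun f x => ?_
    have hB : F.B (i + 2) = partialDeriv i (F.A (i + 1)) x - partialDeriv (i + 1) (F.A i) x := by
      have := F.magnetic x
      fin_cases i
      · exact congrFun this 2
      · exact congrFun this 0
      · exact congrFun this 1
    have hn : ∀ (S : Op), (-S) f x = -(S f x) := fun _ => rfl
    simp only [sub_op_apply, hn, smul_op_apply, csmul_op_apply, mulOp_apply, hB]
    ext a
    simp
    ring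

/-! ### Expansion to first order in the formal field strength. -/

/-- Evaluation at `t = 0`, as a homomorphism of `ℝ`-algebras. -/
noncomputable def evalZero (R : Type*) [Ring R] [Algebra ℝ R] : Polynomial R →ₐ[ℝ] R :=
  { Polynomial.constantCoeff with
    commutes' := fun r => by simp [Polynomial.algebraMap_apply] }

/-- The part of a series that is of order zero in the formal parameter `t`. -/
noncomputable def zerothPart (R : Type*) [Ring R] [Algebra ℝ R] :
    PowerSeries (Polynomial R) →+* PowerSeries R :=
  PowerSeries.map (evalZero R : Polynomial R →+* R)

/-- The part of a series that is of first order in the formal parameter `t`. -/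
noncomputable def firstPart (R : Type*) [Ring R] [Algebra ℝ R] :
    PowerSeries (Polynomial R) →+ PowerSeries R where
  toFun a := PowerSeries.mk fun k => (PowerSeries.coeff k a).coeff 1
  map_zero' := by ext; simp
  map_add' a b := by ext; simp

section Parts

variable {R : Type*} [Ring R] [Algebra ℝ R]

theorem coeff_zerothPart (k : ℕ) (a : PowerSeries (Polynomial R)) :
    PowerSeries.coeff k (zerothPart R a) = (PowerSeries.coeff k a).coeff 0 := by
  rw [zerothPart, PowerSeries.coeff_map]
  rfl

theorem coeff_firstPart (k : ℕ) (a : PowerSeries (Polynomial R)) :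
    PowerSeries.coeff k (firstPart R a) = (PowerSeries.coeff k a).coeff 1 :=
  PowerSeries.coeff_mk k fun k => (PowerSeries.coeff k a).coeff 1

/-- The coefficient of `t` in a product: Leibniz's rule modulo `t²`. This is the hypothesis `hc` of
the first-order lemmas. -/
theorem firstPart_mul (a b : PowerSeries (Polynomial R)) :
    firstPart R (a * b) = zerothPart R a * firstPart R b + firstPart R a * zerothPart R b := by
  ext k
  simp only [coeff_firstPart, PowerSeries.coeff_mul, map_add, coeff_zerothPart,
    Polynomial.finsetSum_coeff, Polynomial.mul_coeff_one, Finset.sum_add_distrib]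

theorem zerothPart_smul (r : ℝ) (a : PowerSeries (Polynomial R)) :
    zerothPart R (r • a) = r • zerothPart R a := by
  ext k
  simp only [coeff_zerothPart, PowerSeries.coeff_smul, Polynomial.coeff_smul]

theorem firstPart_smul (r : ℝ) (a : PowerSeries (Polynomial R)) :
    firstPart R (r • a) = r • firstPart R a := by
  ext k
  simp only [coeff_firstPart, PowerSeries.coeff_smul, Polynomial.coeff_smul]

theorem zerothPart_X : zerothPart R PowerSeries.X = PowerSeries.X := PowerSeries.map_X _

theorem firstPart_X_pow (n : ℕ) : firstPart R (PowerSeries.X ^ n) = 0 := by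
  ext k
  rw [coeff_firstPart, PowerSeries.coeff_X_pow]
  split_ifs <;> simp [Polynomial.coeff_one]

theorem zerothPart_C_C (z : R) :
    zerothPart R (PowerSeries.C (Polynomial.C z)) = PowerSeries.C z := by
  rw [zerothPart, PowerSeries.map_C]
  simp [evalZero]

theorem firstPart_C_C (z : R) : firstPart R (PowerSeries.C (Polynomial.C z)) = 0 := by
  ext k
  rw [coeff_firstPart, PowerSeries.coeff_C]
  split_ifs <;> simp

theorem zerothPart_C_X_mul (z : R) :
    zerothPart R (PowerSeries.C (Polynomial.X * Polynomial.C z)) = 0 := by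
  rw [zerothPart, PowerSeries.map_C]
  simp [evalZero]

theorem firstPart_C_X_mul (z : R) :
    firstPart R (PowerSeries.C (Polynomial.X * Polynomial.C z)) = PowerSeries.C z := by
  ext k
  rw [coeff_firstPart, PowerSeries.coeff_C, PowerSeries.coeff_C]
  split_ifs <;> simp

theorem zerothPart_taylor (f : ℝ → ℝ) (T : PowerSeries (Polynomial R)) :
    zerothPart R (taylorOnePlus f T) = taylorOnePlus f (zerothPart R T) :=
  map_taylorOnePlus (evalZero R) f T

end Parts

namespace System

/-! ### The Pauli identity for the kinematic momentum. -/

section Velocity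

variable {R : Type*} [Ring R] [Algebra ℝ R] {d : System R} {ħ : ℝ}

/-- Momenta commute among themselves, and so do the components of `A`; only the mixed terms survive,
and they form a component of the curl of `A`. -/
theorem kin_commutator (h : d.Laws ħ) (q : ℝ) (i : Fin 3) :
    d.kin q i * d.kin q (i + 1) - d.kin q (i + 1) * d.kin q i
      = (q * ħ) • (PowerSeries.X * (PowerSeries.C d.j * PowerSeries.C (d.B (i + 2)))) := by
  have hX : ∀ z : R, PowerSeries.C z * PowerSeries.X = PowerSeries.X * PowerSeries.C z := fun z =>
    (PowerSeries.commute_X _).eq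
  have hpA := congrArg (PowerSeries.C (R := R)) (h.p_A i)
  have hpp := congrArg (PowerSeries.C (R := R)) (h.p_p i (i + 1)).eq
  have hAA := congrArg (PowerSeries.C (R := R)) (h.A_A i (i + 1)).eq
  have hs : ∀ (r : ℝ) (z : R), PowerSeries.C (r • z) = r • PowerSeries.C z := fun r z => by
    ext k
    simp [PowerSeries.coeff_C]
  simp only [map_sub, map_mul, map_neg, hs] at hpA hpp hAA
  have h1 : d.kin q i * d.kin q (i + 1) - d.kin q (i + 1) * d.kin q i
      = (PowerSeries.C (d.p i) * PowerSeries.C (d.p (i + 1))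
          - PowerSeries.C (d.p (i + 1)) * PowerSeries.C (d.p i))
        - q • (PowerSeries.X * ((PowerSeries.C (d.p i) * PowerSeries.C (d.A (i + 1))
          - PowerSeries.C (d.A (i + 1)) * PowerSeries.C (d.p i))
          - (PowerSeries.C (d.p (i + 1)) * PowerSeries.C (d.A i)
            - PowerSeries.C (d.A i) * PowerSeries.C (d.p (i + 1)))))
        + (q * q) • (PowerSeries.X ^ 2 * (PowerSeries.C (d.A i) * PowerSeries.C (d.A (i + 1))
          - PowerSeries.C (d.A (i + 1)) * PowerSeries.C (d.A i))) := by
    simp only [kin, hs, sub_mul, mul_sub, smul_mul_assoc, mul_smul_comm, pow_two, mul_assoc]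
    simp only [← mul_assoc, hX, smul_sub]
    simp only [mul_assoc]
    simp only [← mul_assoc, smul_smul]
    abel
  rw [h1, hpA, hpp, hAA, sub_self, sub_self]
  simp only [mul_neg, mul_smul_comm, smul_neg, smul_smul, mul_zero, smul_zero]
  abel

/-- The antisymmetric part of the product of spin matrices meets the commutators of `π`; each
contributes a factor `i`, hence the minus sign before `σ·B`. -/
theorem sP_mul_sP (h : d.Laws ħ) (q : ℝ) :
    d.sP q * d.sP q = d.kin q ⬝ᵥ d.kin q - (q * ħ) • (PowerSeries.X * d.sB) := by
  have hC : ∀ {a b : R}, a = b → PowerSeries.C a = PowerSeries.C b := fun h => congrArg _ h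
  have hj : PowerSeries.C d.j * PowerSeries.C d.j = -1 := by
    rw [← map_mul, h.j_sq, map_neg, map_one]
  have hσk : ∀ i k, Commute (PowerSeries.C (d.σ i)) (d.kin q k) := fun i k =>
    ((h.σ_p i k).map PowerSeries.C).sub_right ((PowerSeries.commute_X _).mul_right
      (((h.σ_A i k).smul_right q).map PowerSeries.C))
  have key := sigma_dot_mul (j := PowerSeries.C d.j) (σ := fun i => PowerSeries.C (d.σ i))
    (a := d.kin q) (b := d.kin q)
    (fun i => by rw [← map_mul, h.σ_sq, map_one]) (fun i => by rw [← map_mul, h.σ_mul, map_mul])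
    (fun i => by rw [← map_mul, h.σ_mul', map_neg, map_mul]) hσk
  have hjz : ∀ z y : PowerSeries R, z * (PowerSeries.C d.j * y) = PowerSeries.C d.j * (z * y) :=
    fun z y => by
      have : Commute z (PowerSeries.C d.j) := by
        refine PowerSeries.ext fun n => ?_
        rw [PowerSeries.coeff_C_mul, PowerSeries.coeff_mul_C, (h.j_comm _).eq]
      rw [← mul_assoc, this.eq, mul_assoc]
  have hXz : ∀ z y : PowerSeries R, z * (PowerSeries.X * y) = PowerSeries.X * (z * y) :=
    fun z y => by rw [← mul_assoc, (PowerSeries.commute_X z).eq, mul_assoc]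
  have hjj : ∀ y : PowerSeries R, PowerSeries.C d.j * (PowerSeries.C d.j * y) = -y := fun y => by
    rw [← mul_assoc, hj, neg_one_mul]
  have k0 := kin_commutator h q 0
  have k1 := kin_commutator h q 1
  have k2 := kin_commutator h q 2
  simp only [Fin.isValue, zero_add, Fin.reduceAdd] at k0 k1 k2
  rw [sP, key, k0, k1, k2, sB]
  simp only [dotProduct, Fin.sum_univ_three, mul_add, mul_smul_comm, smul_add]
  simp only [hXz (PowerSeries.C (d.σ _)), hjz (PowerSeries.C (d.σ _)), hjz (PowerSeries.X), hjj]
  simp only [smul_neg]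
  abel

end Velocity

/-! ### Quantities in units of the rest energy. -/

section Blocks

variable {R : Type*} [Ring R] [Algebra ℝ R] (d : System R)

/-- `σ·π/(mc)` -/
noncomputable def slope (m q : ℝ) : PowerSeries R := (1 / m) • (PowerSeries.X * d.sP q)

/-- `qφ/(mc²)` -/
noncomputable def electric (m q : ℝ) : PowerSeries R :=
  (q / m) • (PowerSeries.X ^ 2 * PowerSeries.C d.φ)

/-- `μ'σ·B/(mc²)` -/
noncomputable def zeeman (m μ : ℝ) : PowerSeries R := (μ / m) • (PowerSeries.X ^ 3 * d.sB)

/-- `iμ'σ·E/(mc²)` -/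
noncomputable def dipole (m μ : ℝ) : PowerSeries R :=
  (μ / m) • (PowerSeries.X ^ 3 * (PowerSeries.C d.j * d.sE))

variable {m : ℝ} (q μ : ℝ)

theorem h11_eq (hm : m ≠ 0) : d.h11 m q μ = m • (1 + d.electric m q - d.zeeman m μ) := by
  simp only [h11, electric, zeeman, smul_add, smul_sub, smul_smul, mul_div_cancel₀ _ hm]

theorem h12_eq (hm : m ≠ 0) : d.h12 q μ = m • (d.slope m q + d.dipole m μ) := by
  simp only [h12, slope, dipole, smul_add, smul_smul, mul_div_cancel₀ _ hm, one_smul]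

theorem h21_eq (hm : m ≠ 0) : d.h21 q μ = m • (d.slope m q - d.dipole m μ) := by
  simp only [h21, slope, dipole, smul_sub, smul_smul, mul_div_cancel₀ _ hm, one_smul]

theorem h22_eq (hm : m ≠ 0) : d.h22 m q μ = m • (-1 + d.electric m q + d.zeeman m μ) := by
  simp only [h22, electric, zeeman, smul_add, smul_smul, mul_div_cancel₀ _ hm, smul_neg]

/-- Cancelling the common factor `m` brings the condition into the form that `firstOrder_weak`
expects of `x`. -/
theorem Decouples.scaled_eq {d : System R} (hm : m ≠ 0) {x : PowerSeries R}
    (h : d.Decouples m q μ x) :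
    x * (1 + d.electric m q - d.zeeman m μ) + x * (d.slope m q + d.dipole m μ) * x
      = d.slope m q - d.dipole m μ + (-1 + d.electric m q + d.zeeman m μ) * x := by
  rw [Decouples, h11_eq d q μ hm, h12_eq d q μ hm, h21_eq d q μ hm, h22_eq d q μ hm] at h
  simp only [mul_smul_comm, smul_mul_assoc, ← smul_add] at h
  exact (smul_right_inj hm).1 h

theorem fw_eq (hm : m ≠ 0) (x xd : PowerSeries R) :
    d.fw m q μ x xd = m • (taylorOnePlus (fun u => √u) (xd * x)
      * (1 + d.electric m q - d.zeeman m μ + (d.slope m q + d.dipole m μ) * x)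
      * taylorOnePlus (fun u => 1 / √u) (xd * x)) := by
  rw [fw, h11_eq d q μ hm, h12_eq d q μ hm]
  simp only [mul_smul_comm, smul_mul_assoc, ← smul_add]

theorem electric_conj : d.conj.electric m q = -d.electric m q := by
  simp [electric, conj]

theorem dipole_conj : d.conj.dipole m μ = -d.dipole m μ := by
  simp [dipole, conj, sE, dotProduct]

/-- The Pauli identity in units of `mc`. The `σ·B` term is the difference between `γ²` and `Γ²`,
from which the magnetic moment of the Dirac particle arises. -/
theorem slope_mul_slope {ħ : ℝ} {d : System R} (h : d.Laws ħ) :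
    d.slope m q * d.slope m q
      = d.velocitySq m q - (q * ħ / m ^ 2) • (PowerSeries.X ^ 3 * d.sB) := by
  have h1 : d.slope m q * d.slope m q
      = (1 / m ^ 2) • (PowerSeries.X ^ 2 * (d.sP q * d.sP q)) := by
    simp only [slope, smul_mul_assoc, mul_smul_comm, smul_smul, mul_assoc]
    rw [← mul_assoc (d.sP q), (PowerSeries.commute_X (d.sP q)).eq,
      pow_two (PowerSeries.X : PowerSeries R), mul_assoc, mul_assoc]
    congr 1
    field_simp
  rw [h1, sP_mul_sP h, velocitySq, mul_sub, smul_sub, mul_smul_comm, smul_smul,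
    ← mul_assoc (PowerSeries.X ^ 2) PowerSeries.X, ← pow_succ]
  congr 2
  field_simp

/-- The weak-field Hamiltonian in units of the rest energy. -/
theorem weak_eq (hm : m ≠ 0) (ħ : ℝ) :
    d.weak m ħ q μ = m • (taylorOnePlus (fun u => √u) (d.velocitySq m q) + d.electric m q
      - PowerSeries.X ^ 2 * ((fun i => PowerSeries.C (d.σ i)) ⬝ᵥ fun i =>
      ((μ / m) • PowerSeries.X + (q * ħ / (2 * m ^ 2)) • PowerSeries.X
          * taylorOnePlus (fun u => 1 / √u) (d.velocitySq m q)) * PowerSeries.C (d.B i)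
        - (μ / m) • PowerSeries.X
          * taylorOnePlus (fun u => 1 / (√u * (1 + √u))) (d.velocitySq m q)
          * (d.velocity m q ⬝ᵥ fun i => PowerSeries.C (d.B i)) * d.velocity m q i
        - ((μ / m) • PowerSeries.X * taylorOnePlus (fun u => 1 / √u) (d.velocitySq m q)
          + (q * ħ / (2 * m ^ 2)) • PowerSeries.X
            * taylorOnePlus (fun u => 1 / (√u * (1 + √u))) (d.velocitySq m q))
          * cross (d.velocity m q) (fun i => PowerSeries.C (d.E i)) i)) := by
  have h1 : ∀ r : ℝ, m * (r / m) = r := fun r => mul_div_cancel₀ _ hm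
  have h2 : m * (q * ħ / (2 * m ^ 2)) = q * ħ / (2 * m) := by field_simp
  simp only [weak, electric, smul_add, smul_sub, ← mul_smul_comm m (PowerSeries.X ^ 2), smul_smul,
    h1, ← dotProduct_smul]
  congr 3
  funext i
  simp only [Pi.smul_apply, smul_sub, ← smul_mul_assoc, smul_add, smul_smul, h1, h2]

end Blocks

theorem commute_C_of_forall {R : Type*} [Ring R] {a : R} (h : ∀ z, Commute a z) (z : PowerSeries R) :
    Commute (PowerSeries.C a) z := by
  refine PowerSeries.ext fun n => ?_
  rw [PowerSeries.coeff_C_mul, PowerSeries.coeff_mul_C, (h _).eq]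

/-! ### Zeroth and first parts of the building blocks. -/

section Parts

variable {R : Type*} [Ring R] [Algebra ℝ R] (d : System R) (m q μ : ℝ)

/-- The vector `p/(mc)`. -/
noncomputable def freeVelocity (i : Fin 3) : PowerSeries R :=
  (1 / m) • (PowerSeries.X * PowerSeries.C (d.p i))

/-- `(p/(mc))²` -/
noncomputable def freeVelocitySq : PowerSeries R :=
  (1 / m ^ 2) • (PowerSeries.X ^ 2
    * ((fun i => PowerSeries.C (d.p i)) ⬝ᵥ fun i => PowerSeries.C (d.p i)))

/-- `σ·p/(mc)` -/
noncomputable def freeSlope : PowerSeries R :=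
  (fun i => PowerSeries.C (d.σ i)) ⬝ᵥ d.freeVelocity m

theorem zerothPart_dotProduct (a b : Fin 3 → PowerSeries (Polynomial R)) :
    zerothPart R (a ⬝ᵥ b) = (fun i => zerothPart R (a i)) ⬝ᵥ fun i => zerothPart R (b i) :=
  map_dotProduct (evalZero R) a b

theorem zerothPart_kin (i : Fin 3) : zerothPart R (d.scaled.kin q i) = PowerSeries.C (d.p i) := by
  have h : zerothPart R (PowerSeries.C (q • (d.scaled.A i))) = 0 := by
    rw [scaled, ← mul_smul_comm, Polynomial.smul_C, zerothPart_C_X_mul]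
  rw [kin, map_sub, map_mul, h, mul_zero, sub_zero]
  exact zerothPart_C_C _

theorem zerothPart_velocity (i : Fin 3) :
    zerothPart R (d.scaled.velocity m q i) = d.freeVelocity m i := by
  rw [velocity, zerothPart_smul, map_mul, zerothPart_kin, zerothPart_X, freeVelocity]

theorem zerothPart_velocitySq :
    zerothPart R (d.scaled.velocitySq m q) = d.freeVelocitySq m := by
  rw [velocitySq, zerothPart_smul, map_mul, map_pow, zerothPart_dotProduct, zerothPart_X,
    freeVelocitySq]
  simp only [zerothPart_kin]

theorem zerothPart_σ (i : Fin 3) :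
    zerothPart R (PowerSeries.C (d.scaled.σ i)) = PowerSeries.C (d.σ i) := zerothPart_C_C _

theorem firstPart_σ (i : Fin 3) : firstPart R (PowerSeries.C (d.scaled.σ i)) = 0 :=
  firstPart_C_C _

theorem zerothPart_j : zerothPart R (PowerSeries.C d.scaled.j) = PowerSeries.C d.j :=
  zerothPart_C_C _

theorem firstPart_j : firstPart R (PowerSeries.C d.scaled.j) = 0 := firstPart_C_C _

theorem zerothPart_E (i : Fin 3) : zerothPart R (PowerSeries.C (d.scaled.E i)) = 0 :=
  zerothPart_C_X_mul _

theorem firstPart_E (i : Fin 3) :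
    firstPart R (PowerSeries.C (d.scaled.E i)) = PowerSeries.C (d.E i) := firstPart_C_X_mul _

theorem zerothPart_B (i : Fin 3) : zerothPart R (PowerSeries.C (d.scaled.B i)) = 0 :=
  zerothPart_C_X_mul _

theorem firstPart_B (i : Fin 3) :
    firstPart R (PowerSeries.C (d.scaled.B i)) = PowerSeries.C (d.B i) := firstPart_C_X_mul _

theorem zerothPart_sE : zerothPart R d.scaled.sE = 0 := by
  rw [sE, zerothPart_dotProduct]
  simp [zerothPart_E, dotProduct]

theorem firstPart_sE : firstPart R d.scaled.sE = d.sE := by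
  simp [sE, dotProduct, firstPart_mul, zerothPart_E, firstPart_E, zerothPart_σ]

theorem zerothPart_sB : zerothPart R d.scaled.sB = 0 := by
  rw [sB, zerothPart_dotProduct]
  simp [zerothPart_B, dotProduct]

theorem firstPart_sB : firstPart R d.scaled.sB = d.sB := by
  simp [sB, dotProduct, firstPart_mul, zerothPart_B, firstPart_B, zerothPart_σ]

theorem zerothPart_slope : zerothPart R (d.scaled.slope m q) = d.freeSlope m := by
  rw [slope, zerothPart_smul, map_mul, sP, zerothPart_dotProduct, zerothPart_X, freeSlope]
  simp only [zerothPart_kin, zerothPart_σ, freeVelocity, dotProduct, Finset.mul_sum,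
    Finset.smul_sum, mul_smul_comm]
  refine Finset.sum_congr rfl fun i _ => ?_
  rw [← mul_assoc, ← (PowerSeries.commute_X _).eq, mul_assoc]

theorem zerothPart_electric : zerothPart R (d.scaled.electric m q) = 0 := by
  rw [electric, zerothPart_smul, map_mul, scaled, zerothPart_C_X_mul, mul_zero, smul_zero]

theorem firstPart_electric :
    firstPart R (d.scaled.electric m q) = d.electric m q := by
  rw [electric, firstPart_smul, firstPart_mul, scaled, firstPart_X_pow, zero_mul,
    firstPart_C_X_mul, add_zero, map_pow, zerothPart_X, electric]

theorem zerothPart_zeeman : zerothPart R (d.scaled.zeeman m μ) = 0 := by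
  rw [zeeman, zerothPart_smul, map_mul, zerothPart_sB, mul_zero, smul_zero]

theorem firstPart_zeeman : firstPart R (d.scaled.zeeman m μ) = d.zeeman m μ := by
  rw [zeeman, firstPart_smul, firstPart_mul, firstPart_X_pow, zero_mul, firstPart_sB, add_zero,
    map_pow, zerothPart_X, zeeman]

theorem zerothPart_dipole : zerothPart R (d.scaled.dipole m μ) = 0 := by
  rw [dipole, zerothPart_smul, map_mul, map_mul, zerothPart_sE, mul_zero, mul_zero, smul_zero]

theorem firstPart_dipole : firstPart R (d.scaled.dipole m μ) = d.dipole m μ := by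
  rw [dipole, firstPart_smul, firstPart_mul, firstPart_X_pow, zero_mul, firstPart_mul,
    firstPart_j, zero_mul, firstPart_sE, add_zero, add_zero, map_pow, zerothPart_X,
    zerothPart_j, dipole]

end Parts

/-! ### Spin algebra at zero field. -/

section Free

variable {R : Type*} [Ring R] [Algebra ℝ R] {d : System R} {ħ : ℝ} (m q μ : ℝ)

theorem commute_freeVelocitySq {z : PowerSeries R} (h : ∀ i, Commute z (PowerSeries.C (d.p i))) :
    Commute z (d.freeVelocitySq m) :=
  ((PowerSeries.commute_X_pow z 2).mul_right
    (Commute.sum_right _ _ _ fun i _ => (h i).mul_right (h i))).smul_right _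

theorem Laws.commute_σ_p (h : d.Laws ħ) (i k : Fin 3) :
    Commute (PowerSeries.C (d.σ i)) (PowerSeries.C (d.p k)) := (h.σ_p i k).map PowerSeries.C

theorem Laws.commute_freeVelocity (h : d.Laws ħ) (i k : Fin 3) :
    Commute (PowerSeries.C (d.σ i)) (d.freeVelocity m k) :=
  ((PowerSeries.commute_X _).mul_right (h.commute_σ_p i k)).smul_right _

/-- The Pauli product formula in both orders: since `F` is central, the scalar part is symmetric and
the cross-product part antisymmetric under exchange. -/
theorem freeSlope_mul_dot (h : d.Laws ħ) {F : Fin 3 → R} (hF : ∀ i z, Commute (F i) z) :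
    let S := (fun i => PowerSeries.C (d.σ i)) ⬝ᵥ fun i => PowerSeries.C (F i)
    let K := (fun i => PowerSeries.C (d.σ i))
      ⬝ᵥ cross (d.freeVelocity m) fun i => PowerSeries.C (F i)
    d.freeSlope m * S - S * d.freeSlope m = (2 : ℝ) • (PowerSeries.C d.j * K) ∧
    d.freeSlope m * S + S * d.freeSlope m
      = (2 : ℝ) • (d.freeVelocity m ⬝ᵥ fun i => PowerSeries.C (F i)) := by
  intro S K
  have hF' : ∀ i z, Commute (PowerSeries.C (F i)) z := fun i => commute_C_of_forall (hF i)
  have key := @sigma_dot_mul (PowerSeries R) _ (PowerSeries.C d.j) fun i => PowerSeries.C (d.σ i)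
  have key' := fun a b => @key a b (fun i => by rw [← map_mul, h.σ_sq, map_one])
    (fun i => by rw [← map_mul, h.σ_mul, map_mul])
    (fun i => by rw [← map_mul, h.σ_mul', map_neg, map_mul])
  have h1 : d.freeSlope m * S = _ := key' _ (fun i => PowerSeries.C (F i))
    (h.commute_freeVelocity m)
  have h2 : S * d.freeSlope m = _ := key' _ (d.freeVelocity m) fun i k => (hF' k _).symm
  have h3 : ∀ i k, PowerSeries.C (F i) * d.freeVelocity m k
    = d.freeVelocity m k * PowerSeries.C (F i) := fun i k => (hF' i _).eq
  simp only [dotProduct, Fin.sum_univ_three, h3] at h1 h2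
  rw [h1, h2, two_smul, two_smul]
  simp only [K, cross, dotProduct, Fin.sum_univ_three, Matrix.cons_val]
  constructor <;> noncomm_ring

/-- By `[φ, pᵢ] = -iħEᵢ` the commutator is a multiple of `iσ·E`. It therefore commutes with
functions of `p²`, although `φ` does not; this is what `firstOrder_weak` requires of `e`. -/
theorem electric_freeSlope (h : d.Laws ħ) :
    d.electric m q * d.freeSlope m - d.freeSlope m * d.electric m q
      = -((q * ħ / m ^ 2) • (PowerSeries.X ^ 3 * (PowerSeries.C d.j * d.sE))) := by
  have hj : ∀ z, Commute (PowerSeries.C d.j) z := commute_C_of_forall h.j_comm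
  have h1 : ∀ i, PowerSeries.C d.φ * (PowerSeries.C (d.σ i) * PowerSeries.C (d.p i))
      - PowerSeries.C (d.σ i) * PowerSeries.C (d.p i) * PowerSeries.C d.φ
      = -(ħ • (PowerSeries.C d.j * (PowerSeries.C (d.σ i) * PowerSeries.C (d.E i)))) := fun i => by
    have hs : ∀ (r : ℝ) (z : R), PowerSeries.C (r • z) = r • PowerSeries.C z := fun r z => by
      ext k
      simp [PowerSeries.coeff_C]
    have h2 := congrArg (PowerSeries.C (R := R)) (h.φ_p i)
    have h3 := ((h.σ_φ i).map PowerSeries.C).eq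
    simp only [map_sub, map_mul, map_neg, hs] at h2 h3
    rw [← mul_assoc, ← h3, mul_assoc, mul_assoc, ← mul_sub, h2, mul_neg, mul_smul_comm,
      ← mul_assoc, ← (hj _).eq, mul_assoc]
  have h4 : d.freeSlope m = (1 / m) • (PowerSeries.X
      * ∑ i, PowerSeries.C (d.σ i) * PowerSeries.C (d.p i)) := by
    simp only [freeSlope, freeVelocity, dotProduct, Finset.mul_sum, Finset.smul_sum, mul_smul_comm]
    refine Finset.sum_congr rfl fun i _ => ?_
    rw [← mul_assoc, (PowerSeries.commute_X _).eq, mul_assoc]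
  have h5 : PowerSeries.C d.φ * (∑ i, PowerSeries.C (d.σ i) * PowerSeries.C (d.p i))
      - (∑ i, PowerSeries.C (d.σ i) * PowerSeries.C (d.p i)) * PowerSeries.C d.φ
      = -(ħ • (PowerSeries.C d.j * d.sE)) := by
    rw [Finset.mul_sum, Finset.sum_mul, ← Finset.sum_sub_distrib, Finset.sum_congr rfl fun i _ =>
      h1 i, Finset.sum_neg_distrib, ← Finset.smul_sum, ← Finset.mul_sum]
    rfl
  rw [h4, electric]
  set P := ∑ i, PowerSeries.C (d.σ i) * PowerSeries.C (d.p i)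
  have h6 : ∀ a b : PowerSeries R, PowerSeries.X ^ 2 * a * (PowerSeries.X * b)
      = PowerSeries.X ^ 3 * (a * b) := fun a b => by
    rw [mul_assoc, ← mul_assoc a, (PowerSeries.commute_X a).eq, mul_assoc, ← mul_assoc, ← pow_succ]
  have h7 : ∀ a b : PowerSeries R, PowerSeries.X * a * (PowerSeries.X ^ 2 * b)
      = PowerSeries.X ^ 3 * (a * b) := fun a b => by
    rw [mul_assoc, ← mul_assoc a, (PowerSeries.commute_X_pow a 2).eq, mul_assoc, ← mul_assoc,
      ← pow_succ']
  -- For `m = 0` both sides are zero, as division by zero gives zero.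
  have h8 : q / m * (1 / m) * ħ = q * ħ / m ^ 2 := by
    by_cases hm : m = 0
    · simp [hm]
    · field_simp
  simp only [smul_mul_assoc, mul_smul_comm, h6, h7, smul_smul, mul_comm (1 / m)]
  rw [← smul_sub, ← mul_sub, h5, mul_neg, smul_neg, mul_smul_comm, smul_smul, h8]

end Free

/-! ### Identification of the first-order Hamiltonian. -/

section WeakField

variable {R : Type*} [Ring R] [Algebra ℝ R] {d : System R} {ħ : ℝ}

/-- The part of the weak-field Hamiltonian that is of first order in the fields. -/
theorem firstPart_weak (h : d.Laws ħ) {m : ℝ} (hm : m ≠ 0) (q μ : ℝ) :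
    let r := taylorOnePlus (fun u => 1 / √u) (d.freeVelocitySq m)
    let w := taylorOnePlus (fun u => 1 / (1 + √u)) (d.freeVelocitySq m)
    let K := (fun i => PowerSeries.C (d.σ i))
      ⬝ᵥ cross (d.freeVelocity m) fun i => PowerSeries.C (d.E i)
    let β := d.freeVelocity m ⬝ᵥ fun i => PowerSeries.C (d.B i)
    firstPart R (d.scaled.weak m ħ q μ)
      = m • (firstPart R (taylorOnePlus (fun u => √u) (d.scaled.velocitySq m q))
        + d.electric m q - d.zeeman m μ
        - (q * ħ / (2 * m ^ 2)) • (PowerSeries.X ^ 3 * (r * d.sB))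
        + (μ / m) • (PowerSeries.X ^ 3 * (r * (w * (β * d.freeSlope m))))
        + (μ / m) • (PowerSeries.X ^ 3 * (r * K))
        + (q * ħ / (2 * m ^ 2)) • (PowerSeries.X ^ 3 * (r * (w * K)))) := by
  intro r w K β
  have hσT : ∀ i, Commute (PowerSeries.C (d.σ i)) (d.freeVelocitySq m) := fun i =>
    commute_freeVelocitySq m (h.commute_σ_p i)
  have hT0 : PowerSeries.constantCoeff (d.freeVelocitySq m) = 0 := by
    simp [freeVelocitySq]
  have hσr : ∀ i, Commute (PowerSeries.C (d.σ i)) r := fun i =>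
    commute_taylorOnePlus _ hT0 (hσT i)
  have hσw : ∀ i, Commute (PowerSeries.C (d.σ i)) w := fun i =>
    commute_taylorOnePlus _ hT0 (hσT i)
  have hilm : taylorOnePlus (fun u => 1 / (√u * (1 + √u))) (d.freeVelocitySq m) = r * w :=
    taylor_inv_sqrt_mul hT0
  have hil : taylorOnePlus (fun u => 1 / √u) (d.freeVelocitySq m) = r := rfl
  have hB : ∀ i z, Commute (PowerSeries.C (d.B i)) z := fun i => commute_C_of_forall (h.B_comm i)
  have hσβ : ∀ i, Commute (PowerSeries.C (d.σ i)) β := fun i =>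
    Commute.sum_right _ _ _ fun k _ => (h.commute_freeVelocity m i k).mul_right (hB k _).symm
  have hX : ∀ z : PowerSeries R, Commute z PowerSeries.X := PowerSeries.commute_X
  have hcross : ∀ i, firstPart R (cross (d.scaled.velocity m q)
      (fun i => PowerSeries.C (d.scaled.E i)) i)
      = cross (d.freeVelocity m) (fun i => PowerSeries.C (d.E i)) i := fun i => by
    fin_cases i <;> simp [cross, firstPart_mul, zerothPart_velocity, zerothPart_E, firstPart_E]
  have hcross0 : ∀ i, zerothPart R (cross (d.scaled.velocity m q)
      (fun i => PowerSeries.C (d.scaled.E i)) i) = 0 := fun i => by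
    fin_cases i <;> simp [cross, zerothPart_E]
  have hβ1 : firstPart R (d.scaled.velocity m q ⬝ᵥ fun i => PowerSeries.C (d.scaled.B i)) = β := by
    simp [dotProduct, firstPart_mul, zerothPart_velocity, zerothPart_B, firstPart_B, β]
  have hβ0 : zerothPart R (d.scaled.velocity m q ⬝ᵥ fun i => PowerSeries.C (d.scaled.B i)) = 0 := by
    rw [zerothPart_dotProduct]
    simp [zerothPart_B, dotProduct]
  rw [weak_eq _ _ _ hm, firstPart_smul]
  congr 1
  have hX2 : zerothPart R (PowerSeries.X ^ 2) = PowerSeries.X ^ 2 := by rw [map_pow, zerothPart_X]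
  rw [map_sub, map_add, firstPart_electric, firstPart_mul, firstPart_X_pow, zero_mul, add_zero, hX2,
    dotProduct, map_sum]
  -- Each summand contains exactly one factor `E` or `B`, of vanishing zeroth part; all other
  -- factors are therefore evaluated at zero field.
  have hterm : ∀ i, firstPart R (PowerSeries.C (d.scaled.σ i) *
      (((μ / m) • PowerSeries.X + (q * ħ / (2 * m ^ 2)) • PowerSeries.X
          * taylorOnePlus (fun u => 1 / √u) (d.scaled.velocitySq m q))
          * PowerSeries.C (d.scaled.B i)
        - (μ / m) • PowerSeries.X
          * taylorOnePlus (fun u => 1 / (√u * (1 + √u))) (d.scaled.velocitySq m q)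
          * (d.scaled.velocity m q ⬝ᵥ fun i => PowerSeries.C (d.scaled.B i))
          * d.scaled.velocity m q i
        - ((μ / m) • PowerSeries.X
            * taylorOnePlus (fun u => 1 / √u) (d.scaled.velocitySq m q)
          + (q * ħ / (2 * m ^ 2)) • PowerSeries.X
            * taylorOnePlus (fun u => 1 / (√u * (1 + √u))) (d.scaled.velocitySq m q))
          * cross (d.scaled.velocity m q) (fun i => PowerSeries.C (d.scaled.E i)) i))
      = (μ / m) • (PowerSeries.X * (PowerSeries.C (d.σ i) * PowerSeries.C (d.B i)))
        + (q * ħ / (2 * m ^ 2)) • (PowerSeries.X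
          * (r * (PowerSeries.C (d.σ i) * PowerSeries.C (d.B i))))
        - (μ / m) • (PowerSeries.X
          * (r * (w * (β * (PowerSeries.C (d.σ i) * d.freeVelocity m i)))))
        - (μ / m) • (PowerSeries.X * (r * (PowerSeries.C (d.σ i)
          * cross (d.freeVelocity m) (fun i => PowerSeries.C (d.E i)) i)))
        - (q * ħ / (2 * m ^ 2)) • (PowerSeries.X * (r * (w * (PowerSeries.C (d.σ i)
          * cross (d.freeVelocity m) (fun i => PowerSeries.C (d.E i)) i)))) := fun i => by
    have hr : ∀ z, PowerSeries.C (d.σ i) * (r * z) = r * (PowerSeries.C (d.σ i) * z) := fun z => by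
      rw [← mul_assoc, (hσr i).eq, mul_assoc]
    have hw : ∀ z, PowerSeries.C (d.σ i) * (w * z) = w * (PowerSeries.C (d.σ i) * z) := fun z => by
      rw [← mul_assoc, (hσw i).eq, mul_assoc]
    have hb : ∀ z, PowerSeries.C (d.σ i) * (β * z) = β * (PowerSeries.C (d.σ i) * z) := fun z => by
      rw [← mul_assoc, (hσβ i).eq, mul_assoc]
    have hx : ∀ z, PowerSeries.C (d.σ i) * (PowerSeries.X * z)
        = PowerSeries.X * (PowerSeries.C (d.σ i) * z) := fun z => by
      rw [← mul_assoc, (hX _).eq, mul_assoc]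
    rw [firstPart_mul, firstPart_σ, zero_mul, add_zero, map_sub, map_sub, firstPart_mul,
      firstPart_mul _ (d.scaled.velocity m q i), firstPart_mul _ (_ ⬝ᵥ _), firstPart_mul _ (cross _ _ i),
      hcross, hcross0, map_mul (zerothPart R) _ (_ ⬝ᵥ _), hβ0, hβ1, zerothPart_B, firstPart_B,
      zerothPart_velocity]
    simp only [map_mul, map_add, zerothPart_smul, zerothPart_X, zerothPart_taylor,
      zerothPart_velocitySq, hilm, hil, mul_zero, zero_mul, add_zero, zero_add, zerothPart_σ]
    simp only [mul_add, mul_sub, add_mul, smul_mul_assoc, mul_smul_comm, mul_assoc, hr, hw, hb, hx]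
    abel
  rw [Finset.sum_congr rfl fun i _ => hterm i]
  simp only [Finset.sum_add_distrib, Finset.sum_sub_distrib, ← Finset.smul_sum, ← Finset.mul_sum]
  change _ - PowerSeries.X ^ 2 * ((μ / m) • (PowerSeries.X * d.sB)
    + (q * ħ / (2 * m ^ 2)) • (PowerSeries.X * (r * d.sB))
    - (μ / m) • (PowerSeries.X * (r * (w * (β * d.freeSlope m))))
    - (μ / m) • (PowerSeries.X * (r * K))
    - (q * ħ / (2 * m ^ 2)) • (PowerSeries.X * (r * (w * K)))) = _
  have h3 : ∀ z : PowerSeries R, PowerSeries.X ^ 2 * (PowerSeries.X * z) = PowerSeries.X ^ 3 * z :=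
    fun z => by rw [← mul_assoc, ← pow_succ]
  simp only [mul_add, mul_sub, mul_smul_comm, h3, zeeman]
  abel

theorem zerothPart_weak {m : ℝ} (hm : m ≠ 0) (q μ : ℝ) :
    zerothPart R (d.scaled.weak m ħ q μ)
      = m • taylorOnePlus (fun u => √u) (d.freeVelocitySq m) := by
  rw [weak_eq _ _ _ hm, zerothPart_smul, map_sub, map_add, zerothPart_electric, map_mul,
    zerothPart_dotProduct, zerothPart_taylor, zerothPart_velocitySq]
  have h0 : ∀ i, zerothPart R (cross (d.scaled.velocity m q)
      (fun i => PowerSeries.C (d.scaled.E i)) i) = 0 := fun i => by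
    fin_cases i <;> simp [cross, zerothPart_E]
  simp only [map_sub, map_mul, zerothPart_B, h0, zerothPart_dotProduct]
  simp [dotProduct]

/-- To first order in the fields, the Foldy-Wouthuysen Hamiltonian is the weak-field Hamiltonian. -/
theorem fw_parts (h : d.Laws ħ) {m : ℝ} (hm : m ≠ 0) (q μ : ℝ) :
    zerothPart R (d.scaled.fw m q μ (d.scaled.solution m q μ) (d.scaled.conj.solution m q μ))
      = zerothPart R (d.scaled.weak m ħ q μ) ∧
    firstPart R (d.scaled.fw m q μ (d.scaled.solution m q μ) (d.scaled.conj.solution m q μ))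
      = firstPart R (d.scaled.weak m ħ q μ) := by
  set D := d.scaled with hD
  have hL : D.Laws ħ := h.scaled
  set U := D.slope m q with hU
  set V := D.velocitySq m q with hV
  set x := D.solution m q μ
  set xd := D.conj.solution m q μ
  have hU0 : PowerSeries.constantCoeff (U * U) = 0 := by simp [hU, slope]
  have hV0 : PowerSeries.constantCoeff V = 0 := by simp [hV, velocitySq]
  have hx0 : PowerSeries.constantCoeff (xd * x) = 0 := by
    rw [map_mul, constantCoeff_solution, zero_mul]
  set v := d.freeVelocitySq m with hv
  have hv0 : PowerSeries.constantCoeff v = 0 := by simp [hv, freeVelocitySq]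
  have hUU : zerothPart R (U * U) = v := by
    rw [hU, slope_mul_slope _ hL, map_sub, zerothPart_velocitySq, zerothPart_smul, map_mul,
      zerothPart_sB, mul_zero, smul_zero, sub_zero]
  have hc : ∀ f : ℝ → ℝ, f 1 = 1 → ∀ T : PowerSeries (Polynomial R),
      PowerSeries.constantCoeff (zerothPart R (taylorOnePlus f T)) = 1 := fun f hf T => by
    rw [zerothPart_taylor, constantCoeff_taylorOnePlus, hf, one_smul]
  have hσv : ∀ i, Commute (PowerSeries.C (d.σ i)) v := fun i =>
    commute_freeVelocitySq m (h.commute_σ_p i)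
  have hcomm : ∀ {z}, Commute z v → Commute z (taylorOnePlus (fun u => √u) v) := fun {z} hz =>
    commute_taylorOnePlus _ hv0 hz
  have hB : ∀ i z, Commute (PowerSeries.C (d.B i)) z := fun i => commute_C_of_forall (h.B_comm i)
  have hE : ∀ i z, Commute (PowerSeries.C (d.E i)) z := fun i => commute_C_of_forall (h.E_comm i)
  have hj : ∀ z, Commute (PowerSeries.C d.j) z := commute_C_of_forall h.j_comm
  have hsB : Commute d.sB v :=
    Commute.sum_left Finset.univ _ _ fun i _ => (hσv i).mul_left (hB i v)
  have hsE : Commute d.sE v :=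
    Commute.sum_left Finset.univ _ _ fun i _ => (hσv i).mul_left (hE i v)
  have hX3 : Commute (PowerSeries.X ^ 3) v := (PowerSeries.commute_X_pow v 3).symm
  have hjsE : Commute (PowerSeries.X ^ 3 * (PowerSeries.C d.j * d.sE)) v :=
    hX3.mul_left ((hj v).mul_left hsE)
  have hg0 : zerothPart R (taylorOnePlus (fun u => √u) (U * U))
      = taylorOnePlus (fun u => √u) v := by rw [zerothPart_taylor, hUU]
  have he : firstPart R (D.electric m q) * zerothPart R U
      - zerothPart R U * firstPart R (D.electric m q)
      = -((q * ħ / m ^ 2) • (PowerSeries.X ^ 3 * (PowerSeries.C d.j * d.sE))) := by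
    rw [firstPart_electric, zerothPart_slope, electric_freeSlope m q h]
  obtain ⟨k0, k1⟩ := firstOrder_weak (c₀ := zerothPart R) (c₁ := firstPart R) firstPart_mul
    (U := U) (γ := taylorOnePlus (fun u => √u) V) (Γ := taylorOnePlus (fun u => √u) (U * U))
    (W := taylorOnePlus (fun u => 1 / (1 + √u)) (U * U)) (x := x) (xd := xd)
    (N := taylorOnePlus (fun u => √u) (xd * x)) (Y := taylorOnePlus (fun u => 1 / √u) (xd * x))
    (φ := D.electric m q) (T := D.zeeman m μ) (s := D.dipole m μ)
    (r := taylorOnePlus (fun u => 1 / √u) v)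
    (τ := (q * ħ / m ^ 2) • (PowerSeries.X ^ 3 * d.sB))
    (zerothPart_electric d m q) (zerothPart_zeeman d m μ) (zerothPart_dipole d m μ)
    (taylor_sqrt_mul_self hU0) (taylor_one_add_mul_inv hU0)
    (by
      rw [← ((Commute.one_left _).add_left (commute_taylorOnePlus _ hU0
        (commute_taylorOnePlus _ hU0 (Commute.refl _)).symm)).eq, taylor_one_add_mul_inv hU0])
    (commute_taylorOnePlus _ hU0 ((Commute.refl U).mul_right (Commute.refl U)))
    (by rw [zerothPart_slope]; simp [freeSlope, freeVelocity, dotProduct])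
    (hc _ (by simp) _) (hc _ (by simp) _)
    ((D.decouples_solution m q μ hm).scaled_eq q μ hm)
    (by
      -- The equation of the reversed system is that of `x` with the signs of `φ` and `s` changed.
      have := (D.conj.decouples_solution m q μ hm).scaled_eq q μ hm
      rw [electric_conj, dipole_conj] at this
      exact this)
    (taylor_sqrt_mul_self hx0) (taylor_sqrt_mul_inv hx0) (taylor_inv_mul_sqrt hx0)
    (by rw [hg0, zerothPart_taylor, zerothPart_velocitySq])
    (by
      have h1 : firstPart R (1 : PowerSeries (Polynomial R)) = 0 := by
        simpa using firstPart_X_pow (R := R) 0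
      rw [taylor_sqrt_mul_self hV0, hU, slope_mul_slope _ hL, map_add, map_sub, firstPart_smul,
        firstPart_mul, firstPart_X_pow, zero_mul, firstPart_sB, map_pow, zerothPart_X, add_zero, h1]
      abel)
    (by rw [hg0, taylor_sqrt_mul_inv hv0]) (by rw [hg0, taylor_inv_mul_sqrt hv0])
    (by
      rw [hg0, he]
      exact (hcomm (hjsE.smul_left _)).neg_left)
    (by
      rw [hg0, firstPart_zeeman]
      exact hcomm ((hX3.mul_left hsB).smul_left _))
    (by
      rw [hg0, firstPart_dipole]
      exact hcomm (hjsE.smul_left _))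
    (by
      rw [hg0]
      exact hcomm ((hX3.mul_left hsB).smul_left _))
  rw [fw_eq D q μ hm, zerothPart_smul, firstPart_smul, k0, k1, zerothPart_weak hm,
    firstPart_weak h hm, zerothPart_taylor, zerothPart_velocitySq]
  refine ⟨rfl, ?_⟩
  congr 1
  rw [he, firstPart_electric, firstPart_zeeman, firstPart_dipole, zerothPart_slope,
    zerothPart_taylor, hUU]
  set r := taylorOnePlus (fun u => 1 / √u) v
  set w := taylorOnePlus (fun u => 1 / (1 + √u)) v
  -- The three spin combinations left by `firstOrder_weak` are now evaluated: commutators with `σ·E`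
  -- give `σ·(v × E)`, and the anticommutator with `σ·B` gives `v·B`, where `v = p/(mc)`.
  obtain ⟨hSE, -⟩ := freeSlope_mul_dot m h h.E_comm
  obtain ⟨-, hSB⟩ := freeSlope_mul_dot m h h.B_comm
  set u := d.freeSlope m
  set K := (fun i => PowerSeries.C (d.σ i)) ⬝ᵥ cross (d.freeVelocity m) fun i => PowerSeries.C (d.E i)
  set β := d.freeVelocity m ⬝ᵥ fun i => PowerSeries.C (d.B i)
  change u * d.sE - d.sE * u = _ at hSE
  change u * d.sB + d.sB * u = _ at hSB
  have hXz : ∀ z y : PowerSeries R, z * (PowerSeries.X ^ 3 * y) = PowerSeries.X ^ 3 * (z * y) :=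
    fun z y => mul_X_pow_mul 3 z y
  have hjz : ∀ z y : PowerSeries R, z * (PowerSeries.C d.j * y) = PowerSeries.C d.j * (z * y) :=
    fun z y => by rw [← mul_assoc, ← (hj z).eq, mul_assoc]
  have hjj : ∀ y : PowerSeries R, PowerSeries.C d.j * (PowerSeries.C d.j * y) = -y := fun y => by
    rw [← mul_assoc, ← map_mul, h.j_sq, map_neg, map_one, neg_one_mul]
  have e1 : u * -((q * ħ / m ^ 2) • (PowerSeries.X ^ 3 * (PowerSeries.C d.j * d.sE)))
      - -((q * ħ / m ^ 2) • (PowerSeries.X ^ 3 * (PowerSeries.C d.j * d.sE))) * u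
      = (2 * (q * ħ / m ^ 2)) • (PowerSeries.X ^ 3 * K) := by
    calc _ = -((q * ħ / m ^ 2) • (PowerSeries.X ^ 3 * (PowerSeries.C d.j
          * (u * d.sE - d.sE * u)))) := by
          simp only [mul_neg, mul_smul_comm, hXz u, hjz u, neg_mul, smul_mul_assoc, mul_assoc,
            mul_sub, smul_sub]
          abel
      _ = _ := by
          rw [hSE, mul_smul_comm, hjj]
          simp only [mul_smul_comm, smul_smul, smul_neg, mul_neg, neg_neg]
          rw [mul_comm]
  have e2 : d.dipole m μ * u - u * d.dipole m μ = (2 * (μ / m)) • (PowerSeries.X ^ 3 * K) := by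
    calc _ = -((μ / m) • (PowerSeries.X ^ 3 * (PowerSeries.C d.j * (u * d.sE - d.sE * u)))) := by
          simp only [dipole, mul_smul_comm, hXz u, hjz u, smul_mul_assoc, mul_assoc, mul_sub,
            smul_sub]
          abel
      _ = _ := by
          rw [hSE, mul_smul_comm, hjj]
          simp only [mul_smul_comm, smul_smul, smul_neg, mul_neg, neg_neg]
          rw [mul_comm]
  have e3 : u * d.zeeman m μ + d.zeeman m μ * u = (2 * (μ / m)) • (PowerSeries.X ^ 3 * β) := by
    calc _ = (μ / m) • (PowerSeries.X ^ 3 * (u * d.sB + d.sB * u)) := by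
          simp only [zeeman, mul_smul_comm, hXz u, smul_mul_assoc, mul_assoc, mul_add, smul_add]
      _ = _ := by
          rw [hSB]
          simp only [mul_smul_comm, smul_smul]
          rw [mul_comm]
  rw [e1, e2, e3]
  simp only [half, smul_mul_assoc, one_mul, mul_smul_comm, hXz r, hXz w, smul_smul, mul_assoc]
  match_scalars <;> ring

end WeakField

end System

/-! ### From formal to real field strength. -/

/-- Evaluation of the formal parameter at a real number `t`. -/
noncomputable def polyEval (R : Type*) [Ring R] [Algebra ℝ R] (t : ℝ) : Polynomial R →ₐ[ℝ] R :=
  { Polynomial.eval₂RingHom' (RingHom.id R) (algebraMap ℝ R t) fun a =>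
      (Algebra.commutes t a).symm with
    commutes' := fun _ => Polynomial.eval₂_C _ _ }

section PolyEval

variable {R : Type*} [Ring R] [Algebra ℝ R] (t : ℝ)

theorem polyEval_C (a : R) : polyEval R t (Polynomial.C a) = a :=
  Polynomial.eval₂_C _ _

theorem polyEval_X_mul_C (a : R) :
    polyEval R t (Polynomial.X * Polynomial.C a) = t • a := by
  rw [map_mul, polyEval_C, Algebra.smul_def]
  exact congrArg (· * a) (Polynomial.eval₂_X _ _)

theorem polyEval_eq_sum (p : Polynomial R) :
    polyEval R t p = ∑ i ∈ Finset.range (p.natDegree + 1), t ^ i • p.coeff i := by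
  change Polynomial.eval₂ _ _ p = _
  rw [Polynomial.eval₂_eq_sum_range]
  refine Finset.sum_congr rfl fun i _ => ?_
  rw [← map_pow, Algebra.smul_def, Algebra.commutes]
  rfl

end PolyEval

/-- The link between the two notions of scaling: by naturality, every series built over polynomials
specializes to the one of the field `F.scale t`. -/
theorem scaled_map_polyEval (ħ : ℝ) (F : HomogeneousField) (t : ℝ) :
    (opSystem ħ F).scaled.map (polyEval Op t) = opSystem ħ (F.scale t) := by
  simp only [System.map, System.scaled, polyEval_C, polyEval_X_mul_C]
  simp only [opSystem, HomogeneousField.scale, System.mk.injEq]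
  refine ⟨trivial, ?_, trivial, ?_, trivial, ?_, ?_⟩
  · exact op_ext fun f x => by
      simp only [smul_op_apply, potential, mulOp_apply, smul_smul]
  · funext i
    exact op_ext fun f x => by
      simp only [smul_op_apply, mulOp_apply, smul_smul]
  · funext i
    rw [Pi.smul_apply, smul_eq_mul, map_mul, Algebra.smul_def]
  · funext i
    rw [Pi.smul_apply, smul_eq_mul, map_mul, Algebra.smul_def]

/-- Pointwise one has a finite sum of vectors times `t ^ i` with `i ≥ n`, and `|t| ^ i ≤ |t| ^ n`
for `|t| < 1`. -/
theorem isBigO_polyEval (p : Polynomial Op) (n : ℕ) (h : ∀ i < n, p.coeff i = 0) (f : Spinor)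
    (x : Space) : (fun t : ℝ => polyEval Op t p f x) =O[𝓝 0] fun t : ℝ => t ^ n := by
  have h1 : ∀ t : ℝ, polyEval Op t p f x
      = ∑ i ∈ Finset.range (p.natDegree + 1), t ^ i • p.coeff i f x := fun t => by
    have h2 : ∀ s : Finset ℕ, (∑ i ∈ s, t ^ i • p.coeff i) f x
        = ∑ i ∈ s, t ^ i • p.coeff i f x := fun s => by
      induction s using Finset.cons_induction with
      | empty => rfl
      | cons a s ha ih => rw [Finset.sum_cons, Finset.sum_cons, add_op_apply, ih, smul_op_apply]
    rw [polyEval_eq_sum, h2]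
  simp only [h1]
  refine Asymptotics.IsBigO.fun_sum fun i _ => ?_
  rcases lt_or_ge i n with hi | hi
  · have h3 : ∀ t : ℝ, t ^ i • p.coeff i f x = 0 := fun t => by
      rw [h i hi]
      exact smul_zero _
    simp only [h3]
    exact Asymptotics.isBigO_zero _ _
  · refine Asymptotics.IsBigO.of_bound ‖p.coeff i f x‖ ?_
    filter_upwards [Metric.ball_mem_nhds (0 : ℝ) one_pos] with t ht
    rw [mem_ball_zero_iff, Real.norm_eq_abs] at ht
    rw [norm_smul, mul_comm, norm_pow, norm_pow, Real.norm_eq_abs]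
    exact mul_le_mul_of_nonneg_left (pow_le_pow_of_le_one (abs_nonneg t) ht.le hi) (norm_nonneg _)

theorem eqModOrder_of_coeff {n : ℕ} {a b : PowerSeries (Polynomial Op)}
    (h : ∀ k, ∀ i < n, (PowerSeries.coeff k a).coeff i = (PowerSeries.coeff k b).coeff i) :
    EqModOrder n (fun t => toLaurent (PowerSeries.map (polyEval Op t : Polynomial Op →+* Op) a))
      fun t => toLaurent (PowerSeries.map (polyEval Op t : Polynomial Op →+* Op) b) := by
  intro k f x
  rcases lt_or_ge k 0 with hk | hk
  · simp only [coeff_toLaurent_of_neg _ hk, sub_self]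
    exact Asymptotics.isBigO_zero _ _
  · lift k to ℕ using hk
    simp only [coeff_toLaurent_natCast, PowerSeries.coeff_map]
    have key := isBigO_polyEval (PowerSeries.coeff k a - PowerSeries.coeff k b) n
      (fun i hi => by rw [Polynomial.coeff_sub, h k i hi, sub_self]) f x
    simp only [map_sub] at key
    exact key

theorem EqModOrder.light_sq_mul {n : ℕ} {S T : ℝ → LaurentSeries Op} (h : EqModOrder n S T) :
    EqModOrder n (fun t => light Op ^ 2 * S t) fun t => light Op ^ 2 * T t := by
  intro k f x
  simp only [coeff_light_sq_mul]
  exact h (k + 2) f x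

/-! ### The order estimates in the fields. -/

variable {m ħ q μ : ℝ} {F : HomogeneousField}

theorem solution_scale (hm : m ≠ 0) (t : ℝ) :
    PowerSeries.map (polyEval Op t : Polynomial Op →+* Op)
      ((opSystem ħ F).scaled.solution m q μ) = (opSystem ħ (F.scale t)).solution m q μ := by
  rw [System.map_solution _ _ _ _ _ hm, scaled_map_polyEval]

theorem conj_solution_scale (hm : m ≠ 0) (t : ℝ) :
    PowerSeries.map (polyEval Op t : Polynomial Op →+* Op)
      ((opSystem ħ F).scaled.conj.solution m q μ)
      = (opSystem ħ (F.scale t)).conj.solution m q μ := by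
  rw [System.map_solution _ _ _ _ _ hm, System.map_conj, scaled_map_polyEval]

/-- Without fields, the solution does not depend on the magnetic moment. -/
theorem zerothPart_solution {R : Type*} [Ring R] [Algebra ℝ R] (d : System R) (hm : m ≠ 0) :
    zerothPart R (d.scaled.solution m q μ) = zerothPart R (d.scaled.solution m q 0) := by
  have h1 : ∀ ν, zerothPart R (d.scaled.solution m q ν)
      = (d.scaled.map (evalZero R)).solution m q ν := fun ν =>
    System.map_solution _ _ _ _ _ hm
  have hE : (d.scaled.map (evalZero R)).sE = 0 := by
    rw [← System.map_sE]
    exact d.zerothPart_sE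
  have hB : (d.scaled.map (evalZero R)).sB = 0 := by
    rw [← System.map_sB]
    exact d.zerothPart_sB
  rw [h1, h1]
  refine System.Decouples.eq_solution hm ?_
  have h2 := (d.scaled.map (evalZero R)).decouples_solution m q μ hm
  simpa only [System.Decouples, System.h11, System.h12, System.h21, System.h22, hE, hB, mul_zero,
    smul_zero] using h2

theorem eqModOrder_solution (hm : m ≠ 0) {X X' : ℝ → PowerSeries Op}
    (hX : ∀ t, KutzelniggCondition m ħ q 0 (F.scale t) (X t))
    (hX' : ∀ t, KutzelniggCondition m ħ q μ (F.scale t) (X t + X' t)) :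
    EqModOrder 1 (fun t => toLaurent (X' t)) fun _ => 0 := by
  have h1 : ∀ t, X' t = PowerSeries.map (polyEval Op t : Polynomial Op →+* Op)
      ((opSystem ħ F).scaled.solution m q μ - (opSystem ħ F).scaled.solution m q 0) := fun t => by
    rw [map_sub, solution_scale hm, solution_scale hm, ← eq_solution_of_condition hm (hX t),
      ← eq_solution_of_condition hm (hX' t), add_sub_cancel_left]
  have key := eqModOrder_of_coeff (n := 1)
    (a := (opSystem ħ F).scaled.solution m q μ - (opSystem ħ F).scaled.solution m q 0) (b := 0)
    fun k i hi => by
      rw [Nat.lt_one_iff.1 hi, ← coeff_zerothPart, map_sub, zerothPart_solution _ hm, sub_self,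
        map_zero, map_zero, Polynomial.coeff_zero]
  simp only [map_zero] at key
  simpa only [h1, map_sub] using key

theorem eqModOrder_fwHamiltonian (hm : m ≠ 0) {x xd : ℝ → PowerSeries Op}
    (hx : ∀ t, KutzelniggCondition m ħ q μ (F.scale t) (x t))
    (hxd : ∀ t, IsSeriesAdjoint (toLaurent (x t)) (toLaurent (xd t))) :
    EqModOrder 2 (fun t => fwHamiltonian m ħ q μ (F.scale t) (x t) (xd t))
      fun t => weakFieldDiracPauli m ħ q μ (F.scale t) := by
  have h1 : ∀ t, fwHamiltonian m ħ q μ (F.scale t) (x t) (xd t) = light Op ^ 2 * toLaurent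
      (PowerSeries.map (polyEval Op t : Polynomial Op →+* Op) ((opSystem ħ F).scaled.fw m q μ
        ((opSystem ħ F).scaled.solution m q μ) ((opSystem ħ F).scaled.conj.solution m q μ))) :=
    fun t => by
      rw [fwHamiltonian_eq_fw hm (hx t) (hxd t), System.map_fw, solution_scale hm,
        conj_solution_scale hm, scaled_map_polyEval, ← eq_solution_of_condition hm (hx t),
        ← eq_conj_solution_of_adjoint hm (hx t) (hxd t)]
  have h2 : ∀ t, weakFieldDiracPauli m ħ q μ (F.scale t) = light Op ^ 2 * toLaurent
      (PowerSeries.map (polyEval Op t : Polynomial Op →+* Op)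
        ((opSystem ħ F).scaled.weak m ħ q μ)) := fun t => by
    rw [weakFieldDiracPauli_eq, System.map_weak, scaled_map_polyEval]
  simp only [h1, h2]
  obtain ⟨k0, k1⟩ := System.fw_parts (opSystem_laws ħ F) hm q μ
  refine (eqModOrder_of_coeff fun k i hi => ?_).light_sq_mul
  interval_cases i
  · rw [← coeff_zerothPart, ← coeff_zerothPart, k0]
  · rw [← coeff_firstPart, ← coeff_firstPart, k1]

/-! ### Classical form of the Hamiltonian, and the Dirac case. -/

theorem const_smul {R : Type*} [Ring R] {S : Type*} [CommSemiring S] [Algebra S R] (r : S) (a : R) :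
    const (r • a) = r • const a := by
  change toLaurent (PowerSeries.C (r • a)) = r • toLaurent (PowerSeries.C a)
  rw [← toLaurent_smul]
  congr 1
  ext k
  simp [PowerSeries.coeff_C]

theorem smul_mul_bracket {𝒜 : Type*} [Ring 𝒜] [Module ℝ 𝒜] [IsScalarTower ℝ 𝒜 𝒜]
    [SMulCommClass ℝ 𝒜 𝒜] (r : ℝ) (s a b il ilm B β u K : 𝒜) :
    s * ((r • a + r • b * il) * B - r • a * ilm * β * u - (r • a * il + r • b * ilm) * K)
      = r • s * ((a + b * il) * B - a * ilm * β * u - (a * il + b * ilm) * K) := by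
  simp only [smul_mul_assoc, ← smul_add, ← smul_sub, mul_smul_comm]

theorem laurent_smul_mul_bracket {R : Type*} [Ring R] [Algebra ℝ R] (r : ℝ)
    (s a b il ilm B β u K : LaurentSeries R) :
    s * ((r • a + r • b * il) * B - r • a * ilm * β * u - (r • a * il + r • b * ilm) * K)
      = r • s * ((a + b * il) * B - a * ilm * β * u - (a * il + b * ilm) * K) :=
  smul_mul_bracket r s a b il ilm B β u K

/-- Both couplings `μ' = ħγ'/2` and `qħ/(2mc)` contain the factor `ħ/2`, which moves into the spin.
No operators are reordered. -/
theorem weakFieldDiracPauli_eq_formalHamiltonian (m ħ q g : ℝ) (F : HomogeneousField) :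
    weakFieldDiracPauli m ħ q (ħ / 2 * g) F
      = formalHamiltonian m q g (potential F) F.E F.B (kinematic ħ q F)
          fun i => (ħ / 2) • sigma i := by
  have h1 : muPrime (ħ / 2 * g) = (ħ / 2) • (g • invLight Op) := by rw [muPrime, smul_smul]
  have h2 : (q * ħ / (2 * m)) • invLight Op = (ħ / 2) • ((q / m) • invLight Op) := by
    rw [smul_smul]
    congr 1
    ring
  have h3 : ∀ i, const ((ħ / 2) • sigma i) = (ħ / 2) • sigmaL i := fun i => const_smul _ _
  rw [weakFieldDiracPauli, formalHamiltonian]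
  simp only [h1, h2, h3]
  exact congrArg _ (Finset.sum_congr rfl fun i _ =>
    laurent_smul_mul_bracket (ħ / 2) _ _ _ _ _ _ _ _ _)

theorem sigmaL_commute_gammaFun (m ħ q : ℝ) (F : HomogeneousField) (f : ℝ → ℝ) (i : Fin 3) :
    Commute (sigmaL i) (gammaFun m (kinematic ħ q F) f) := by
  have h : Commute (PowerSeries.C (sigma i))
      ((1 / m ^ 2) • (PowerSeries.X ^ 2 * (kinematic ħ q F ⬝ᵥ kinematic ħ q F))) :=
    ((PowerSeries.commute_X_pow _ 2).mul_right (Commute.sum_right _ _ _ fun k _ =>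
      (sigma_commute_kinematic ħ q F i k).mul_right
        (sigma_commute_kinematic ħ q F i k))).smul_right _
  exact (commute_taylorOnePlus f (by simp) h).map toLaurent

/-- Rests on `1/γ - 1/(1 + γ) = 1/(γ(1 + γ))`, and on the fact that `σ` commutes with functions of
`π²`, which allows these functions to be moved to the left of the spin. -/
theorem weakFieldDiracPauli_zero (m ħ q : ℝ) (F : HomogeneousField) :
    weakFieldDiracPauli m ħ q 0 F = weakFieldDirac m ħ q F := by
  have h1 : muPrime 0 = 0 := zero_smul ℝ (invLight Op)
  have h2 : invLorentz m (kinematic ħ q F) - invOneAddLorentz m (kinematic ħ q F)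
      = invLorentzMul m (kinematic ħ q F) := by
    rw [sub_eq_iff_eq_add, invLorentz, invOneAddLorentz, invLorentzMul, gammaFun, gammaFun,
      gammaFun, ← map_add, taylor_inv_sqrt_mul_add]
  have h3 : ∀ f : ℝ → ℝ, ∀ i y, sigmaL i * (invLight Op * gammaFun m (kinematic ħ q F) f * y)
      = invLight Op * gammaFun m (kinematic ħ q F) f * (sigmaL i * y) := fun f i y => by
    rw [mul_assoc, ← mul_assoc (sigmaL i), invLight_comm, mul_assoc, ← mul_assoc (sigmaL i),
      (sigmaL_commute_gammaFun m ħ q F f i).eq]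
    simp only [mul_assoc]
  rw [weakFieldDiracPauli, weakFieldDirac, h1, h2]
  simp only [zero_mul, zero_add, laurent_smul_mul, dotProduct, mul_sub, laurent_mul_smul,
    invLorentz, invLorentzMul, h3, sigmaB, Finset.sum_sub_distrib, Finset.mul_sum,
    Finset.sum_const_zero, mul_zero]
  abel

/-! ### Convergence of the Taylor series at `1`. -/

theorem iteratedDeriv_re {F : ℂ → ℂ} {f : ℝ → ℝ} (hF : DifferentiableOn ℂ F (Metric.ball 1 1))
    (hf : ∀ x ∈ Set.Ioo (0 : ℝ) 2, f x = (F x).re) (n : ℕ) :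
    ∀ x ∈ Set.Ioo (0 : ℝ) 2, iteratedDeriv n f x = (iteratedDeriv n F x).re := by
  induction n with
  | zero => simpa using hf
  | succ n ih =>
    intro x hx
    have hball : (x : ℂ) ∈ Metric.ball (1 : ℂ) 1 := by
      rw [Metric.mem_ball, ← Complex.ofReal_one, Complex.dist_eq, ← Complex.ofReal_sub,
        Complex.norm_real, Real.norm_eq_abs, abs_lt]
      constructor <;> linarith [hx.1, hx.2]
    have hA : AnalyticAt ℂ F x := hF.analyticAt (Metric.isOpen_ball.mem_nhds hball)
    have hd : HasDerivAt (iteratedDeriv n F) (iteratedDeriv (n + 1) F x) x := by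
      rw [iteratedDeriv_succ]
      have : AnalyticAt ℂ (iteratedDeriv n F) x := by
        rw [iteratedDeriv_eq_iterate]
        exact hA.iterated_deriv n
      exact this.differentiableAt.hasDerivAt
    rw [iteratedDeriv_succ]
    refine Filter.EventuallyEq.deriv_eq ?_ |>.trans hd.real_of_complex.deriv
    filter_upwards [Ioo_mem_nhds hx.1 hx.2] with y hy using ih y hy

/-- A holomorphic extension to the disc of radius `1` about `1` guarantees the radius of
convergence; along the real axis, real parts of complex derivatives are real derivatives. -/
theorem hasSum_taylor {F : ℂ → ℂ} {f : ℝ → ℝ} (hF : DifferentiableOn ℂ F (Metric.ball 1 1))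
    (hf : ∀ x ∈ Set.Ioo (0 : ℝ) 2, f x = (F x).re) {y : ℝ} (hy : |y| < 1) :
    HasSum (fun n : ℕ => iteratedDeriv n f 1 / (n.factorial : ℝ) * y ^ n) (f (1 + y)) := by
  have hmem : 1 + y ∈ Set.Ioo (0 : ℝ) 2 := by
    rw [abs_lt] at hy
    constructor <;> linarith
  have hball : ((1 + y : ℝ) : ℂ) ∈ Metric.ball (1 : ℂ) 1 := by
    rw [Metric.mem_ball, ← Complex.ofReal_one, Complex.dist_eq, ← Complex.ofReal_sub,
      Complex.norm_real, Real.norm_eq_abs]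
    simpa using hy
  have h := Complex.hasSum_re (Complex.hasSum_taylorSeries_on_ball hF hball)
  rw [hf _ hmem]
  convert h using 2 with n
  rw [iteratedDeriv_re hF hf n 1 (by norm_num)]
  have h1 : (((1 + y : ℝ) : ℂ) - 1) = (y : ℂ) := by push_cast; ring
  rw [h1, ← Complex.ofReal_pow, smul_eq_mul, smul_eq_mul, ← Complex.ofReal_natCast,
    ← Complex.ofReal_inv, Complex.re_ofReal_mul, Complex.re_ofReal_mul, Complex.ofReal_one]
  ring

/-- A holomorphic square root. -/
noncomputable def complexSqrt (z : ℂ) : ℂ := z ^ ((2 : ℕ) : ℂ)⁻¹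

theorem complexSqrt_sq (z : ℂ) : complexSqrt z ^ 2 = z := Complex.cpow_nat_inv_pow z two_ne_zero

theorem complexSqrt_ofReal {x : ℝ} (hx : 0 < x) : complexSqrt x = ((√x : ℝ) : ℂ) := by
  rw [Real.sqrt_eq_rpow, Complex.ofReal_cpow hx.le, complexSqrt]
  norm_num

theorem re_pos_of_mem_ball {z : ℂ} (hz : z ∈ Metric.ball (1 : ℂ) 1) : 0 < z.re := by
  rw [Metric.mem_ball, Complex.dist_eq] at hz
  have h := (Complex.abs_re_le_norm (z - 1)).trans_lt hz
  rw [Complex.sub_re, Complex.one_re, abs_lt] at h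
  linarith [h.1]

theorem differentiableOn_complexSqrt : DifferentiableOn ℂ complexSqrt (Metric.ball 1 1) :=
  fun _ hz => (DifferentiableAt.cpow_const differentiableAt_id
    (Or.inl (re_pos_of_mem_ball hz))).differentiableWithinAt

theorem complexSqrt_ne_zero {z : ℂ} (hz : z ∈ Metric.ball (1 : ℂ) 1) : complexSqrt z ≠ 0 := by
  intro h
  have h1 := re_pos_of_mem_ball hz
  rw [← complexSqrt_sq z, h] at h1
  simp at h1

/-- A root equal to `-1` would force `z = 1`, where the principal branch takes the value `1`. -/
theorem one_add_complexSqrt_ne_zero (z : ℂ) : 1 + complexSqrt z ≠ 0 := by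
  intro h
  have h1 : complexSqrt z = -1 := by linear_combination h
  have h2 : z = 1 := by rw [← complexSqrt_sq z, h1]; norm_num
  rw [h2, complexSqrt, Complex.one_cpow] at h1
  norm_num at h1

theorem hasSum_taylor_sqrt {y : ℝ} (hy : |y| < 1) :
    HasSum (fun n : ℕ => iteratedDeriv n (fun u => √u) 1 / (n.factorial : ℝ) * y ^ n) √(1 + y) :=
  hasSum_taylor (f := fun u => √u) differentiableOn_complexSqrt (fun x hx => by
    rw [complexSqrt_ofReal hx.1, Complex.ofReal_re]) hy

theorem hasSum_taylor_inv_sqrt {y : ℝ} (hy : |y| < 1) :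
    HasSum (fun n : ℕ => iteratedDeriv n (fun u => 1 / √u) 1 / (n.factorial : ℝ) * y ^ n)
      (1 / √(1 + y)) :=
  hasSum_taylor (f := fun u => 1 / √u) (F := fun z => 1 / complexSqrt z)
    ((differentiableOn_const 1).div differentiableOn_complexSqrt fun _ => complexSqrt_ne_zero)
    (fun x hx => by
      rw [complexSqrt_ofReal hx.1, ← Complex.ofReal_one, ← Complex.ofReal_div, Complex.ofReal_re])
    hy

theorem hasSum_taylor_inv_sqrt_mul {y : ℝ} (hy : |y| < 1) :
    HasSum (fun n : ℕ => iteratedDeriv n (fun u => 1 / (√u * (1 + √u))) 1 / (n.factorial : ℝ)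
      * y ^ n) (1 / (√(1 + y) * (1 + √(1 + y)))) :=
  hasSum_taylor (f := fun u => 1 / (√u * (1 + √u)))
    (F := fun z => 1 / (complexSqrt z * (1 + complexSqrt z)))
    ((differentiableOn_const 1).div (differentiableOn_complexSqrt.mul
      ((differentiableOn_const 1).add differentiableOn_complexSqrt)) fun z hz =>
        mul_ne_zero (complexSqrt_ne_zero hz) (one_add_complexSqrt_ne_zero z))
    (fun x hx => by
      rw [complexSqrt_ofReal hx.1, ← Complex.ofReal_one, ← Complex.ofReal_add, ← Complex.ofReal_mul,
        ← Complex.ofReal_div, Complex.ofReal_re])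
    hy

/-! ### Evaluation of Laurent series at a real speed of light. -/

/-- The formal series `S` in `1/c` converges to `a` at `1/c = z`. -/
def EvalsTo (z : ℝ) (S : LaurentSeries ℝ) (a : ℝ) : Prop := HasSum (fun k : ℤ => S.coeff k * z ^ k) a

section EvalsTo

variable {z : ℝ} {S T : LaurentSeries ℝ} {a b : ℝ}

theorem EvalsTo.add (hS : EvalsTo z S a) (hT : EvalsTo z T b) : EvalsTo z (S + T) (a + b) := by
  simpa only [EvalsTo, HahnSeries.coeff_add, add_mul] using HasSum.add hS hT

theorem EvalsTo.sub (hS : EvalsTo z S a) (hT : EvalsTo z T b) : EvalsTo z (S - T) (a - b) := by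
  simpa only [EvalsTo, HahnSeries.coeff_sub, sub_mul] using HasSum.sub hS hT

theorem EvalsTo.smul (r : ℝ) (hS : EvalsTo z S a) : EvalsTo z (r • S) (r * a) := by
  simpa only [EvalsTo, HahnSeries.coeff_smul, smul_eq_mul, mul_assoc] using HasSum.mul_left r hS

theorem EvalsTo.sum {ι : Type*} {s : Finset ι} {S : ι → LaurentSeries ℝ} {a : ι → ℝ}
    (h : ∀ i ∈ s, EvalsTo z (S i) (a i)) : EvalsTo z (∑ i ∈ s, S i) (∑ i ∈ s, a i) := by
  induction s using Finset.cons_induction with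
  | empty =>
    simp only [Finset.sum_empty, EvalsTo, HahnSeries.coeff_zero, zero_mul]
    exact hasSum_zero
  | cons i s hi ih =>
    rw [Finset.sum_cons, Finset.sum_cons]
    exact (h i (Finset.mem_cons_self i s)).add (ih fun j hj => h j (Finset.mem_cons_of_mem hj))

/-- `S` is a formal series, with value `a` at `1/c = z`, by which one may multiply convergent
series. -/
def Multiplier (z : ℝ) (S : LaurentSeries ℝ) (a : ℝ) : Prop :=
  ∀ ⦃T b⦄, EvalsTo z T b → EvalsTo z (T * S) (b * a)

/-- Multiplication by a monomial only shifts the index of summation. Every term of the Hamiltonian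
contains at most one infinite series, the rest being Laurent polynomials, so no Cauchy products are
needed. -/
theorem multiplier_single (hz : z ≠ 0) (n : ℤ) (r : ℝ) :
    Multiplier z (HahnSeries.single n r) (r * z ^ n) := fun T b h => by
  have h1 := (Equiv.hasSum_iff (Equiv.subRight n)).2 h
  have h2 := h1.mul_right (r * z ^ n)
  refine h2.congr_fun fun k => ?_
  simp only [HahnSeries.coeff_mul_single, Function.comp, Equiv.subRight_apply]
  rw [zpow_sub₀ hz]
  field_simp

theorem Multiplier.mul (hS : Multiplier z S a) (hT : Multiplier z T b) :
    Multiplier z (S * T) (a * b) := fun U c h => by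
  rw [← mul_assoc, ← mul_assoc]
  exact hT (hS h)

theorem Multiplier.add (hS : Multiplier z S a) (hT : Multiplier z T b) :
    Multiplier z (S + T) (a + b) := fun U c h => by
  rw [mul_add, mul_add]
  exact (hS h).add (hT h)

theorem Multiplier.sub (hS : Multiplier z S a) (hT : Multiplier z T b) :
    Multiplier z (S - T) (a - b) := fun U c h => by
  rw [mul_sub, mul_sub]
  exact (hS h).sub (hT h)

theorem Multiplier.smul (r : ℝ) (hS : Multiplier z S a) : Multiplier z (r • S) (r * a) :=
  fun U c h => by
    rw [laurent_mul_smul, mul_left_comm]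
    exact (hS h).smul r

theorem Multiplier.mul_evalsTo (hS : Multiplier z S a) (hT : EvalsTo z T b) :
    EvalsTo z (S * T) (a * b) := by
  rw [mul_comm S, mul_comm a]
  exact hS hT

theorem multiplier_const (hz : z ≠ 0) (r : ℝ) : Multiplier z (const r) r := by
  have h : (const r : LaurentSeries ℝ) = HahnSeries.single 0 r :=
    (HahnSeries.ofPowerSeries_C r)
  rw [h]
  simpa using multiplier_single hz 0 r

theorem multiplier_invLight (hz : z ≠ 0) : Multiplier z (invLight ℝ) z := by
  have h := multiplier_single hz 1 1
  rwa [zpow_one, one_mul] at h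

theorem Multiplier.evalsTo (hS : Multiplier z S a) : EvalsTo z S a := by
  have h : EvalsTo z 1 1 := by
    have := hasSum_ite_eq (0 : ℤ) (1 : ℝ)
    refine this.congr_fun fun k => ?_
    rw [HahnSeries.coeff_one]
    split_ifs with h <;> simp [h]
  simpa using hS h

theorem multiplier_dot {v w : Fin 3 → LaurentSeries ℝ} {a b : Fin 3 → ℝ}
    (hv : ∀ i, Multiplier z (v i) (a i)) (hw : ∀ i, Multiplier z (w i) (b i)) :
    Multiplier z (v ⬝ᵥ w) (a ⬝ᵥ b) := by
  simp only [dotProduct, Fin.sum_univ_three]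
  exact (((hv 0).mul (hw 0)).add ((hv 1).mul (hw 1))).add ((hv 2).mul (hw 2))

theorem multiplier_cross {v w : Fin 3 → LaurentSeries ℝ} {a b : Fin 3 → ℝ}
    (hv : ∀ i, Multiplier z (v i) (a i)) (hw : ∀ i, Multiplier z (w i) (b i)) (i : Fin 3) :
    Multiplier z (cross v w i) (cross a b i) := by
  fin_cases i
  · exact ((hv 1).mul (hw 2)).sub ((hv 2).mul (hw 1))
  · exact ((hv 2).mul (hw 0)).sub ((hv 0).mul (hw 2))
  · exact ((hv 0).mul (hw 1)).sub ((hv 1).mul (hw 0))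

/-- With numerical `π` the argument is a monomial of degree `2` in `1/c`. Its `n`-th power sits in
degree `2n` alone, so the series in `1/c` is the Taylor series spread over the even exponents. -/
theorem evalsTo_gammaFun {m c : ℝ} (hm : m ≠ 0) (hc : c ≠ 0) {π : Fin 3 → ℝ} {f : ℝ → ℝ} {v : ℝ}
    (h : HasSum (fun n : ℕ => iteratedDeriv n f 1 / (n.factorial : ℝ)
      * ((π ⬝ᵥ π) / (m * c) ^ 2) ^ n) v) :
    EvalsTo (1 / c) (gammaFun m (fun i => PowerSeries.C (π i)) f) v := by
  have hT : (1 / m ^ 2) • (PowerSeries.X ^ 2 * ((fun i => PowerSeries.C (π i)) ⬝ᵥ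
      fun i => PowerSeries.C (π i))) = PowerSeries.monomial 2 ((π ⬝ᵥ π) / m ^ 2) := by
    have h1 : ((fun i => PowerSeries.C (π i)) ⬝ᵥ fun i => PowerSeries.C (π i))
        = PowerSeries.C (π ⬝ᵥ π) := by
      simp [dotProduct]
    rw [h1, PowerSeries.monomial_eq_mk]
    ext k
    rw [PowerSeries.coeff_smul, PowerSeries.coeff_mul_C, PowerSeries.coeff_X_pow,
      PowerSeries.coeff_mk]
    split_ifs <;> simp [div_eq_inv_mul]
  rw [gammaFun, hT]
  have hcoeff : ∀ k, PowerSeries.coeff k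
      (taylorOnePlus f (PowerSeries.monomial 2 ((π ⬝ᵥ π) / m ^ 2)))
      = ∑ n ∈ Finset.range (k + 1), if k = n * 2 then
        iteratedDeriv n f 1 / (n.factorial : ℝ) * ((π ⬝ᵥ π) / m ^ 2) ^ n else 0 := fun k => by
    rw [taylorOnePlus, PowerSeries.coeff_mk]
    refine Finset.sum_congr rfl fun n _ => ?_
    rw [PowerSeries.monomial_pow, PowerSeries.coeff_monomial, smul_ite, smul_zero, smul_eq_mul]
  have hinj : Function.Injective fun n : ℕ => ((n * 2 : ℕ) : ℤ) := fun a b h => by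
    have h1 : ((a * 2 : ℕ) : ℤ) = ((b * 2 : ℕ) : ℤ) := h
    omega
  refine (hinj.hasSum_iff fun k hk => ?_).1 (h.congr_fun fun n => ?_)
  · rcases lt_or_ge k 0 with h0 | h0
    · rw [coeff_toLaurent_of_neg _ h0, zero_mul]
    · lift k to ℕ using h0
      rw [coeff_toLaurent_natCast, hcoeff, Finset.sum_eq_zero, zero_mul]
      intro n _
      rw [if_neg]
      rintro rfl
      exact hk ⟨n, rfl⟩
  · rw [Function.comp, coeff_toLaurent_natCast, hcoeff, Finset.sum_eq_single n, if_pos rfl,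
      zpow_natCast, pow_mul', mul_assoc, ← mul_pow, mul_pow m]
    · congr 2
      field_simp
    · intro k _ hk
      rw [if_neg]
      omega
    · intro hn
      exact absurd (Finset.mem_range.2 (by omega)) hn

/-- The formal series of the classical Hamiltonian converges to the classical Hamiltonian. -/
theorem evalsTo_formalHamiltonian {m c : ℝ} (hm : 0 < m) (hc : 0 < c) (q g φ : ℝ)
    (E B π s : Fin 3 → ℝ) (hπ : π ⬝ᵥ π < m ^ 2 * c ^ 2) :
    EvalsTo (1 / c) (formalHamiltonian m q (c * g) φ E B (fun i => PowerSeries.C (π i)) s)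
      (classicalHamiltonian m c q g φ E B π s) := by
  have hz : 1 / c ≠ 0 := one_div_ne_zero hc.ne'
  have hmc : 0 < m * c := mul_pos hm hc
  set y := (π ⬝ᵥ π) / (m * c) ^ 2 with hy
  have hy0 : 0 ≤ y := by
    refine div_nonneg ?_ (sq_nonneg _)
    exact Finset.sum_nonneg fun i _ => mul_self_nonneg (π i)
  have hy1 : |y| < 1 := by
    rw [abs_of_nonneg hy0, hy, div_lt_one (by positivity), mul_pow]
    exact hπ
  have hγ := evalsTo_gammaFun hm.ne' hc.ne' (hasSum_taylor_sqrt hy1)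
  have hil := evalsTo_gammaFun hm.ne' hc.ne' (hasSum_taylor_inv_sqrt hy1)
  have hilm := evalsTo_gammaFun hm.ne' hc.ne' (hasSum_taylor_inv_sqrt_mul hy1)
  have hlight : Multiplier (1 / c) (light ℝ ^ 2) (c ^ 2) := by
    have h1 : Multiplier (1 / c) (light ℝ) c := by
      have := multiplier_single hz (-1) 1
      rwa [show (1 : ℝ) * (1 / c) ^ (-1 : ℤ) = c by simp] at this
    rw [pow_two, pow_two]
    exact h1.mul h1
  have hiL := multiplier_invLight hz
  -- The formal coupling is `(c g)/c` with `c g` treated as a constant, so that its value is the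
  -- gyromagnetic ratio `g`.
  have hγ' : Multiplier (1 / c) ((c * g) • invLight ℝ) g := by
    have := hiL.smul (c * g)
    rwa [show c * g * (1 / c) = g by field_simp] at this
  have he : Multiplier (1 / c) ((q / m) • invLight ℝ) (q / (m * c)) := by
    have := hiL.smul (q / m)
    rwa [show q / m * (1 / c) = q / (m * c) by field_simp] at this
  have hu : ∀ i, Multiplier (1 / c) ((1 / m) • (invLight ℝ * toLaurent (PowerSeries.C (π i))))
      (((1 / (m * c)) • π) i) := fun i => by
    have := (hiL.mul (multiplier_const hz (π i))).smul (1 / m)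
    rwa [show 1 / m * (1 / c * π i) = ((1 / (m * c)) • π) i by
      rw [Pi.smul_apply, smul_eq_mul]; field_simp] at this
  have hreal : ∀ (v : Fin 3 → ℝ) i, Multiplier (1 / c) (realVec ℝ v i) (v i) := fun v i =>
    multiplier_const hz (v i)
  have hkin : EvalsTo (1 / c) (kineticEnergy m fun i => PowerSeries.C (π i))
      √(m ^ 2 * c ^ 4 + c ^ 2 * (π ⬝ᵥ π)) := by
    have h1 := (hlight.mul_evalsTo hγ).smul m
    have h2 : m ^ 2 * c ^ 4 + c ^ 2 * (π ⬝ᵥ π) = (m * c ^ 2) ^ 2 * (1 + y) := by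
      rw [hy]
      field_simp
    rw [h2, Real.sqrt_mul (sq_nonneg _), Real.sqrt_sq (by positivity), mul_assoc]
    exact h1
  refine (hkin.add ((multiplier_const hz φ).evalsTo.smul q)).sub (EvalsTo.sum fun i _ =>
    (multiplier_const hz (s i)).mul_evalsTo ?_)
  exact (hreal B i (hγ'.evalsTo.add (he.mul_evalsTo hil))).sub
    (hu i (multiplier_dot hu (hreal B) (hγ'.mul_evalsTo hilm))) |>.sub
    (multiplier_cross hu (hreal E) i ((hγ'.mul_evalsTo hil).add (he.mul_evalsTo hilm)))

end EvalsTo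

end DiracPauli

/-! ### The main theorem. -/

open DiracPauli in
theorem mainTheorem1 (m ħ q μ : ℝ) (hm : 0 < m) (hħ : 0 < ħ) (F : HomogeneousField) :
    -- existence and uniqueness of `𝒳` and of its formal adjoint `𝒳†`
    (∀ t : ℝ, (∃! 𝒳 : PowerSeries Op, KutzelniggCondition m ħ q μ (F.scale t) 𝒳) ∧
      ∀ 𝒳 : PowerSeries Op, KutzelniggCondition m ħ q μ (F.scale t) 𝒳 →
        PowerSeries.constantCoeff 𝒳 = 0 ∧
        ∃! Xd : PowerSeries Op, IsSeriesAdjoint (toLaurent 𝒳) (toLaurent Xd)) ∧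
    -- the Foldy-Wouthuysen transformation with `𝒳 = X + X'`
    (∀ X X' Xd : ℝ → PowerSeries Op,
      (∀ t, KutzelniggCondition m ħ q 0 (F.scale t) (X t)) →
      (∀ t, KutzelniggCondition m ħ q μ (F.scale t) (X t + X' t)) →
      (∀ t, IsSeriesAdjoint (toLaurent (X t + X' t)) (toLaurent (Xd t))) →
      -- exact block diagonalization by a unitary
      (∀ t, let U := transform (X t + X' t) (Xd t)
        let Ud := transformAdjoint (X t + X' t) (Xd t)
        let H := transformed m ħ q μ (F.scale t) (X t + X' t) (Xd t)
        (∀ i j, IsSeriesAdjoint (U i j) (Ud j i)) ∧ U * Ud = 1 ∧ Ud * U = 1 ∧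
        H 0 1 = 0 ∧ H 1 0 = 0 ∧
        fwHamiltonian m ħ q μ (F.scale t) (X t + X' t) (Xd t)
          = kutzelniggHamiltonian m ħ q μ (F.scale t) (X t + X' t) (Xd t) ∧
        IsSeriesAdjoint (fwHamiltonian m ħ q μ (F.scale t) (X t + X' t) (Xd t))
          (fwHamiltonian m ħ q μ (F.scale t) (X t + X' t) (Xd t))) ∧
      -- `X'` is of first order in the fields
      EqModOrder 1 (fun t => toLaurent (X' t)) (fun _ => 0) ∧
      -- the Hamiltonian up to terms that are linear in the fields
      EqModOrder 2 (fun t => fwHamiltonian m ħ q μ (F.scale t) (X t + X' t) (Xd t))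
        (fun t => weakFieldDiracPauli m ħ q μ (F.scale t))) ∧
    -- agreement with the classical Hamiltonian: `s = ħσ/2` and `μ' = ħγ'/2`
    (∀ g : ℝ, μ = ħ / 2 * g →
      weakFieldDiracPauli m ħ q μ F
        = formalHamiltonian m q g (potential F) F.E F.B (kinematic ħ q F)
            (fun i => (ħ / 2) • sigma i)) ∧
    (∀ (c g φ : ℝ) (E B π s : Fin 3 → ℝ), 0 < c → π ⬝ᵥ π < m ^ 2 * c ^ 2 →
      HasSum (fun k : ℤ =>
          (formalHamiltonian m q (c * g) φ E B (fun i => PowerSeries.C (π i)) s).coeff k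
            * (1 / c) ^ k)
        (classicalHamiltonian m c q g φ E B π s)) ∧
    -- reduction to the Dirac Hamiltonian for `μ' = 0`
    (∀ X Xd : ℝ → PowerSeries Op,
      (∀ t, KutzelniggCondition m ħ q 0 (F.scale t) (X t)) →
      (∀ t, IsSeriesAdjoint (toLaurent (X t)) (toLaurent (Xd t))) →
      EqModOrder 2 (fun t => fwHamiltonian m ħ q 0 (F.scale t) (X t) (Xd t))
        (fun t => weakFieldDirac m ħ q (F.scale t))) ∧
    weakFieldDiracPauli m ħ q 0 F = weakFieldDirac m ħ q F := by
  refine ⟨fun t => existsUnique_solution hm.ne', fun X X' Xd hX hX' hXd => ⟨fun t => ?_, ?_, ?_⟩,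
    ?_, ?_, fun X Xd hX hXd => ?_, weakFieldDiracPauli_zero m ħ q F⟩
  · obtain ⟨h1, h2⟩ := transform_unitary (xd := Xd t) hm.ne' (hX' t)
    obtain ⟨h3, h4, -⟩ := transformed_blocks hm.ne' (hX' t) (hXd t)
    exact ⟨transform_adjoint (isSeriesAdjoint_toLaurent.1 (hXd t)), h1, h2, h3, h4,
      fwHamiltonian_eq_kutzelnigg hm.ne' (hX' t) (hXd t),
      fwHamiltonian_adjoint hm.ne' (hX' t) (hXd t)⟩
  · exact eqModOrder_solution hm.ne' hX hX'
  · exact eqModOrder_fwHamiltonian hm.ne' hX' hXd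
  · rintro g rfl
    exact weakFieldDiracPauli_eq_formalHamiltonian m ħ q g F
  · intro c g φ E B π s hc hπ
    exact evalsTo_formalHamiltonian hm hc q g φ E B π s hπ
  · simpa only [weakFieldDiracPauli_zero] using eqModOrder_fwHamiltonian hm.ne' hX hXd
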